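/- **Model.** A single machine is, at each time $t\ge 0$, asleep (power $0$) or active; when active it runs at a speed $s\ge 0$ and draws power $P(s)=s^{\alpha}+g$, where $\alpha\ge 1$ and $g\ge 0$. It is asleep before time $0$, and each transition from the sleep state to the active state costs $A>0$. Finitely many jobs $j$ arrive online, with release times $r_j\ge 0$, deadlines $d_j>r_j$ and volumes $p_j>0$. A schedule assigns to each job $j$ a measurable speed $s_j(t)\ge 0$, the speed of the machine being $s(t)=\sum_j s_j(t)$ (preemption is allowed); it is feasible if every job receives volume at least $p_j$ during $[r_j,d_j]$ at times at which the machine is active. Its total energy is $\int_{\text{active}}P(s(t))\,dt$ plus $A$ times the number of wake-ups. Let $s^c$ be the critical speed, that is, a minimiser of $P(s)/s$ over $s>0$, which is assumed to exist (for $\alpha>1$ it exists exactly when $g>0$); if $g=0$, the value $s^c=0$ is allowed as well. **Algorithm (Sleep-aware Optimal Available, in primal-dual form).** At each time $\tau$ a tentative speed profile on $[\tau,\infty)$ is computed from the released unfinished (pending) jobs: start from the zero profile, take the pending jobs in earliest-deadline-first order, and for each of them add its remaining volume continuously on $[\tau,d_j)$, always at the times at which the current speed of the profile (hence the marginal power $P'$)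 is smallest. Let $\rho(\tau)$ be the value at $\tau$ of the resulting profile. The machine is initially asleep, and obeys the following rules. * *Working state:* if $\rho(\tau)>0$, process pending jobs with the earliest deadline at speed $\max\{\rho(\tau),s^c\}$; if $\rho(\tau)=0$, switch to the idle state. * *Idle state* (active, speed $0$): if $\rho(\tau)>0$ and $\rho(\tau)\ge s^c$, switch to the working state; otherwise, if the total idle time since the last wake-up has reached $A/g$ (never, if $g=0$), switch to the sleep state. * *Sleep state:* if $\rho(\tau)>0$ and $\rho(\tau)\ge s^c$, switch to the working state. **Theorem.** For every instance the algorithm is well defined (a schedule obeying these rules exists), and every schedule obeying these rules is feasible and has total energy at most $\max\{4,\alpha^{\alpha}\}$ times the total energy of any feasible schedule. That is, the algorithm is $\max\{4,\alpha^{\alpha}\}$-competitive. -/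

import Mathlib

open Set Filter Topology MeasureTheory

namespace SpeedScaling

/-- A job: release time, deadline and processing volume. -/
structure Job where
  release : ℝ
  deadline : ℝ
  volume : ℝ
  release_nonneg : 0 ≤ release
  release_lt_deadline : release < deadline
  volume_pos : 0 < volume

/-- Power drawn by the active machine at speed `s`: dynamic power `s ^ α` plus static power `g`. -/
noncomputable def power (α g s : ℝ) : ℝ := s ^ α + g

/-- `sc` is the critical speed: a minimiser over `s > 0` of the energy per unit of work
`power α g s / s`.  For `g = 0` and `α > 1` the infimum is only approached as `s → 0`, and the
critical speed is then `0` by convention. -/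
def IsCriticalSpeed (α g sc : ℝ) : Prop :=
  (0 < sc ∧ ∀ s : ℝ, 0 < s → power α g sc / sc ≤ power α g s / s) ∨ (g = 0 ∧ sc = 0)

/-! ### Schedules and their energy -/

/-- A (preemptive) schedule on one machine: `rate j t` is the speed spent on job `j` at time `t`,
and `active` is the set of times at which the machine is not in the sleep state.  The machine is
asleep before time `0`. -/
structure Schedule (n : ℕ) where
  rate : Fin n → ℝ → ℝ
  active : Set ℝ
  rate_nonneg : ∀ j t, 0 ≤ rate j t
  measurable_rate : ∀ j, Measurable (rate j)
  measurableSet_active : MeasurableSet active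
  active_subset : active ⊆ Ici 0

namespace Schedule

variable {n : ℕ}

/-- Speed of the machine. -/
noncomputable def speed (S : Schedule n) (t : ℝ) : ℝ := ∑ j, S.rate j t

/-- Every job receives its whole volume between its release time and its deadline, at times at
which the machine is active. -/
def Feasible (S : Schedule n) (jobs : Fin n → Job) : Prop :=
  ∀ j, ENNReal.ofReal (jobs j).volume ≤
    ∫⁻ t in Icc (jobs j).release (jobs j).deadline ∩ S.active, ENNReal.ofReal (S.rate j t)

/-- Number of transitions from the sleep state to the active state: the largest `m` (possibly
infinite) such that there are times `t 0 < t 1 < ⋯ < t (2 * m - 1)` at which the machine is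
alternately asleep and active. -/
noncomputable def wakeUps (S : Schedule n) : ENNReal :=
  ⨆ (m : ℕ) (_ : ∃ t : ℕ → ℝ, StrictMono t ∧
    ∀ i < m, t (2 * i) ∉ S.active ∧ t (2 * i + 1) ∈ S.active), (m : ENNReal)

/-- Total energy: the energy consumed in the active state plus `A` for each wake-up. -/
noncomputable def energy (α g A : ℝ) (S : Schedule n) : ENNReal :=
  (∫⁻ t in S.active, ENNReal.ofReal (power α g (S.speed t))) + ENNReal.ofReal A * S.wakeUps

/-- Volume of job `j` that is still unprocessed at time `t`. -/
noncomputable def remaining (S : Schedule n) (jobs : Fin n → Job) (j : Fin n) (t : ℝ) : ℝ :=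
  (jobs j).volume - ∫ u in Iio t, S.rate j u

/-- Job `j` has been released and is not finished at time `t`. -/
def Pending (S : Schedule n) (jobs : Fin n → Job) (j : Fin n) (t : ℝ) : Prop :=
  (jobs j).release ≤ t ∧ 0 < S.remaining jobs j t

end Schedule

/-! ### The tentative (primal-dual) speed plan -/

/-- Level reached when a volume `v` is poured over the speed profile `s` on `[τ, d)`, always at
the times where the current speed, hence the marginal power, is smallest. -/
noncomputable def fillLevel (s : ℝ → ℝ) (τ d v : ℝ) : ℝ :=
  sSup {L : ℝ | 0 ≤ L ∧ ∫ u in Ico τ d, max (L - s u) 0 ≤ v}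

open Classical in
/-- The speed profile after a volume `v` has been added to the profile `s` on `[τ, d)`,
continuously at the times of smallest marginal power. -/
noncomputable def waterFill (s : ℝ → ℝ) (τ d v : ℝ) : ℝ → ℝ :=
  fun u => if u ∈ Ico τ d then max (s u) (fillLevel s τ d v) else s u

open Classical in
/-- All jobs in earliest-deadline-first order. -/
noncomputable def edfOrder {n : ℕ} (jobs : Fin n → Job) : List (Fin n) :=
  (List.finRange n).insertionSort fun i j => (jobs i).deadline ≤ (jobs j).deadline

open Classical in
/-- The tentative speed profile computed at time `τ`: starting from the zero profile, the pending
jobs are taken in earliest-deadline-first order and the remaining volume of each of them is added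
between `τ` and its deadline at the times of smallest marginal power. -/
noncomputable def plan {n : ℕ} (jobs : Fin n → Job) (S : Schedule n) (τ : ℝ) : ℝ → ℝ :=
  ((edfOrder jobs).filter fun j => S.Pending jobs j τ).foldl
    (fun s j => waterFill s τ (jobs j).deadline (S.remaining jobs j τ)) (fun _ => 0)

/-- The tentative speed at the current time `τ`. -/
noncomputable def plannedSpeed {n : ℕ} (jobs : Fin n → Job) (S : Schedule n) (τ : ℝ) : ℝ :=
  plan jobs S τ τ

/-! ### The algorithm -/

/-- States of the machine: asleep; active at speed `0`; active and executing jobs. -/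
inductive Mode where
  | sleep
  | idle
  | working

/-- Total time spent in the idle state since the last wake-up. -/
noncomputable def idleTime (mode : ℝ → Mode) (t : ℝ) : ℝ :=
  (volume {u : ℝ | u < t ∧ mode u = Mode.idle ∧ ∀ v ∈ Ico u t, mode v ≠ Mode.sleep}).toReal

open Classical in
/-- State chosen from the preceding state, the critical speed `sc`, the tentative speed `ρ`, and
the information whether the idle time since the last wake-up has used up its budget. -/
noncomputable def nextMode (sc ρ : ℝ) (expired : Prop) : Mode → Mode
  | Mode.working =>
      if 0 < ρ then Mode.working else if expired then Mode.sleep else Mode.idle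
  | Mode.idle =>
      if 0 < ρ ∧ sc ≤ ρ then Mode.working else if expired then Mode.sleep else Mode.idle
  | Mode.sleep =>
      if 0 < ρ ∧ sc ≤ ρ then Mode.working else Mode.sleep

/-- `S`, with machine states `mode`, is the schedule produced by Sleep-aware Optimal Available on
the given jobs.  The decisions at time `t` use only the jobs released by time `t`, and what has
been processed before. -/
structure IsSOARun {n : ℕ} (g A sc : ℝ) (jobs : Fin n → Job)
    (mode : ℝ → Mode) (S : Schedule n) : Prop where
  initial : ∀ t < 0, mode t = Mode.sleep
  active_iff : ∀ t, t ∈ S.active ↔ mode t ≠ Mode.sleep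
  integrable_rate : ∀ j, Integrable (S.rate j)
  /-- The state is locally constant to the left and to the right of every time `t`, and the state
  at `t` follows from the state just before `t`.  The idle budget is used up when the static
  energy of the idle time reaches `A`, that is, after idle time `A / g`. -/
  step : ∀ t, ∃ m : Mode, (∀ᶠ u in 𝓝[<] t, mode u = m) ∧
    mode t = nextMode sc (plannedSpeed jobs S t) (A ≤ g * idleTime mode t) m ∧
    ∀ᶠ u in 𝓝[>] t, mode u = mode t
  rate_eq_zero : ∀ t, mode t ≠ Mode.working → ∀ j, S.rate j t = 0
  speed_eq : ∀ t, mode t = Mode.working → S.speed t = max (plannedSpeed jobs S t) sc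
  earliest_deadline : ∀ t j, 0 < S.rate j t → S.Pending jobs j t ∧
    ∀ k, S.Pending jobs k t → (jobs j).deadline ≤ (jobs k).deadline

end SpeedScaling

namespace SpeedScaling

/-! ### Water filling -/

section WaterFill

variable {s : ℝ → ℝ} {τ d v : ℝ}

/-! The planned speed at `τ` is the largest density of pending work: the maximum over `x > τ` of the
remaining volume due by `x`, divided by `x - τ` (`sum_remaining_le_plannedSpeed_mul`,
`exists_plannedSpeed_mul_le`). Everything later uses the plan only through this characterisation.

Working energy. Since `sc` minimises `P(s)/s`, the static power is `(α - 1) * sc ^ α`, and for `s ≥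
sc` the power `P(s)` equals `P'(sc) * s` plus the integral of `P''(y) * (s - y)` over `y` from `sc`
to `s` (`ofReal_power_eq`). It therefore suffices to bound, for each level `y ≥ sc`, the work done
above speed `y`. On each component of `{speed > y}`, work released earlier fits below level `y`, and
the rest belongs to jobs whose whole lifetime lies in the component (`lintegral_component_le`). Any
feasible schedule `S'` must process those jobs while the speed of the run exceeds `y`. Integrating
over `y` bounds the working energy `W` by the integral of `s' * P'(max s sc)` over the active times
of `S'` (`working_energy_le`). Young's inequality turns this into `α * W ≤ (α - 1) * W + c * E'`,
where `E'` is the active energy of `S'` and `c = max 4 (α ^ α)`. At idle times there is slack `2 *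
g`, which is kept for the idle account (`working_energy_add_le`).

Idle and wake-up energy. If `g > 0`, each period from a wake-up to the next sleep has idle energy
exactly `A`, so idling and wake-up cost `2 * A` together. If `S'` is active at all idle times of the
period, the slack `2 * g` pays for it. Otherwise `S'` sleeps at some idle time of the period, and
two such periods together force a wake-up of `S'` (`card_le_two_mul_wakeUps`); hence the charge of
`4 * A` per wake-up of `S'`. If `g = 0` the machine wakes up at most once.

Existence. Runs are built piece by piece; an integer potential, decreasing from piece to piece,
shows that finitely many pieces suffice (`IsRunBefore.exists_isSOARun`). -/

theorem integrableOn_of_antitoneOn (hs : AntitoneOn s (Ici τ)) (x : ℝ) :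
    IntegrableOn s (Ico τ x) :=
  ((hs.mono Icc_subset_Ici_self).integrableOn_isCompact isCompact_Icc).mono_set Ico_subset_Icc_self

theorem integrableOn_max_sub (hs : AntitoneOn s (Ici τ)) (L x : ℝ) :
    IntegrableOn (fun u => max (L - s u) 0) (Ico τ x) :=
  (((integrableOn_const (C := L) (s := Ico τ x) measure_Ico_lt_top.ne).sub
    (integrableOn_of_antitoneOn hs x))).pos_part

theorem continuous_integral_max_sub (hs : AntitoneOn s (Ici τ)) :
    Continuous fun L => ∫ u in Ico τ d, max (L - s u) 0 := by
  have : LipschitzWith (Real.toNNReal (volume.real (Ico τ d)))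
      fun L => ∫ u in Ico τ d, max (L - s u) 0 := by
    refine LipschitzWith.of_dist_le_mul fun L L' => ?_
    rw [Real.dist_eq, Real.dist_eq, ← integral_sub (integrableOn_max_sub hs L d)
      (integrableOn_max_sub hs L' d), Real.coe_toNNReal _ measureReal_nonneg, mul_comm]
    refine norm_setIntegral_le_of_norm_le_const (μ := volume) (s := Ico τ d)
      (f := fun u => max (L - s u) 0 - max (L' - s u) 0) (C := |L - L'|) measure_Ico_lt_top fun u _ => ?_
    rw [Real.norm_eq_abs]
    refine (abs_max_sub_max_le_abs _ _ _).trans_eq ?_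
    congr 1
    ring
  exact this.continuous

/-- The volume held below level `L` is continuous and monotone in `L`, vanishes at `0` and
eventually exceeds `v`. So the supremum defining `fillLevel` is attained, and the volume poured is
exactly `v`. -/
theorem fillLevel_spec (hs : AntitoneOn s (Ici τ)) (h0 : ∀ u, 0 ≤ s u) (hd : τ < d)
    (hv : 0 ≤ v) :
    0 ≤ fillLevel s τ d v ∧ ∫ u in Ico τ d, max (fillLevel s τ d v - s u) 0 = v := by
  set f : ℝ → ℝ := fun L => ∫ u in Ico τ d, max (L - s u) 0 with hf
  have hcont : Continuous f := continuous_integral_max_sub hs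
  have hmono : Monotone f := fun L L' h =>
    setIntegral_mono (integrableOn_max_sub hs L d) (integrableOn_max_sub hs L' d)
      fun u => max_le_max (by linarith) le_rfl
  have hf0 : f 0 = 0 := by
    have : ∀ u, max (0 - s u) 0 = 0 := fun u => max_eq_right (by linarith [h0 u])
    simp [hf, h0]
  have hgrow : ∀ L, (L - s τ) * (d - τ) ≤ f L := by
    intro L
    have : ∫ _ in Ico τ d, (L - s τ) ≤ f L := by
      refine setIntegral_mono_on (integrableOn_const measure_Ico_lt_top.ne) (integrableOn_max_sub hs L d)
        measurableSet_Ico fun u hu => le_max_of_le_left ?_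
      have := hs self_mem_Ici (mem_Ici.2 hu.1) hu.1
      linarith
    rw [setIntegral_const, smul_eq_mul, Real.volume_real_Ico_of_le hd.le] at this
    linarith
  -- As `s ≤ s τ` on `[τ, d)`, the rectangle between the levels `s τ` and `B`, of area `v + 1`, lies
  -- above the profile.
  set B := s τ + (v + 1) / (d - τ) with hB
  have hdpos : 0 < d - τ := sub_pos.2 hd
  have hfB : v + 1 ≤ f B := by
    have := hgrow B
    rw [hB, add_sub_cancel_left, div_mul_cancel₀ _ hdpos.ne'] at this
    exact this
  set K : Set ℝ := {L : ℝ | 0 ≤ L ∧ f L ≤ v} with hK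
  have hbdd : BddAbove K := ⟨B, fun L hL => le_of_not_gt fun h => by
    have := hmono h.le
    linarith [hL.2]⟩
  have hB0 : 0 ≤ B := add_nonneg (h0 τ) (by positivity)
  obtain ⟨L₀, hL₀, hL₀v⟩ : ∃ L ∈ Icc 0 B, f L = v :=
    intermediate_value_Icc hB0 hcont.continuousOn ⟨by rw [hf0]; exact hv, by linarith⟩
  have hmem : L₀ ∈ K := ⟨hL₀.1, hL₀v.le⟩
  have hclosed : IsClosed K :=
    (isClosed_le continuous_const continuous_id).inter (isClosed_le hcont continuous_const)
  have hsup : fillLevel s τ d v ∈ K := hclosed.csSup_mem ⟨L₀, hmem⟩ hbdd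
  refine ⟨hsup.1, le_antisymm hsup.2 ?_⟩
  calc v = f L₀ := hL₀v.symm
    _ ≤ f (fillLevel s τ d v) := hmono (le_csSup hbdd hmem)

theorem waterFill_of_le (hd : d ≤ τ) : waterFill s τ d v = s := by
  funext u
  simp [waterFill, Ico_eq_empty (not_lt.2 hd)]

end WaterFill

/-- The properties of the profile obtained by pouring the volumes `v j`, for `j` in the list `l`,
between `τ` and the deadlines `d j`. -/
structure IsFilling {ι : Type*} (τ : ℝ) (d v : ι → ℝ) (l : List ι) (s : ℝ → ℝ) : Prop where
  anti : AntitoneOn s (Ici τ)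
  nonneg : ∀ u, 0 ≤ s u
  eq_zero : ∀ u, τ ≤ u → (∀ j ∈ l, d j ≤ u) → s u = 0
  integral_eq : ∀ x, τ < x → (∀ j ∈ l, d j ≤ x) → ∫ u in Ico τ x, s u = (l.map v).sum
  sum_le : ∀ x, τ < x → (l.map fun j => if d j ≤ x then v j else 0).sum ≤ ∫ u in Ico τ x, s u
  le_sum : 0 < s τ → ∃ x, τ < x ∧
    s τ * (x - τ) ≤ (l.map fun j => if d j ≤ x then v j else 0).sum

/-- As `d j` is the latest deadline so far, the old profile is supported before `d j`, and taking
the maximum with a constant on `[τ, d j)` keeps it nonincreasing. For the maximal density there are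
two cases: the new level does not raise `s τ`, and the old witness survives; or it does, the profile
is constant on `[τ, d j)`, and the whole list has density `L` with horizon `d j`. -/
theorem IsFilling.append {ι : Type*} {τ : ℝ} {d v : ι → ℝ} {l : List ι} {s : ℝ → ℝ}
    (h : IsFilling τ d v l s) {j : ι} (hj : τ < d j) (hv : 0 ≤ v j) (hl : ∀ i ∈ l, d i ≤ d j) :
    IsFilling τ d v (l ++ [j]) (waterFill s τ (d j) (v j)) := by
  obtain ⟨hL0, hL⟩ := fillLevel_spec h.anti h.nonneg hj hv
  set L := fillLevel s τ (d j) (v j) with hLdef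
  have hin : ∀ u, u ∈ Ico τ (d j) → waterFill s τ (d j) (v j) u = max (s u) L := fun u hu => by
    simp [waterFill, hu, hLdef]
  have hout : ∀ u, u ∉ Ico τ (d j) → waterFill s τ (d j) (v j) u = s u := fun u hu => by
    simp only [waterFill, if_neg hu]
  have hge : ∀ u, s u ≤ waterFill s τ (d j) (v j) u := fun u => by
    by_cases hu : u ∈ Ico τ (d j)
    · rw [hin u hu]; exact le_max_left _ _
    · rw [hout u hu]
  have hzero : ∀ u, d j ≤ u → waterFill s τ (d j) (v j) u = 0 := fun u hu => by
    rw [hout u (fun h' => absurd h'.2 (not_lt.2 hu))]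
    exact h.eq_zero u (hj.le.trans hu) fun i hi => (hl i hi).trans hu
  have hnn : ∀ u, 0 ≤ waterFill s τ (d j) (v j) u := fun u => (h.nonneg u).trans (hge u)
  have hanti : AntitoneOn (waterFill s τ (d j) (v j)) (Ici τ) := by
    intro a ha b hb hab
    rcases le_or_gt (d j) b with hjb | hjb
    · rw [hzero b hjb]; exact hnn a
    · rw [hin b ⟨hb, hjb⟩, hin a ⟨ha, hab.trans_lt hjb⟩]
      exact max_le_max (h.anti ha hb hab) le_rfl
  have hint := fun x => integrableOn_of_antitoneOn hanti x
  have hvol : ∫ u in Ico τ (d j), waterFill s τ (d j) (v j) u = (l.map v).sum + v j := by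
    have hadd := integral_add (integrableOn_of_antitoneOn h.anti (d j))
      (integrableOn_max_sub h.anti L (d j))
    rw [hL, h.integral_eq _ hj hl] at hadd
    rw [← hadd]
    refine setIntegral_congr_fun measurableSet_Ico fun u hu => ?_
    rw [hin u hu]
    rcases le_total (s u) L with h' | h'
    · rw [max_eq_right h', max_eq_left (by linarith)]; ring
    · rw [max_eq_left h', max_eq_right (by linarith)]; ring
  have hvol' : ∀ x, d j ≤ x →
      ∫ u in Ico τ x, waterFill s τ (d j) (v j) u = (l.map v).sum + v j := fun x hx => by
    rw [← hvol]
    refine (setIntegral_eq_of_subset_of_forall_sdiff_eq_zero measurableSet_Ico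
      (Ico_subset_Ico_right hx) fun u hu => hzero u ?_)
    by_contra hlt
    exact hu.2 ⟨hu.1.1, not_le.1 hlt⟩
  have hmapl : ∀ x, d j ≤ x → (l.map fun i => if d i ≤ x then v i else 0) = l.map v :=
    fun x hx => List.map_congr_left fun i hi => if_pos ((hl i hi).trans hx)
  refine ⟨hanti, hnn, fun u _ hu => hzero u (hu j (by simp)), fun x _ hx => ?_, fun x hx => ?_, ?_⟩
  · rw [hvol' x (hx j (by simp)), List.map_append, List.sum_append]; simp
  · rcases le_or_gt (d j) x with hjx | hjx
    · rw [hvol' x hjx, List.map_append, List.sum_append, hmapl x hjx]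
      simp [hjx]
    · rw [List.map_append, List.sum_append]
      simp only [List.map_cons, List.map_nil, List.sum_cons, List.sum_nil, if_neg (not_le.2 hjx),
        add_zero]
      exact (h.sum_le x hx).trans (setIntegral_mono (integrableOn_of_antitoneOn h.anti x)
        (hint x) hge)
  · intro hpos
    rw [hin τ ⟨le_rfl, hj⟩] at hpos ⊢
    rcases le_total L (s τ) with h' | h'
    · rw [max_eq_left h'] at hpos ⊢
      obtain ⟨x, hx, hsum⟩ := h.le_sum hpos
      refine ⟨x, hx, hsum.trans ?_⟩
      rw [List.map_append, List.sum_append]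
      refine le_add_of_nonneg_right ?_
      simp only [List.map_cons, List.map_nil, List.sum_cons, List.sum_nil, add_zero]
      split_ifs <;> simp [hv]
    · rw [max_eq_right h']
      refine ⟨d j, hj, ?_⟩
      rw [List.map_append, List.sum_append, hmapl _ le_rfl]
      simp only [List.map_cons, List.map_nil, List.sum_cons, List.sum_nil, add_zero, le_refl,
        if_true]
      rw [← hvol]
      have : ∫ u in Ico τ (d j), waterFill s τ (d j) (v j) u = ∫ _ in Ico τ (d j), L := by
        refine setIntegral_congr_fun measurableSet_Ico fun u hu => ?_
        simp only [hin u hu]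
        exact max_eq_right ((h.anti self_mem_Ici (mem_Ici.2 hu.1) hu.1).trans h')
      rw [this, setIntegral_const, smul_eq_mul, Real.volume_real_Ico_of_le hj.le, mul_comm]

theorem isFilling_foldl {ι : Type*} (τ : ℝ) (d v : ι → ℝ) (l : List ι)
    (hd : ∀ j ∈ l, τ < d j) (hv : ∀ j ∈ l, 0 ≤ v j) (hl : l.Pairwise fun i j => d i ≤ d j) :
    IsFilling τ d v l (l.foldl (fun s j => waterFill s τ (d j) (v j)) fun _ => 0) := by
  induction l using List.reverseRecOn with
  | nil => exact ⟨fun _ _ _ _ _ => le_rfl, fun _ => le_rfl, fun _ _ _ => rfl, by simp, by simp,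
      fun h => absurd h (lt_irrefl _)⟩
  | append_singleton l j ih =>
    rw [List.foldl_append]
    rw [List.pairwise_append] at hl
    refine (ih (fun i hi => hd i (by simp [hi])) (fun i hi => hv i (by simp [hi])) hl.1).append
      (hd j (by simp)) (hv j (by simp)) fun i hi => hl.2.2 i hi j (by simp)

theorem foldl_waterFill_filter {ι : Type*} (τ : ℝ) (d v : ι → ℝ) (l : List ι) (s : ℝ → ℝ) :
    l.foldl (fun s j => waterFill s τ (d j) (v j)) s =
      (l.filter fun j => τ < d j).foldl (fun s j => waterFill s τ (d j) (v j)) s := by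
  induction l generalizing s with
  | nil => rfl
  | cons j l ih =>
    by_cases h : τ < d j
    · simp [h, ih]
    · simp [h, ih, waterFill_of_le (not_lt.1 h)]

theorem sum_map_filter_ite {ι : Type*} (p : ι → Prop) [DecidablePred p] (f : ι → ℝ)
    (l : List ι) : ((l.filter fun j => p j).map f).sum = (l.map fun j => if p j then f j else 0).sum := by
  induction l with
  | nil => rfl
  | cons j l ih => by_cases h : p j <;> simp [h, ih]

/-! ### The planned speed as the maximal density of pending work -/

section Plan

variable {n : ℕ} (jobs : Fin n → Job) (S : Schedule n) (τ : ℝ)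

open Classical in
theorem sum_edfOrder (f : Fin n → ℝ) : ((edfOrder jobs).map f).sum = ∑ j, f j := by
  have hp : (edfOrder jobs).Perm (List.finRange n) := List.perm_insertionSort _ _
  rw [(hp.map f).sum_eq, ← List.ofFn_eq_map, List.sum_ofFn]

open Classical in
theorem pairwise_edfOrder :
    (edfOrder jobs).Pairwise fun i j => (jobs i).deadline ≤ (jobs j).deadline := by
  have : IsTrans (Fin n) fun i j => (jobs i).deadline ≤ (jobs j).deadline :=
    ⟨fun _ _ _ => le_trans⟩
  have : Std.Total fun i j : Fin n => (jobs i).deadline ≤ (jobs j).deadline :=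
    ⟨fun _ _ => le_total _ _⟩
  exact List.pairwise_insertionSort _ _

open Classical in
-- Pending jobs whose deadline has passed are dropped because pouring over an empty interval changes
-- nothing. In an actual run there are none (`lt_deadline_of_pending`).
theorem isFilling_plan :
    IsFilling τ (fun j => (jobs j).deadline) (fun j => S.remaining jobs j τ)
      (((edfOrder jobs).filter fun j => S.Pending jobs j τ).filter fun j => τ < (jobs j).deadline)
      (plan jobs S τ) := by
  unfold plan
  rw [foldl_waterFill_filter τ (fun j => (jobs j).deadline)]
  refine isFilling_foldl _ _ _ _ (fun j hj => ?_) (fun j hj => ?_)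
    (((pairwise_edfOrder jobs).filter _).filter _)
  · simpa using (List.mem_filter.1 hj).2
  · have := (List.mem_filter.1 (List.mem_filter.1 hj).1).2
    simp only [decide_eq_true_eq] at this
    exact this.2.le

theorem plannedSpeed_nonneg : 0 ≤ plannedSpeed jobs S τ := (isFilling_plan jobs S τ).nonneg τ

open Classical in
theorem sum_plan_list (x : ℝ) :
    ((((edfOrder jobs).filter fun j => S.Pending jobs j τ).filter
      fun j => τ < (jobs j).deadline).map
        fun j => if (jobs j).deadline ≤ x then S.remaining jobs j τ else 0).sum =
    ∑ j with S.Pending jobs j τ ∧ τ < (jobs j).deadline ∧ (jobs j).deadline ≤ x,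
      S.remaining jobs j τ := by
  rw [sum_map_filter_ite, sum_map_filter_ite, sum_edfOrder, Finset.sum_filter]
  refine Finset.sum_congr rfl fun j _ => ?_
  split_ifs <;> simp_all

/-- The planned speed suffices for any set of released jobs. -/
theorem sum_remaining_le_plannedSpeed_mul {x : ℝ} (hx : τ < x) (J : Finset (Fin n))
    (hJ : ∀ j ∈ J, 0 < S.remaining jobs j τ →
      (jobs j).release ≤ τ ∧ τ < (jobs j).deadline ∧ (jobs j).deadline ≤ x) :
    ∑ j ∈ J, S.remaining jobs j τ ≤ plannedSpeed jobs S τ * (x - τ) := by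
  classical
  have h := isFilling_plan jobs S τ
  have h1 := h.sum_le x hx
  rw [sum_plan_list] at h1
  -- The profile is nonincreasing, so its initial value dominates its average over `[τ, x)`.
  have h2 : ∫ u in Ico τ x, plan jobs S τ u ≤ plannedSpeed jobs S τ * (x - τ) := by
    have : ∫ u in Ico τ x, plan jobs S τ u ≤ ∫ _ in Ico τ x, plannedSpeed jobs S τ :=
      setIntegral_mono_on (integrableOn_of_antitoneOn h.anti x) (integrableOn_const measure_Ico_lt_top.ne)
        measurableSet_Ico fun u hu => h.anti self_mem_Ici (mem_Ici.2 hu.1) hu.1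
    rwa [setIntegral_const, smul_eq_mul, Real.volume_real_Ico_of_le hx.le, mul_comm] at this
  refine le_trans ?_ (h1.trans h2)
  calc ∑ j ∈ J, S.remaining jobs j τ
      ≤ ∑ j ∈ J with 0 < S.remaining jobs j τ, S.remaining jobs j τ := by
        rw [Finset.sum_filter]
        exact Finset.sum_le_sum fun j _ => by split_ifs <;> linarith
    _ ≤ _ := by
        refine Finset.sum_le_sum_of_subset_of_nonneg (fun j hj => ?_) fun j hj _ => ?_
        · rw [Finset.mem_filter] at hj
          have := hJ j hj.1 hj.2
          exact Finset.mem_filter.2 ⟨Finset.mem_univ _, ⟨this.1, hj.2⟩, this.2⟩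
        · exact (Finset.mem_filter.1 hj).2.1.2.le

open Classical in
/-- A positive planned speed is the density of some set of pending jobs. -/
theorem exists_plannedSpeed_mul_le (hρ : 0 < plannedSpeed jobs S τ) :
    ∃ x, τ < x ∧ plannedSpeed jobs S τ * (x - τ) ≤
      ∑ j with S.Pending jobs j τ ∧ τ < (jobs j).deadline ∧ (jobs j).deadline ≤ x,
        S.remaining jobs j τ := by
  obtain ⟨x, hx, h⟩ := (isFilling_plan jobs S τ).le_sum hρ
  exact ⟨x, hx, (sum_plan_list jobs S τ x) ▸ h⟩

/-- A pending job makes the planned speed positive. -/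
theorem remaining_le_plannedSpeed_mul {j : Fin n} (hj : S.Pending jobs j τ)
    (hd : τ < (jobs j).deadline) :
    S.remaining jobs j τ ≤ plannedSpeed jobs S τ * ((jobs j).deadline - τ) := by
  simpa using sum_remaining_le_plannedSpeed_mul jobs S τ hd {j} (by simpa using fun _ => ⟨hj.1, hd⟩)

theorem plannedSpeed_pos {j : Fin n} (hj : S.Pending jobs j τ) (hd : τ < (jobs j).deadline) :
    0 < plannedSpeed jobs S τ :=
  pos_of_mul_pos_left (hj.2.trans_le (remaining_le_plannedSpeed_mul jobs S τ hj hd))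
    (sub_pos.2 hd).le

/-- The plan sees the schedule only through the remaining volumes, hence only through the past. This
lets a run be prolonged without disturbing earlier decisions. -/
theorem plannedSpeed_congr {S' : Schedule n}
    (h : ∀ j, S.remaining jobs j τ = S'.remaining jobs j τ) :
    plannedSpeed jobs S τ = plannedSpeed jobs S' τ := by
  have hP : ∀ j, S.Pending jobs j τ ↔ S'.Pending jobs j τ := fun j => by
    simp only [Schedule.Pending, h]
  simp only [plannedSpeed, plan, h]
  rw [List.filter_congr fun j _ => decide_eq_decide.2 (hP j)]

end Plan

end SpeedScaling

namespace SpeedScaling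

/-! ### Remaining volumes -/

namespace Schedule

variable {n : ℕ} {S S' : Schedule n} {jobs : Fin n → Job} {j : Fin n}

theorem speed_nonneg (S : Schedule n) (t : ℝ) : 0 ≤ S.speed t :=
  Finset.sum_nonneg fun j _ => S.rate_nonneg j t

theorem rate_le_speed (S : Schedule n) (j : Fin n) (t : ℝ) : S.rate j t ≤ S.speed t :=
  Finset.single_le_sum (f := fun j => S.rate j t) (fun j _ => S.rate_nonneg j t)
    (Finset.mem_univ j)

theorem measurable_speed (S : Schedule n) : Measurable S.speed :=
  Finset.measurable_sum _ fun j _ => S.measurable_rate j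

theorem remaining_sub_remaining (hi : Integrable (S.rate j)) {a b : ℝ} (hab : a ≤ b) :
    S.remaining jobs j a - S.remaining jobs j b = ∫ u in Ico a b, S.rate j u := by
  have h : ∫ u in Iio b, S.rate j u = (∫ u in Iio a, S.rate j u) + ∫ u in Ico a b, S.rate j u := by
    rw [← setIntegral_union _ measurableSet_Ico hi.integrableOn hi.integrableOn,
      Iio_union_Ico_eq_Iio hab]
    exact disjoint_left.2 fun x hx hx' => not_le.2 hx hx'.1
  simp only [remaining, h]
  ring

theorem antitone_remaining (hi : Integrable (S.rate j)) : Antitone (S.remaining jobs j) := by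
  intro a b hab
  have := remaining_sub_remaining (jobs := jobs) hi hab
  have h0 : 0 ≤ ∫ u in Ico a b, S.rate j u := integral_nonneg fun u => S.rate_nonneg j u
  linarith

theorem continuous_remaining (hi : Integrable (S.rate j)) : Continuous (S.remaining jobs j) := by
  have h : ∀ x, S.remaining jobs j x = S.remaining jobs j 0 - ∫ u in (0 : ℝ)..x, S.rate j u := by
    intro x
    rcases le_total 0 x with h | h
    · rw [intervalIntegral.integral_of_le h, ← integral_Ico_eq_integral_Ioc,
        ← remaining_sub_remaining (jobs := jobs) hi h]
      ring
    · rw [intervalIntegral.integral_of_ge h, ← integral_Ico_eq_integral_Ioc,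
        ← remaining_sub_remaining (jobs := jobs) hi h]
      ring
  rw [funext h]
  exact continuous_const.sub
    (intervalIntegral.continuous_primitive (fun a b => hi.intervalIntegrable) 0)

theorem remaining_eq_of_rate_eq_zero (hi : Integrable (S.rate j)) {a b : ℝ} (hab : a ≤ b)
    (h : ∀ u ∈ Ico a b, S.rate j u = 0) : S.remaining jobs j b = S.remaining jobs j a := by
  have := remaining_sub_remaining (jobs := jobs) hi hab
  rw [setIntegral_eq_zero_of_forall_eq_zero h] at this
  linarith

theorem remaining_congr {T : ℝ} (h : ∀ t < T, S.rate j t = S'.rate j t) :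
    ∀ t ≤ T, S.remaining jobs j t = S'.remaining jobs j t := by
  intro t ht
  simp only [remaining]
  rw [setIntegral_congr_fun measurableSet_Iio fun u (hu : u < t) => h u (hu.trans_le ht)]

theorem remaining_eq_volume {T : ℝ} (h : ∀ t < T, S.rate j t = 0) :
    S.remaining jobs j T = (jobs j).volume := by
  simp only [remaining]
  rw [setIntegral_eq_zero_of_forall_eq_zero (t := Iio T) fun u hu => h u (mem_Iio.1 hu), sub_zero]

end Schedule

/-! ### Runs up to a given time -/

/-- The rules of the algorithm are obeyed before time `T`. -/
structure IsRunBefore {n : ℕ} (g A sc : ℝ) (jobs : Fin n → Job)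
    (mode : ℝ → Mode) (S : Schedule n) (T : ℝ) : Prop where
  initial : ∀ t < 0, mode t = Mode.sleep
  active_iff : ∀ t, t ∈ S.active ↔ mode t ≠ Mode.sleep
  integrable_rate : ∀ j, Integrable (S.rate j)
  step : ∀ t < T, ∃ m : Mode, (∀ᶠ u in 𝓝[<] t, mode u = m) ∧
    mode t = nextMode sc (plannedSpeed jobs S t) (A ≤ g * idleTime mode t) m ∧
    ∀ᶠ u in 𝓝[>] t, mode u = mode t
  rate_eq_zero : ∀ t < T, mode t ≠ Mode.working → ∀ j, S.rate j t = 0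
  speed_eq : ∀ t < T, mode t = Mode.working → S.speed t = max (plannedSpeed jobs S t) sc
  earliest_deadline : ∀ t < T, ∀ j, 0 < S.rate j t → S.Pending jobs j t ∧
    ∀ k, S.Pending jobs k t → (jobs j).deadline ≤ (jobs k).deadline

section Runs

variable {n : ℕ} {g A sc : ℝ} {jobs : Fin n → Job} {mode : ℝ → Mode} {S : Schedule n} {T : ℝ}

theorem IsSOARun.isRunBefore (h : IsSOARun g A sc jobs mode S) (T : ℝ) :
    IsRunBefore g A sc jobs mode S T :=
  ⟨h.initial, h.active_iff, h.integrable_rate, fun t _ => h.step t, fun t _ => h.rate_eq_zero t,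
    fun t _ => h.speed_eq t, fun t _ => h.earliest_deadline t⟩

theorem isSOARun_of_isRunBefore (h : ∀ N : ℝ, ∃ T ≥ N, IsRunBefore g A sc jobs mode S T) :
    IsSOARun g A sc jobs mode S := by
  have h' : ∀ t, ∃ T, t < T ∧ IsRunBefore g A sc jobs mode S T := fun t => by
    obtain ⟨T, hT, hr⟩ := h (t + 1)
    exact ⟨T, by linarith, hr⟩
  obtain ⟨T₀, -, h₀⟩ := h' 0
  refine ⟨h₀.initial, h₀.active_iff, h₀.integrable_rate, fun t => ?_, fun t => ?_, fun t => ?_,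
    fun t => ?_⟩ <;> obtain ⟨T, hT, hr⟩ := h' t
  exacts [hr.step t hT, hr.rate_eq_zero t hT, hr.speed_eq t hT, hr.earliest_deadline t hT]

theorem nextMode_eq_working {ρ : ℝ} {e : Prop} {m : Mode} (h : nextMode sc ρ e m = Mode.working) :
    0 < ρ := by
  cases m <;> simp only [nextMode] at h <;> split_ifs at h <;> tauto

theorem nextMode_of_le {ρ : ℝ} {e : Prop} (m : Mode) (h : 0 < ρ) (h' : sc ≤ ρ) :
    nextMode sc ρ e m = Mode.working := by
  cases m <;> simp [nextMode, h, h']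

namespace IsRunBefore

variable (h : IsRunBefore g A sc jobs mode S T)
include h

theorem mode_eq_working {t : ℝ} (ht : t < T) (h0 : 0 < plannedSpeed jobs S t)
    (hsc : sc ≤ plannedSpeed jobs S t) : mode t = Mode.working := by
  obtain ⟨m, -, hm, -⟩ := h.step t ht
  rw [hm, nextMode_of_le m h0 hsc]

theorem plannedSpeed_pos_of_working {t : ℝ} (ht : t < T) (hm : mode t = Mode.working) :
    0 < plannedSpeed jobs S t := by
  obtain ⟨m, -, hm', -⟩ := h.step t ht
  exact nextMode_eq_working (hm'.symm.trans hm)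

theorem integrable_speed : Integrable S.speed :=
  integrable_finsetSum _ fun j _ => h.integrable_rate j

/-- The volume of a job is processed by its deadline. -/
theorem remaining_deadline_nonpos {j : Fin n} (hj : (jobs j).deadline ≤ T) :
    S.remaining jobs j (jobs j).deadline ≤ 0 := by
  by_contra! hδ
  set d := (jobs j).deadline with hd
  set δ := S.remaining jobs j d with hδd
  have hr := (jobs j).release_lt_deadline
  -- The first bound ensures that the job is released, the second that `δ / (d - t) ≥ sc`, so that
  -- even a sleeping machine is called to work.
  set ε := min (d - (jobs j).release) (δ / (|sc| + 1)) with hε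
  have hεpos : 0 < ε := lt_min (sub_pos.2 hr) (by positivity)
  -- If `δ` were left at the deadline, the density of this job alone would force speed `δ / (d - t)`
  -- just before `d`. This is not integrable, whereas the rates of a run are.
  have key : ∀ t ∈ Ioo (d - ε) d, δ * (d - t)⁻¹ ≤ S.speed t := by
    intro t ht
    have hdt : 0 < d - t := sub_pos.2 ht.2
    have hrel : (jobs j).release ≤ t := by
      have := min_le_left (d - (jobs j).release) (δ / (|sc| + 1))
      linarith [ht.1]
    have hrem : δ ≤ S.remaining jobs j t :=
      Schedule.antitone_remaining (h.integrable_rate j) ht.2.le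
    have hpend : S.Pending jobs j t := ⟨hrel, hδ.trans_le hrem⟩
    have hρ := hrem.trans (remaining_le_plannedSpeed_mul jobs S t hpend ht.2)
    have hρ' : δ * (d - t)⁻¹ ≤ plannedSpeed jobs S t := by
      rw [← div_eq_mul_inv, div_le_iff₀ hdt]
      exact hρ
    have hsc : sc ≤ δ * (d - t)⁻¹ := by
      rw [← div_eq_mul_inv, le_div_iff₀ hdt]
      have h1 : ε ≤ δ / (|sc| + 1) := min_le_right _ _
      rw [le_div_iff₀ (by positivity)] at h1
      have h2 : d - t ≤ ε := by linarith [ht.1]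
      have h3 := le_abs_self sc
      have h4 := abs_nonneg sc
      nlinarith
    have hw := h.mode_eq_working (ht.2.trans_le hj) (lt_of_lt_of_le (by positivity) hρ')
      (hsc.trans hρ')
    rw [h.speed_eq t (ht.2.trans_le hj) hw]
    exact hρ'.trans (le_max_left _ _)
  have hint : IntegrableOn (fun t => δ * (d - t)⁻¹) (Ioo (d - ε) d) := by
    refine Integrable.mono' h.integrable_speed.integrableOn
      (by fun_prop : Measurable _).aestronglyMeasurable ?_
    refine (ae_restrict_mem measurableSet_Ioo).mono fun t ht => ?_
    have : 0 < d - t := sub_pos.2 ht.2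
    rw [Real.norm_of_nonneg (by positivity)]
    exact key t ht
  have hint' : IntegrableOn (fun t => (t - d)⁻¹) (Ioo (d - ε) d) := by
    refine (hint.const_mul (-δ⁻¹)).congr (Eventually.of_forall fun t => ?_)
    have h1 : -δ⁻¹ * (δ * (d - t)⁻¹) = -(d - t)⁻¹ := by field_simp
    simp only [h1]
    rw [← inv_neg, neg_sub]
  have := intervalIntegrable_sub_inv_iff.1
    ((intervalIntegrable_iff_integrableOn_Ioo_of_le (by linarith)).2 hint')
  rcases this with h1 | h1
  · linarith
  · exact h1 right_mem_uIcc

theorem lt_deadline_of_pending {t : ℝ} (ht : t ≤ T) {j : Fin n} (hj : S.Pending jobs j t) :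
    t < (jobs j).deadline := by
  by_contra! hd
  have h1 := h.remaining_deadline_nonpos (hd.trans ht)
  have h2 := Schedule.antitone_remaining (jobs := jobs) (h.integrable_rate j) hd
  linarith [hj.2]

end IsRunBefore

/-! ### Complete runs: remaining volumes and feasibility -/

namespace IsSOARun

variable (h : IsSOARun g A sc jobs mode S)
include h

theorem mode_eq_working {t : ℝ} (h0 : 0 < plannedSpeed jobs S t)
    (hsc : sc ≤ plannedSpeed jobs S t) : mode t = Mode.working :=
  (h.isRunBefore (t + 1)).mode_eq_working (lt_add_one t) h0 hsc

theorem plannedSpeed_pos {t : ℝ} (hm : mode t = Mode.working) : 0 < plannedSpeed jobs S t :=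
  (h.isRunBefore (t + 1)).plannedSpeed_pos_of_working (lt_add_one t) hm

theorem integrable_speed : Integrable S.speed := (h.isRunBefore 0).integrable_speed

theorem lt_deadline_of_pending {t : ℝ} {j : Fin n} (hj : S.Pending jobs j t) :
    t < (jobs j).deadline :=
  (h.isRunBefore t).lt_deadline_of_pending le_rfl hj

theorem speed_eq_zero {t : ℝ} (hm : mode t ≠ Mode.working) : S.speed t = 0 :=
  Finset.sum_eq_zero fun j _ => h.rate_eq_zero t hm j

theorem speed_pos {t : ℝ} (hm : mode t = Mode.working) : 0 < S.speed t := by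
  rw [h.speed_eq t hm]
  exact (h.plannedSpeed_pos hm).trans_le (le_max_left _ _)

theorem working_iff {t : ℝ} : mode t = Mode.working ↔ 0 < S.speed t :=
  ⟨h.speed_pos, fun hs => by_contra fun hm => hs.ne' (h.speed_eq_zero hm)⟩

theorem measurableSet_working : MeasurableSet {t | mode t = Mode.working} := by
  simp only [h.working_iff]
  exact measurableSet_lt measurable_const S.measurable_speed

theorem measurableSet_idle : MeasurableSet {t | mode t = Mode.idle} := by
  have : {t | mode t = Mode.idle} = S.active \ {t | mode t = Mode.working} := by
    ext t
    rw [Set.mem_sdiff, h.active_iff, mem_ofPred_eq, mem_ofPred_eq]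
    cases mode t <;> simp
  rw [this]
  exact S.measurableSet_active.diff h.measurableSet_working

theorem pending_of_rate_pos {t : ℝ} {j : Fin n} (hj : 0 < S.rate j t) : S.Pending jobs j t :=
  (h.earliest_deadline t j hj).1

theorem rate_eq_zero_of_not_pending {t : ℝ} {j : Fin n} (hj : ¬ S.Pending jobs j t) :
    S.rate j t = 0 :=
  le_antisymm (le_of_not_gt fun h' => hj (h.pending_of_rate_pos h')) (S.rate_nonneg j t)

theorem remaining_release {j : Fin n} {t : ℝ} (ht : t ≤ (jobs j).release) :
    S.remaining jobs j t = (jobs j).volume :=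
  Schedule.remaining_eq_volume fun _ hu =>
    h.rate_eq_zero_of_not_pending fun hp =>
      absurd (hu.trans_le ht) (not_lt.2 hp.1)

/-- The remaining volume is continuous, and once it is zero the job is no longer pending and its
rate vanishes; so it cannot become negative. -/
theorem remaining_nonneg (j : Fin n) (t : ℝ) : 0 ≤ S.remaining jobs j t := by
  have hanti := Schedule.antitone_remaining (jobs := jobs) (h.integrable_rate j)
  rcases le_total t (jobs j).release with ht | ht
  · rw [h.remaining_release ht]
    exact (jobs j).volume_pos.le
  by_contra! hneg
  obtain ⟨t₀, ht₀, hz⟩ : ∃ x ∈ Icc (jobs j).release t, S.remaining jobs j x = 0 :=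
    intermediate_value_Icc' ht
      (Schedule.continuous_remaining (h.integrable_rate j)).continuousOn
      ⟨hneg.le, (h.remaining_release le_rfl).symm ▸ (jobs j).volume_pos.le⟩
  have := Schedule.remaining_eq_of_rate_eq_zero (jobs := jobs) (h.integrable_rate j) ht₀.2
    fun u hu => h.rate_eq_zero_of_not_pending fun hp => by
      have := hanti hu.1
      linarith [hp.2]
  linarith

theorem remaining_eq_zero {j : Fin n} {t : ℝ} (ht : (jobs j).deadline ≤ t) :
    S.remaining jobs j t = 0 := by
  refine le_antisymm (le_of_not_gt fun hpos => ?_) (h.remaining_nonneg j t)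
  exact not_lt.2 ht (h.lt_deadline_of_pending
    ⟨(jobs j).release_lt_deadline.le.trans ht, hpos⟩)

/-- The work spent on a job between two times is the decrease of its remaining volume. -/
theorem integral_rate_Ico (j : Fin n) {a b : ℝ} (hab : a ≤ b) :
    ∫ u in Ico a b, S.rate j u = S.remaining jobs j a - S.remaining jobs j b :=
  (Schedule.remaining_sub_remaining (h.integrable_rate j) hab).symm

theorem not_pending_of_plannedSpeed_eq_zero {t : ℝ} (hρ : plannedSpeed jobs S t = 0) (j : Fin n) :
    ¬ S.Pending jobs j t := fun hp =>
  (SpeedScaling.plannedSpeed_pos jobs S t hp (h.lt_deadline_of_pending hp)).ne' hρ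

theorem feasible : S.Feasible jobs := by
  intro j
  set d := (jobs j).deadline
  have h0 : ∫ u in Iio d, S.rate j u = (jobs j).volume := by
    have := h.remaining_eq_zero (j := j) le_rfl
    simp only [Schedule.remaining] at this
    linarith
  rw [← h0, ofReal_integral_eq_lintegral_ofReal (h.integrable_rate j).integrableOn
    (Eventually.of_forall fun u => S.rate_nonneg j u), ← lintegral_indicator measurableSet_Iio,
    ← lintegral_indicator (measurableSet_Icc.inter S.measurableSet_active)]
  refine lintegral_mono fun u => ?_
  by_cases hu : u ∈ Icc (jobs j).release d ∩ S.active
  · rw [indicator_of_mem hu]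
    exact indicator_le_self _ _ _
  · rw [indicator_of_notMem hu]
    refine le_of_eq (indicator_apply_eq_zero.2 fun hud => ?_)
    rw [ENNReal.ofReal_eq_zero]
    by_contra! hpos
    refine hu ⟨⟨(h.pending_of_rate_pos hpos).1, (mem_Iio.1 hud).le⟩, (h.active_iff u).2 fun hs => ?_⟩
    exact hpos.ne' (h.rate_eq_zero u (by simp [hs]) j)

end IsSOARun

end Runs

end SpeedScaling

namespace SpeedScaling

/-! ### Existence of a run -/

theorem plannedSpeed_eq_zero {n : ℕ} {jobs : Fin n → Job} {S : Schedule n} {t : ℝ}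
    (h : ∀ j, S.Pending jobs j t → (jobs j).deadline ≤ t) : plannedSpeed jobs S t = 0 := by
  classical
  refine le_antisymm (le_of_not_gt fun hpos => ?_) (plannedSpeed_nonneg jobs S t)
  obtain ⟨x, hx, hle⟩ := exists_plannedSpeed_mul_le jobs S t hpos
  rw [Finset.sum_eq_zero fun j hj => ?_] at hle
  · exact absurd (mul_pos hpos (sub_pos.2 hx)) (not_lt.2 hle)
  · have := (Finset.mem_filter.1 hj).2
    exact absurd this.2.1 (not_lt.2 (h j this.1))

theorem idleTime_congr {mode mode' : ℝ → Mode} {T t : ℝ} (h : ∀ u < T, mode u = mode' u)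
    (ht : t ≤ T) : idleTime mode t = idleTime mode' t := by
  unfold idleTime
  congr 2
  ext u
  simp only [mem_ofPred_eq]
  refine and_congr_right fun hu => ?_
  rw [h u (hu.trans_le ht)]
  refine and_congr_right fun _ => forall₂_congr fun v hv => ?_
  rw [h v (hv.2.trans_le ht)]

theorem idleTime_le_add {mode : ℝ → Mode} (h : ∀ t < 0, mode t = Mode.sleep) {t u : ℝ}
    (htu : t ≤ u) : idleTime mode u ≤ idleTime mode t + (u - t) := by
  rw [← Real.volume_real_Ico_of_le htu]
  -- Sleep before time `0` makes the idle set bounded; without finiteness `toReal` would return `0`.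
  have hfin : volume {x : ℝ | x < t ∧ mode x = Mode.idle ∧ ∀ v ∈ Ico x t, mode v ≠ Mode.sleep} ≠
      ⊤ := by
    refine ((measure_mono fun x hx => ?_).trans_lt (measure_Ico_lt_top (a := (0 : ℝ)) (b := t))).ne
    refine ⟨not_lt.1 fun hx0 => ?_, hx.1⟩
    have := hx.2.1
    rw [h x hx0] at this
    cases this
  refine (measureReal_mono (μ := volume) (fun x hx => ?_)
    (measure_union_lt_top hfin.lt_top measure_Ico_lt_top).ne).trans (measureReal_union_le _ _)
  rcases lt_or_ge x t with hxt | hxt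
  · exact Or.inl ⟨hxt, hx.2.1, fun v hv => hx.2.2 v ⟨hv.1, hv.2.trans_le htu⟩⟩
  · exact Or.inr ⟨hxt, hx.1⟩

/-- A mode just chosen is kept when the rule is applied again to the same data. This makes the
prolongation by a constant mode consistent at its initial time. -/
theorem nextMode_idem {sc ρ : ℝ} {e : Prop} {m m' : Mode} (h : nextMode sc ρ e m = m') :
    nextMode sc ρ e m' = m' := by
  subst h
  cases m <;> simp only [nextMode] <;> split_ifs <;> simp_all

/-- Schedule agreeing with `S` before `T`, with constant rates `c` on `[T, T')` and no work
afterwards; from `T` on the machine is active if and only if `act` holds. -/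
noncomputable def Schedule.extend {n : ℕ} (S : Schedule n) {T : ℝ} (hT : 0 ≤ T) (T' : ℝ)
    (c : Fin n → ℝ) (hc : ∀ j, 0 ≤ c j) (act : Prop) : Schedule n where
  rate j t := if t < T then S.rate j t else if t < T' then c j else 0
  active := S.active ∩ Iio T ∪ {t | T ≤ t ∧ act}
  rate_nonneg j t := by
    split_ifs
    exacts [S.rate_nonneg j t, hc j, le_rfl]
  measurable_rate j := Measurable.ite measurableSet_Iio (S.measurable_rate j)
    (Measurable.ite measurableSet_Iio measurable_const measurable_const)
  measurableSet_active := by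
    refine (S.measurableSet_active.inter measurableSet_Iio).union ?_
    by_cases h : act
    · have : {t : ℝ | T ≤ t ∧ act} = Ici T := by ext t; simp [h]
      rw [this]
      exact measurableSet_Ici
    · simp [h]
  active_subset := by
    rintro t (ht | ht)
    · exact S.active_subset ht.1
    · exact hT.trans ht.1

section Existence

variable {n : ℕ} {g A sc : ℝ} {jobs : Fin n → Job} {mode : ℝ → Mode} {S : Schedule n} {T : ℝ}

namespace Schedule

variable {hT : 0 ≤ T} {T' : ℝ} {c : Fin n → ℝ} {hc : ∀ j, 0 ≤ c j} {act : Prop}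

theorem extend_rate_of_lt {t : ℝ} (ht : t < T) (j : Fin n) :
    (S.extend hT T' c hc act).rate j t = S.rate j t := by
  simp [extend, ht]

theorem extend_rate_of_mem {t : ℝ} (ht : t ∈ Ico T T') (j : Fin n) :
    (S.extend hT T' c hc act).rate j t = c j := by
  simp [extend, not_lt.2 ht.1, ht.2]

theorem integrable_extend {j : Fin n} (h : Integrable (S.rate j)) :
    Integrable ((S.extend hT T' c hc act).rate j) := by
  have h2 : Integrable ((Ico T T').indicator fun _ => c j) :=
    (integrable_indicator_iff measurableSet_Ico).2 (integrableOn_const measure_Ico_lt_top.ne)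
  refine ((h.indicator measurableSet_Iio (s := Iio T)).add h2).congr
    (Eventually.of_forall fun t => ?_)
  simp only [extend, Pi.add_apply, indicator, mem_Iio, mem_Ico]
  split_ifs <;> grind

theorem extend_active_iff (h : ∀ t, t ∈ S.active ↔ mode t ≠ Mode.sleep) (m : Mode) (t : ℝ) :
    t ∈ (S.extend hT T' c hc (m ≠ Mode.sleep)).active ↔
      (if t < T then mode t else m) ≠ Mode.sleep := by
  simp only [extend]
  rw [Set.mem_union, Set.mem_inter_iff, h t, mem_Iio, mem_ofPred_eq]
  split_ifs with ht
  · simp [ht]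
  · simp [ht, not_lt.1 ht]

end Schedule

/-- Planned speed, idle time and pending sets at times up to `T` depend only on what happened
before. So the old rules transfer to any prolongation, and only the rules on `[T, T')` are new
conditions. -/
theorem IsRunBefore.extend (h : IsRunBefore g A sc jobs mode S T) (hT : 0 ≤ T) {T' : ℝ}
    {m₀ m : Mode} (hm₀ : ∀ᶠ u in 𝓝[<] T, mode u = m₀)
    (hm : nextMode sc (plannedSpeed jobs S T) (A ≤ g * idleTime mode T) m₀ = m)
    {mode' : ℝ → Mode} {S' : Schedule n} (hmode : ∀ u < T, mode' u = mode u)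
    (hmode' : ∀ u, T ≤ u → mode' u = m) (hrate : ∀ u < T, ∀ j, S'.rate j u = S.rate j u)
    (hact : ∀ t, t ∈ S'.active ↔ mode' t ≠ Mode.sleep) (hint : ∀ j, Integrable (S'.rate j))
    (hstep : ∀ u ∈ Ioo T T',
      nextMode sc (plannedSpeed jobs S' u) (A ≤ g * idleTime mode' u) m = m)
    (hzero : m ≠ Mode.working → ∀ u ∈ Ico T T', ∀ j, S'.rate j u = 0)
    (hspeed : m = Mode.working → ∀ u ∈ Ico T T', S'.speed u = max (plannedSpeed jobs S' u) sc)
    (hedf : ∀ u ∈ Ico T T', ∀ j, 0 < S'.rate j u → S'.Pending jobs j u ∧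
      ∀ k, S'.Pending jobs k u → (jobs j).deadline ≤ (jobs k).deadline) :
    IsRunBefore g A sc jobs mode' S' T' := by
  have hrem : ∀ t ≤ T, ∀ j, S'.remaining jobs j t = S.remaining jobs j t := fun t ht j =>
    Schedule.remaining_congr (fun u hu => hrate u hu j) t ht
  have hρ : ∀ t ≤ T, plannedSpeed jobs S' t = plannedSpeed jobs S t := fun t ht =>
    plannedSpeed_congr jobs S' t (hrem t ht)
  have hidle : ∀ t ≤ T, idleTime mode' t = idleTime mode t := fun t ht => idleTime_congr hmode ht
  have hpend : ∀ t < T, ∀ j, S'.Pending jobs j t ↔ S.Pending jobs j t := fun t ht j => by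
    simp only [Schedule.Pending, hrem t ht.le]
  have hleft : ∀ t ≤ T, ∀ m', (∀ᶠ u in 𝓝[<] t, mode u = m') → ∀ᶠ u in 𝓝[<] t, mode' u = m' :=
    fun t ht m' hm' => by
      filter_upwards [hm', self_mem_nhdsWithin] with u hu hut
      rw [hmode u (lt_of_lt_of_le hut ht), hu]
  refine ⟨fun t ht => ?_, hact, hint, fun t ht => ?_, fun t ht hne j => ?_, fun t ht hw => ?_,
    fun t ht j hj => ?_⟩
  · rw [hmode t (ht.trans_le hT), h.initial t ht]
  · rcases lt_trichotomy t T with hlt | rfl | hgt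
    · obtain ⟨m', h1, h2, h3⟩ := h.step t hlt
      refine ⟨m', hleft t hlt.le m' h1, ?_, ?_⟩
      · rw [hmode t hlt, hρ t hlt.le, hidle t hlt.le, h2]
      · filter_upwards [h3, mem_nhdsWithin_of_mem_nhds (Iio_mem_nhds hlt)] with u hu hut
        rw [hmode u hut, hmode t hlt, hu]
    · refine ⟨m₀, hleft t le_rfl m₀ hm₀, ?_, ?_⟩
      · rw [hmode' t le_rfl, hρ t le_rfl, hidle t le_rfl, hm]
      · filter_upwards [self_mem_nhdsWithin] with u hu
        rw [hmode' u (le_of_lt hu), hmode' t le_rfl]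
    · refine ⟨m, ?_, ?_, ?_⟩
      · filter_upwards [mem_nhdsWithin_of_mem_nhds (Ioi_mem_nhds hgt)] with u hu
        exact hmode' u (le_of_lt hu)
      · rw [hmode' t hgt.le, hstep t ⟨hgt, ht⟩]
      · filter_upwards [self_mem_nhdsWithin] with u hu
        rw [hmode' u (hgt.trans hu).le, hmode' t hgt.le]
  · rcases lt_or_ge t T with hlt | hge
    · rw [hrate t hlt, h.rate_eq_zero t hlt (hmode t hlt ▸ hne)]
    · exact hzero (hmode' t hge ▸ hne) t ⟨hge, ht⟩ j
  · rcases lt_or_ge t T with hlt | hge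
    · rw [hρ t hlt.le, ← h.speed_eq t hlt (hmode t hlt ▸ hw)]
      exact Finset.sum_congr rfl fun j _ => hrate t hlt j
    · exact hspeed (hmode' t hge ▸ hw) t ⟨hge, ht⟩
  · rcases lt_or_ge t T with hlt | hge
    · rw [hrate t hlt] at hj
      simpa only [hpend t hlt] using h.earliest_deadline t hlt j hj
    · exact hedf t ⟨hge, ht⟩ j hj

theorem eventually_lt_of_lt (f : Fin n → ℝ) (x : ℝ) :
    ∀ᶠ u in 𝓝[>] x, ∀ k, x < f k → u < f k := by
  refine eventually_all.2 fun k => ?_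
  by_cases hk : x < f k
  · filter_upwards [mem_nhdsWithin_of_mem_nhds (Iio_mem_nhds hk)] with u hu _ using hu
  · exact Eventually.of_forall fun u h => absurd h hk

/-- A machine that does not work is not called to work immediately after a time at which it is not
called to work. -/
theorem eventually_not_wake (hint : ∀ j, Integrable (S.rate j)) {x : ℝ}
    (hS : ∀ u, x ≤ u → ∀ j, S.rate j u = 0)
    (hx : ¬ (0 < plannedSpeed jobs S x ∧ sc ≤ plannedSpeed jobs S x)) :
    ∀ᶠ u in 𝓝[>] x, ¬ (0 < plannedSpeed jobs S u ∧ sc ≤ plannedSpeed jobs S u) := by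
  classical
  -- All deadlines after `x` lie beyond `y₀`, so every relevant horizon has length at least `y₀ -
  -- x`. With no work done, passing from `x` to a nearby `u` then changes densities by a factor
  -- close to `1`, uniformly.
  obtain ⟨y₀, hy₀, hxy₀⟩ :=
    ((eventually_lt_of_lt (fun k => (jobs k).deadline) x).and self_mem_nhdsWithin).exists
  have hδ : 0 < y₀ - x := sub_pos.2 hxy₀
  have hclose : ∀ᶠ u in 𝓝[>] x, sc * (u - x) < (sc - plannedSpeed jobs S x) * (y₀ - x) ∨
      plannedSpeed jobs S x ≤ 0 := by
    by_cases h0 : plannedSpeed jobs S x ≤ 0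
    · exact Eventually.of_forall fun u => Or.inr h0
    · have hlt : plannedSpeed jobs S x < sc := by
        by_contra! h; exact hx ⟨not_le.1 h0, h⟩
      have hc : Tendsto (fun u => sc * (u - x)) (𝓝[>] x) (𝓝 (sc * (x - x))) :=
        (Continuous.tendsto (by fun_prop) x).mono_left nhdsWithin_le_nhds
      rw [sub_self, mul_zero] at hc
      exact (hc.eventually_lt_const (mul_pos (sub_pos.2 hlt) hδ)).mono fun u hu => Or.inl hu
  filter_upwards [self_mem_nhdsWithin, eventually_lt_of_lt (fun k => (jobs k).release) x, hclose]
    with u (hxu : x < u) hrel hcl ⟨hpos, hsc⟩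
  have hrem : ∀ j, S.remaining jobs j u = S.remaining jobs j x := fun j =>
    Schedule.remaining_eq_of_rate_eq_zero (hint j) hxu.le fun v hv => hS v hv.1 j
  have hpend : ∀ j, S.Pending jobs j u → S.Pending jobs j x := fun j hj =>
    ⟨not_lt.1 fun hlt => absurd hj.1 (not_le.2 (hrel j hlt)), hrem j ▸ hj.2⟩
  obtain ⟨y, hy, hle⟩ := exists_plannedSpeed_mul_le jobs S u hpos
  have hpos' := (mul_pos hpos (sub_pos.2 hy)).trans_le hle
  obtain ⟨k, hk⟩ := Finset.nonempty_of_sum_ne_zero hpos'.ne'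
  obtain ⟨hk1, hk2, hk3⟩ := (Finset.mem_filter.1 hk).2
  have hρx : 0 < plannedSpeed jobs S x :=
    plannedSpeed_pos jobs S x (hpend k hk1) (hxu.trans hk2)
  have hyy : y₀ ≤ y := (hy₀ k (hxu.trans hk2)).le.trans hk3
  have h1 : plannedSpeed jobs S u * (y - u) ≤ plannedSpeed jobs S x * (y - x) := by
    refine hle.trans ?_
    rw [Finset.sum_congr rfl fun j _ => hrem j]
    refine sum_remaining_le_plannedSpeed_mul jobs S x (hxu.trans hy) _ fun j hj _ => ?_
    have := (Finset.mem_filter.1 hj).2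
    exact ⟨(hpend j this.1).1, hxu.trans this.2.1, this.2.2⟩
  have h2 : sc * (y - u) ≤ plannedSpeed jobs S x * (y - x) :=
    (mul_le_mul_of_nonneg_right hsc (sub_pos.2 hy).le).trans h1
  have hlt : plannedSpeed jobs S x < sc := by
    by_contra! h; exact hx ⟨hρx, h⟩
  rcases hcl with hcl | hcl
  · nlinarith [mul_le_mul_of_nonneg_left (sub_le_sub_right hyy x) (sub_pos.2 hlt).le]
  · linarith

/-- Number of jobs that are unfinished plus number of jobs that are unreleased at time `T`. -/
noncomputable def openCount (jobs : Fin n → Job) (S : Schedule n) (T : ℝ) : ℕ :=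
  {j | 0 < S.remaining jobs j T}.ncard + {j | T < (jobs j).release}.ncard

theorem openCount_le {S' : Schedule n} {T' : ℝ} (hTT' : T ≤ T')
    (h : ∀ j, S'.remaining jobs j T' ≤ S.remaining jobs j T) :
    openCount jobs S' T' ≤ openCount jobs S T :=
  add_le_add (ncard_le_ncard fun j hj => lt_of_lt_of_le hj (h j))
    (ncard_le_ncard fun _ hj => lt_of_le_of_lt hTT' hj)

theorem openCount_lt {S' : Schedule n} {T' : ℝ} (hTT' : T ≤ T')
    (h : ∀ j, S'.remaining jobs j T' ≤ S.remaining jobs j T)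
    (hj : (∃ j, 0 < S.remaining jobs j T ∧ S'.remaining jobs j T' ≤ 0) ∨
      ∃ j, T < (jobs j).release ∧ (jobs j).release ≤ T') :
    openCount jobs S' T' < openCount jobs S T := by
  have h1 : {j | 0 < S'.remaining jobs j T'} ⊆ {j | 0 < S.remaining jobs j T} :=
    fun j hj => lt_of_lt_of_le hj (h j)
  have h2 : {j | T' < (jobs j).release} ⊆ {j | T < (jobs j).release} :=
    fun _ hj => lt_of_le_of_lt hTT' hj
  rcases hj with ⟨j, hj, hj'⟩ | ⟨j, hj, hj'⟩
  · exact add_lt_add_of_lt_of_le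
      (ncard_lt_ncard ⟨h1, fun hs => not_lt.2 hj' (hs hj)⟩) (ncard_le_ncard h2)
  · exact add_lt_add_of_le_of_lt (ncard_le_ncard h1)
      (ncard_lt_ncard ⟨h2, fun hs => not_lt.2 hj' (hs hj)⟩)

/-- Rank of a mode in the order in which modes follow one another while no job is released. -/
def Mode.rank : Mode → ℕ
  | working => 0
  | sleep => 1
  | idle => 2

/-- A run before `T` after which the machine does not work either continues forever in the same
mode, or until a change of mode. -/
theorem IsRunBefore.extend_of_ne_working (h : IsRunBefore g A sc jobs mode S T) (hT : 0 ≤ T)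
    (hg : 0 ≤ g) {m₀ m : Mode} (hm₀ : ∀ᶠ u in 𝓝[<] T, mode u = m₀)
    (hm : nextMode sc (plannedSpeed jobs S T) (A ≤ g * idleTime mode T) m₀ = m)
    (hne : m ≠ Mode.working) :
    (∃ mode' S', IsSOARun g A sc jobs mode' S') ∨
    ∃ T' mode' S', T < T' ∧ IsRunBefore g A sc jobs mode' S' T' ∧
      (∀ᶠ u in 𝓝[<] T', mode' u = m) ∧
      nextMode sc (plannedSpeed jobs S' T') (A ≤ g * idleTime mode' T') m ≠ m ∧
      ∀ j, S'.remaining jobs j T' ≤ S.remaining jobs j T := by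
  classical
  -- One prolongation, frozen in mode `m` without work, serves for every length; it obeys the rules
  -- until the first time at which they would leave `m`.
  set mode' : ℝ → Mode := fun t => if t < T then mode t else m with hmode'
  set S' := S.extend hT T (fun _ => 0) (fun _ => le_rfl) (m ≠ Mode.sleep) with hS'
  have hlow : ∀ u < T, mode' u = mode u := fun u hu => if_pos hu
  have hhigh : ∀ u, T ≤ u → mode' u = m := fun u hu => if_neg (not_lt.2 hu)
  have hrate : ∀ u < T, ∀ j, S'.rate j u = S.rate j u := fun u hu j =>
    Schedule.extend_rate_of_lt hu j
  have hrate' : ∀ u, T ≤ u → ∀ j, S'.rate j u = 0 := fun u hu j => by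
    simp [hS', Schedule.extend, not_lt.2 hu]
  have hact : ∀ t, t ∈ S'.active ↔ mode' t ≠ Mode.sleep := fun t =>
    Schedule.extend_active_iff h.active_iff m t
  have hint : ∀ j, Integrable (S'.rate j) := fun j =>
    Schedule.integrable_extend (h.integrable_rate j)
  have hinit : ∀ t < 0, mode' t = Mode.sleep := fun t ht => by
    rw [hlow t (ht.trans_le hT), h.initial t ht]
  have hext : ∀ T', T ≤ T' → (∀ u ∈ Ioo T T',
      nextMode sc (plannedSpeed jobs S' u) (A ≤ g * idleTime mode' u) m = m) →
      IsRunBefore g A sc jobs mode' S' T' := fun T' _ hstep =>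
    h.extend hT hm₀ hm hlow hhigh hrate hact hint hstep (fun _ u hu j => hrate' u hu.1 j)
      (fun hw => absurd hw hne) fun u hu j hj => absurd hj (hrate' u hu.1 j).not_gt
  have hremT : ∀ j, S'.remaining jobs j T = S.remaining jobs j T := fun j =>
    Schedule.remaining_congr (fun u hu => hrate u hu j) T le_rfl
  set B := {u | T < u ∧ nextMode sc (plannedSpeed jobs S' u) (A ≤ g * idleTime mode' u) m ≠ m}
    with hB
  have hstable : ∀ x, T ≤ x →
      nextMode sc (plannedSpeed jobs S' x) (A ≤ g * idleTime mode' x) m = m →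
      ∀ᶠ u in 𝓝[>] x, nextMode sc (plannedSpeed jobs S' u) (A ≤ g * idleTime mode' u) m = m := by
    intro x hx hnext
    have hwake : ¬ (0 < plannedSpeed jobs S' x ∧ sc ≤ plannedSpeed jobs S' x) := fun hw =>
      hne (hnext.symm.trans (nextMode_of_le m hw.1 hw.2))
    have h1 := eventually_not_wake hint (fun u hu => hrate' u (hx.trans hu)) hwake
    cases m with
    | working => exact absurd rfl hne
    | sleep => filter_upwards [h1] with u hu using by simp [nextMode, hu]
    | idle =>
      have hexp : ¬ A ≤ g * idleTime mode' x := fun he => by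
        simp [nextMode, he, hwake] at hnext
      have hc : Tendsto (fun u => g * (idleTime mode' x + (u - x))) (𝓝[>] x)
          (𝓝 (g * (idleTime mode' x + (x - x)))) :=
        (Continuous.tendsto (by fun_prop) x).mono_left nhdsWithin_le_nhds
      rw [sub_self, add_zero] at hc
      filter_upwards [h1, hc.eventually_lt_const (not_le.1 hexp), self_mem_nhdsWithin]
        with u hu hlt hxu
      have := (mul_le_mul_of_nonneg_left (idleTime_le_add hinit (le_of_lt hxu)) hg).trans_lt hlt
      simp [nextMode, hu, not_le.2 this]
  have hnextT : nextMode sc (plannedSpeed jobs S' T) (A ≤ g * idleTime mode' T) m = m := by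
    rw [plannedSpeed_congr jobs S' T hremT, idleTime_congr hlow le_rfl]
    exact nextMode_idem hm
  rcases B.eq_empty_or_nonempty with hBe | hBne
  · left
    refine ⟨mode', S', isSOARun_of_isRunBefore fun N => ⟨max N T, le_max_left _ _,
      hext _ (le_max_right _ _) fun u hu => ?_⟩⟩
    by_contra hn
    exact (hBe ▸ (⟨hu.1, hn⟩ : u ∈ B) : u ∈ (∅ : Set ℝ))
  · right
    have hbdd : BddBelow B := ⟨T, fun u hu => hu.1.le⟩
    have hnot : ∀ u ∈ Ioo T (sInf B),
        nextMode sc (plannedSpeed jobs S' u) (A ≤ g * idleTime mode' u) m = m := fun u hu => by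
      by_contra hn
      exact notMem_of_lt_csInf hu.2 hbdd ⟨hu.1, hn⟩
    -- By `hstable`, a time at which `m` is kept is followed by an interval on which it is kept. At
    -- `T` this gives `T < sInf B`; at `sInf B` itself it shows that the rules do leave `m` there.
    have hge : ∀ x, T ≤ x → (∀ b ∈ B, x ≤ b) →
        nextMode sc (plannedSpeed jobs S' x) (A ≤ g * idleTime mode' x) m = m → x < sInf B := by
      intro x hx hxB hnext
      obtain ⟨y, hy, hyx⟩ := (mem_nhdsGT_iff_exists_Ioo_subset.1 (hstable x hx hnext))
      refine lt_of_lt_of_le hy (le_csInf hBne fun b hb => not_lt.1 fun hby => ?_)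
      rcases (hxB b hb).eq_or_lt with rfl | hlt
      · exact hb.2 hnext
      · exact hb.2 (hyx ⟨hlt, hby⟩)
    have hTlt : T < sInf B := hge T le_rfl (fun b hb => hb.1.le) hnextT
    refine ⟨sInf B, mode', S', hTlt, hext _ hTlt.le hnot, ?_, fun hnext => ?_, fun j => ?_⟩
    · filter_upwards [mem_nhdsWithin_of_mem_nhds (Ioi_mem_nhds hTlt)] with u hu
      exact hhigh u (le_of_lt hu)
    · exact lt_irrefl _ (hge _ hTlt.le (fun b hb => csInf_le hbdd hb) hnext)
    · rw [← hremT]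
      exact Schedule.antitone_remaining (hint j) hTlt.le

/-- A run before `T` after which the machine works continues at constant speed until a job is
finished or released. -/
theorem IsRunBefore.extend_of_working (h : IsRunBefore g A sc jobs mode S T) (hT : 0 ≤ T)
    {m₀ : Mode} (hm₀ : ∀ᶠ u in 𝓝[<] T, mode u = m₀)
    (hm : nextMode sc (plannedSpeed jobs S T) (A ≤ g * idleTime mode T) m₀ = Mode.working) :
    ∃ T' mode' S', T < T' ∧ IsRunBefore g A sc jobs mode' S' T' ∧
      (∀ᶠ u in 𝓝[<] T', mode' u = Mode.working) ∧
      openCount jobs S' T' < openCount jobs S T := by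
  classical
  have hρ : 0 < plannedSpeed jobs S T := nextMode_eq_working hm
  set ρ := plannedSpeed jobs S T with hρdef
  obtain ⟨i, hi⟩ : ∃ i, S.Pending jobs i T := by
    by_contra! hn
    exact hρ.ne' (plannedSpeed_eq_zero fun j hj => absurd hj (hn j))
  obtain ⟨j, hjmem, hjmin⟩ := Finset.exists_min_image
    (Finset.univ.filter fun j => S.Pending jobs j T) (fun j => (jobs j).deadline)
    ⟨i, by simpa using hi⟩
  have hj : S.Pending jobs j T := by simpa using hjmem
  replace hjmin : ∀ k, S.Pending jobs k T → (jobs j).deadline ≤ (jobs k).deadline :=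
    fun k hk => hjmin k (by simpa using hk)
  have hdj : T < (jobs j).deadline := h.lt_deadline_of_pending le_rfl hj
  set s := max ρ sc with hs
  have hspos : 0 < s := hρ.trans_le (le_max_left _ _)
  set R := S.remaining jobs j T with hR
  -- Candidates for the next event: completion of `j` at speed `s`, and the release times still to
  -- come.
  set F : Finset ℝ := insert (T + R / s)
    ((Finset.univ.image fun k => (jobs k).release).filter fun r => T < r) with hF
  have hFne : F.Nonempty := Finset.insert_nonempty _ _
  set T' := F.min' hFne with hT'
  have hRs : 0 < R / s := div_pos hj.2 hspos
  have hTT' : T < T' := by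
    rw [hT', Finset.lt_min'_iff]
    intro x hx
    rcases Finset.mem_insert.1 hx with rfl | hx
    · linarith
    · exact (Finset.mem_filter.1 hx).2
  have hT'le : T' ≤ T + R / s := Finset.min'_le _ _ (Finset.mem_insert_self _ _)
  have hrel : ∀ k, (jobs k).release < T' → (jobs k).release ≤ T := fun k hk => by
    by_contra! hlt
    refine not_le.2 hk (Finset.min'_le _ _ (Finset.mem_insert_of_mem ?_))
    exact Finset.mem_filter.2 ⟨Finset.mem_image_of_mem _ (Finset.mem_univ k), hlt⟩
  have hRd : T + R / s ≤ (jobs j).deadline := by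
    have h1 := remaining_le_plannedSpeed_mul jobs S T hj hdj
    have h2 : R ≤ s * ((jobs j).deadline - T) :=
      h1.trans (mul_le_mul_of_nonneg_right (le_max_left _ _) (sub_pos.2 hdj).le)
    have h3 : R / s ≤ (jobs j).deadline - T := by
      rw [div_le_iff₀ hspos]; linarith
    linarith
  set c : Fin n → ℝ := fun k => if k = j then s else 0 with hc
  have hc0 : ∀ k, 0 ≤ c k := fun k => by
    simp only [hc]; split_ifs <;> [exact hspos.le; exact le_rfl]
  set mode' : ℝ → Mode := fun t => if t < T then mode t else Mode.working with hmode'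
  set S' := S.extend hT T' c hc0 (Mode.working ≠ Mode.sleep) with hS'
  have hlow : ∀ u < T, mode' u = mode u := fun u hu => if_pos hu
  have hhigh : ∀ u, T ≤ u → mode' u = Mode.working := fun u hu => if_neg (not_lt.2 hu)
  have hrate : ∀ u < T, ∀ k, S'.rate k u = S.rate k u := fun u hu k =>
    Schedule.extend_rate_of_lt hu k
  have hrate' : ∀ u ∈ Ico T T', ∀ k, S'.rate k u = c k := fun u hu k =>
    Schedule.extend_rate_of_mem hu k
  have hint : ∀ k, Integrable (S'.rate k) := fun k =>
    Schedule.integrable_extend (h.integrable_rate k)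
  have hremT : ∀ k, S'.remaining jobs k T = S.remaining jobs k T := fun k =>
    Schedule.remaining_congr (fun u hu => hrate u hu k) T le_rfl
  have hrem : ∀ u ∈ Icc T T', ∀ k,
      S'.remaining jobs k u = S.remaining jobs k T - c k * (u - T) := fun u hu k => by
    have h1 := Schedule.remaining_sub_remaining (jobs := jobs) (hint k) hu.1
    rw [setIntegral_congr_fun measurableSet_Ico fun v hv =>
      hrate' v ⟨hv.1, hv.2.trans_le hu.2⟩ k, setIntegral_const, smul_eq_mul,
      Real.volume_real_Ico_of_le hu.1, hremT] at h1
    linarith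
  have hpend : ∀ u ∈ Ico T T', ∀ k, S'.Pending jobs k u ↔ S.Pending jobs k T := by
    intro u hu k
    have hRu : s * (u - T) < R := by
      have : u - T < R / s := by linarith [hu.2]
      rw [lt_div_iff₀ hspos] at this
      linarith
    have : 0 < S'.remaining jobs k u ↔ 0 < S.remaining jobs k T := by
      rw [hrem u ⟨hu.1, hu.2.le⟩ k]
      by_cases hk : k = j
      · subst hk
        simp only [hc, if_true]
        exact ⟨fun _ => hj.2, fun _ => by linarith⟩
      · simp [hc, hk]
    simp only [Schedule.Pending, this]
    exact and_congr_left fun _ => ⟨fun hr => hrel k (hr.trans_lt hu.2), fun hr => hr.trans hu.1⟩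
  have hdl : ∀ u ∈ Ico T T', ∀ k, S.Pending jobs k T → u < (jobs k).deadline := fun u hu k hk =>
    (hu.2.trans_le (hT'le.trans hRd)).trans_le (hjmin k hk)
  have hsum : ∀ u ∈ Ico T T', ∀ J : Finset (Fin n), j ∈ J →
      ∑ k ∈ J, S'.remaining jobs k u = ∑ k ∈ J, S.remaining jobs k T - s * (u - T) := by
    intro u hu J hjJ
    rw [Finset.sum_congr rfl fun k _ => hrem u ⟨hu.1, hu.2.le⟩ k, Finset.sum_sub_distrib,
      ← Finset.sum_mul]
    simp [hc, hjJ]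
  have hρ' : ∀ u ∈ Ico T T', 0 < plannedSpeed jobs S' u := fun u hu =>
    plannedSpeed_pos jobs S' u ((hpend u hu j).2 hj) (hdl u hu j hj)
  -- Any set attaining the maximal density has a horizon past the earliest deadline, hence may be
  -- taken to contain `j`. Its volume falls by `s * (u - T)` while the horizon shrinks by `u - T`: a
  -- density equal to `s` stays `s`, and one below `s` stays below. So the rule keeps prescribing
  -- the constant speed `s`.
  have hspeed : ∀ u ∈ Ico T T', max (plannedSpeed jobs S' u) sc = s := by
    intro u hu
    have hle : plannedSpeed jobs S' u ≤ s := by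
      obtain ⟨x, hx, hsx⟩ := exists_plannedSpeed_mul_le jobs S' u (hρ' u hu)
      obtain ⟨k, hk⟩ := Finset.nonempty_of_sum_ne_zero
        ((mul_pos (hρ' u hu) (sub_pos.2 hx)).trans_le hsx).ne'
      obtain ⟨hk1, hk2, hk3⟩ := (Finset.mem_filter.1 hk).2
      have hjx : (jobs j).deadline ≤ x := (hjmin k ((hpend u hu k).1 hk1)).trans hk3
      rw [hsum u hu _ (Finset.mem_filter.2 ⟨Finset.mem_univ j, (hpend u hu j).2 hj,
        hdl u hu j hj, hjx⟩)] at hsx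
      have h1 := sum_remaining_le_plannedSpeed_mul jobs S T (hu.1.trans_lt hx)
        (Finset.univ.filter fun k => S'.Pending jobs k u ∧ u < (jobs k).deadline ∧
          (jobs k).deadline ≤ x) fun k hk _ => by
          have := (Finset.mem_filter.1 hk).2
          exact ⟨((hpend u hu k).1 this.1).1, hu.1.trans_lt this.2.1, this.2.2⟩
      have h2 : ρ * (x - T) ≤ s * (x - T) :=
        mul_le_mul_of_nonneg_right (le_max_left _ _) (sub_pos.2 (hu.1.trans_lt hx)).le
      refine le_of_mul_le_mul_right ?_ (sub_pos.2 hx)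
      calc plannedSpeed jobs S' u * (x - u) ≤ _ := hsx
        _ ≤ s * (x - T) - s * (u - T) := by gcongr; exact h1.trans h2
        _ = s * (x - u) := by ring
    rcases le_or_gt sc ρ with hcase | hcase
    · have hsρ : s = ρ := max_eq_left hcase
      obtain ⟨x, hx, hsx⟩ := exists_plannedSpeed_mul_le jobs S T hρ
      obtain ⟨k, hk⟩ := Finset.nonempty_of_sum_ne_zero
        ((mul_pos hρ (sub_pos.2 hx)).trans_le hsx).ne'
      obtain ⟨hk1, hk2, hk3⟩ := (Finset.mem_filter.1 hk).2
      have hjx : (jobs j).deadline ≤ x := (hjmin k hk1).trans hk3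
      have hux : u < x := (hdl u hu j hj).trans_le hjx
      have h1 := sum_remaining_le_plannedSpeed_mul jobs S' u hux
        (Finset.univ.filter fun k => S.Pending jobs k T ∧ T < (jobs k).deadline ∧
          (jobs k).deadline ≤ x) fun k hk _ => by
          have := (Finset.mem_filter.1 hk).2
          exact ⟨this.1.1.trans hu.1, hdl u hu k this.1, this.2.2⟩
      rw [hsum u hu _ (Finset.mem_filter.2 ⟨Finset.mem_univ j, hj, hdj, hjx⟩)] at h1
      have hge : s ≤ plannedSpeed jobs S' u := by
        refine le_of_mul_le_mul_right ?_ (sub_pos.2 hux)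
        calc s * (x - u) = ρ * (x - T) - s * (u - T) := by rw [hsρ]; ring
          _ ≤ _ := (sub_le_sub_right hsx _).trans h1
      rw [le_antisymm hle hge, hsρ, max_eq_left hcase]
    · have hsρ : s = sc := max_eq_right hcase.le
      rw [hsρ] at hle ⊢
      exact max_eq_right hle
  have hrun : IsRunBefore g A sc jobs mode' S' T' := by
    refine h.extend hT hm₀ hm hlow hhigh hrate
      (fun t => Schedule.extend_active_iff h.active_iff Mode.working t) hint
      (fun u hu => ?_) (fun hn => absurd rfl hn) (fun _ u hu => ?_) fun u hu k hk => ?_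
    · simp [nextMode, hρ' u ⟨hu.1.le, hu.2⟩]
    · rw [hspeed u hu, Schedule.speed, Finset.sum_congr rfl fun k _ => hrate' u hu k]
      simp [hc]
    · rw [hrate' u hu] at hk
      obtain rfl : k = j := by
        by_contra hkj
        simp [hc, hkj] at hk
      exact ⟨(hpend u hu k).2 hj, fun i hi => hjmin i ((hpend u hu i).1 hi)⟩
  refine ⟨T', mode', S', hTT', hrun, ?_, openCount_lt hTT'.le (fun k => ?_) ?_⟩
  · filter_upwards [mem_nhdsWithin_of_mem_nhds (Ioi_mem_nhds hTT')] with u hu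
    exact hhigh u (le_of_lt hu)
  · rw [← hremT]
    exact Schedule.antitone_remaining (hint k) hTT'.le
  · rcases Finset.mem_insert.1 (F.min'_mem hFne) with heq | hmem
    · left
      refine ⟨j, hj.2, ?_⟩
      rw [hrem T' ⟨hTT'.le, le_rfl⟩ j]
      have : T' - T = R / s := by linarith [hT'.trans heq]
      rw [this]
      simp only [hc, if_true]
      rw [mul_div_cancel₀ _ hspos.ne', hR, sub_self]
    · right
      obtain ⟨h1, h2⟩ := Finset.mem_filter.1 hmem
      obtain ⟨k, -, hk⟩ := Finset.mem_image.1 h1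
      exact ⟨k, by rw [hk]; exact h2, by rw [hk]⟩

/-- The potential is three times the number of unfinished plus unreleased jobs, plus the rank of the
mode. A working piece lowers the count, which outweighs a rise of the rank by at most `2`. A piece
without work does not raise the count and ends with a drop of rank, from idle to sleep or working,
or from sleep to working. -/
theorem IsRunBefore.exists_isSOARun (hg : 0 ≤ g) (k : ℕ) :
    ∀ (T : ℝ) (mode : ℝ → Mode) (S : Schedule n) (m₀ : Mode), 0 ≤ T →
      IsRunBefore g A sc jobs mode S T → (∀ᶠ u in 𝓝[<] T, mode u = m₀) →
      3 * openCount jobs S T + (nextMode sc (plannedSpeed jobs S T)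
        (A ≤ g * idleTime mode T) m₀).rank ≤ k →
      ∃ mode' S', IsSOARun g A sc jobs mode' S' := by
  induction k using Nat.strong_induction_on with
  | _ k ih =>
    intro T mode S m₀ hT h hm₀ hk
    have hrank : ∀ m : Mode, m.rank ≤ 2 := fun m => by cases m <;> simp [Mode.rank]
    rcases eq_or_ne (nextMode sc (plannedSpeed jobs S T) (A ≤ g * idleTime mode T) m₀)
      Mode.working with hm | hm
    · obtain ⟨T', mode', S', hTT', h', hleft, hlt⟩ := h.extend_of_working hT hm₀ hm
      refine ih _ ?_ T' mode' S' _ (hT.trans hTT'.le) h' hleft le_rfl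
      have := hrank (nextMode sc (plannedSpeed jobs S' T') (A ≤ g * idleTime mode' T')
        Mode.working)
      omega
    · rcases h.extend_of_ne_working hT hg hm₀ rfl hm with hdone | ⟨T', mode', S', hTT', h', hleft,
        hne, hrem⟩
      · exact hdone
      · refine ih _ ?_ T' mode' S' _ (hT.trans hTT'.le) h' hleft le_rfl
        have hle := openCount_le hTT'.le hrem
        refine lt_of_lt_of_le ?_ hk
        refine add_lt_add_of_le_of_lt (Nat.mul_le_mul_left 3 hle) ?_
        revert hne hm
        generalize nextMode sc (plannedSpeed jobs S T) (A ≤ g * idleTime mode T) m₀ = m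
        intro hm hne
        cases m with
        | working => exact absurd rfl hm
        | sleep =>
          simp only [nextMode] at hne ⊢
          split_ifs at hne ⊢ <;> simp_all [Mode.rank]
        | idle =>
          simp only [nextMode] at hne ⊢
          split_ifs at hne ⊢ <;> simp_all [Mode.rank]

/-- The algorithm is well defined. -/
theorem exists_isSOARun (hg : 0 ≤ g) (jobs : Fin n → Job) :
    ∃ (mode : ℝ → Mode) (S : Schedule n), IsSOARun g A sc jobs mode S := by
  set S : Schedule n := ⟨fun _ _ => 0, ∅, fun _ _ => le_rfl, fun _ => measurable_const,
    MeasurableSet.empty, empty_subset _⟩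
  refine IsRunBefore.exists_isSOARun hg _ 0 (fun _ => Mode.sleep) S Mode.sleep le_rfl ?_
    (Eventually.of_forall fun _ => rfl) le_rfl
  refine ⟨fun _ _ => rfl, fun t => by simp [S], fun _ => integrable_zero _ _ _, fun t ht => ?_,
    fun _ _ _ _ => rfl, fun _ _ h => (nomatch h), fun _ _ _ h => absurd h (lt_irrefl _)⟩
  have hρ : plannedSpeed jobs S t = 0 := plannedSpeed_eq_zero fun j hj =>
    absurd (ht.trans_le (jobs j).release_nonneg) (not_lt.2 hj.1)
  exact ⟨Mode.sleep, Eventually.of_forall fun _ => rfl, by simp [nextMode, hρ],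
    Eventually.of_forall fun _ => rfl⟩

end Existence

end SpeedScaling

namespace SpeedScaling

/-! ### Comparison of measures on components -/

theorem exists_Ico_subset_of_eventually {U : Set ℝ} {t : ℝ} (ht : t ∈ U)
    (h : ∀ᶠ u in 𝓝[>] t, u ∈ U) : ∃ u > t, Ico t u ⊆ U := by
  obtain ⟨u, hu, hsub⟩ := mem_nhdsGT_iff_exists_Ioo_subset.1 h
  refine ⟨u, hu, fun v hv => ?_⟩
  rcases hv.1.eq_or_lt with rfl | hlt
  exacts [ht, hsub ⟨hlt, hv.2⟩]

/-- Let `U` be a set of reals that is a right neighbourhood of each of its points. Two measures that compare on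
every component of `U` compare on `U`. -/
theorem measure_le_of_forall_ordConnectedComponent {U : Set ℝ}
    (hU : ∀ t ∈ U, ∀ᶠ u in 𝓝[>] t, u ∈ U) {μ ν : Measure ℝ}
    (h : ∀ t ∈ U, μ (ordConnectedComponent U t) ≤ ν (ordConnectedComponent U t)) :
    μ U ≤ ν U := by
  -- `U` need not be open, but each component contains an interval `[t, u)` and hence a rational, so
  -- there are countably many.
  set 𝒞 : Set (Set ℝ) := (fun q : ℚ => ordConnectedComponent U q) '' {q | (q : ℝ) ∈ U} with h𝒞
  have hcount : 𝒞.Countable := (to_countable _).image _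
  have hunion : ⋃₀ 𝒞 = U := by
    refine subset_antisymm (sUnion_subset ?_) fun t ht => ?_
    · rintro _ ⟨q, -, rfl⟩
      exact ordConnectedComponent_subset
    · obtain ⟨u, hu, hsub⟩ := exists_Ico_subset_of_eventually ht (hU t ht)
      obtain ⟨q, hq1, hq2⟩ := exists_rat_btwn hu
      have hsub' : uIcc (q : ℝ) t ⊆ U := by
        rw [uIcc_of_ge hq1.le]
        exact fun v hv => hsub ⟨hv.1, hv.2.trans_lt hq2⟩
      exact mem_sUnion.2 ⟨_, ⟨q, hsub ⟨hq1.le, hq2⟩, rfl⟩, mem_ordConnectedComponent.2 hsub'⟩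
  have hdisj : 𝒞.PairwiseDisjoint id := by
    rintro _ ⟨q, -, rfl⟩ _ ⟨r, -, rfl⟩ hne
    refine disjoint_left.2 fun x hx hx' => hne ?_
    change ordConnectedComponent U q = ordConnectedComponent U r
    rw [ordConnectedComponent_eq (mem_ordConnectedComponent.1 hx),
      ordConnectedComponent_eq (mem_ordConnectedComponent.1 hx')]
  have hmeas : ∀ C ∈ 𝒞, MeasurableSet C := by
    rintro _ ⟨q, -, rfl⟩
    exact (inferInstance : OrdConnected (ordConnectedComponent U (q : ℝ))).measurableSet
  rw [← hunion, measure_sUnion hcount hdisj hmeas, measure_sUnion hcount hdisj hmeas]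
  refine ENNReal.tsum_le_tsum ?_
  rintro ⟨_, q, hq, rfl⟩
  exact h q hq

/-! ### The speed above a given level -/

section Level

variable {n : ℕ} {g A sc : ℝ} {jobs : Fin n → Job} {mode : ℝ → Mode} {S : Schedule n}

namespace IsSOARun

variable (h : IsSOARun g A sc jobs mode S)
include h

theorem working_of_rate_pos {t : ℝ} {j : Fin n} (hj : 0 < S.rate j t) :
    mode t = Mode.working :=
  h.working_iff.2 (hj.trans_le (S.rate_le_speed j t))

open Classical in
/-- The density attaining the planned speed is that of jobs with deadlines after the earliest
deadline. -/
theorem exists_density {t : ℝ} {j : Fin n} (hj : 0 < S.rate j t) :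
    ∃ x, ∃ J : Finset (Fin n), (jobs j).deadline ≤ x ∧ (∀ k ∈ J, S.Pending jobs k t ∧
      (jobs j).deadline ≤ (jobs k).deadline ∧ (jobs k).deadline ≤ x) ∧
      plannedSpeed jobs S t * (x - t) ≤ ∑ k ∈ J, S.remaining jobs k t := by
  have hρ := h.plannedSpeed_pos (h.working_of_rate_pos hj)
  obtain ⟨x, hx, hle⟩ := exists_plannedSpeed_mul_le jobs S t hρ
  have hmin := (h.earliest_deadline t j hj).2
  obtain ⟨k, hk⟩ := Finset.nonempty_of_sum_ne_zero
    ((mul_pos hρ (sub_pos.2 hx)).trans_le hle).ne'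
  have hk' := (Finset.mem_filter.1 hk).2
  refine ⟨x, _, (hmin k hk'.1).trans hk'.2.2, fun i hi => ?_, hle⟩
  have hi' := (Finset.mem_filter.1 hi).2
  exact ⟨hi'.1, hmin i hi'.1, hi'.2.2⟩

/-- If the planned speed at `b` is at most `y` and jobs with deadlines after `b` are processed at
speed at most `M` on `[t, b)`, then the planned speed at `t` is limited. -/
theorem plannedSpeed_mul_le {t b y M : ℝ} (htb : t ≤ b) (hb : plannedSpeed jobs S b ≤ y)
    (hM : 0 ≤ M)
    (hspeed : ∀ u ∈ Ico t b, ∀ k, 0 < S.rate k u → b < (jobs k).deadline → S.speed u ≤ M)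
    {j : Fin n} (hj : 0 < S.rate j t) (hjb : b < (jobs j).deadline) :
    ∃ x, (jobs j).deadline ≤ x ∧
      plannedSpeed jobs S t * (x - t) ≤ y * (x - b) + M * (b - t) := by
  obtain ⟨x, J, hjx, hJ, hle⟩ := h.exists_density hj
  have hbx : b < x := hjb.trans_le hjx
  refine ⟨x, hjx, hle.trans ?_⟩
  -- The work pending at `t` splits into what is left at `b`, with density at most `y`, and what is
  -- processed on `[t, b)`, at speed at most `M`.
  have h1 : ∑ k ∈ J, S.remaining jobs k b ≤ y * (x - b) := by
    refine (sum_remaining_le_plannedSpeed_mul jobs S b hbx J fun k hk _ => ?_).trans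
      (mul_le_mul_of_nonneg_right hb (sub_pos.2 hbx).le)
    obtain ⟨hp, hjk, hkx⟩ := hJ k hk
    exact ⟨hp.1.trans htb, hjb.trans_le hjk, hkx⟩
  have h2 : ∑ k ∈ J, ∫ u in Ico t b, S.rate k u ≤ M * (b - t) := by
    rw [← integral_finsetSum J fun k _ => (h.integrable_rate k).integrableOn]
    have : ∫ u in Ico t b, ∑ k ∈ J, S.rate k u ≤ ∫ _ in Ico t b, M := by
      refine setIntegral_mono_on (integrable_finsetSum _ fun k _ =>
        (h.integrable_rate k).integrableOn) (integrableOn_const measure_Ico_lt_top.ne)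
        measurableSet_Ico fun u hu => ?_
      by_cases hex : ∃ k ∈ J, 0 < S.rate k u
      · obtain ⟨k, hk, hpos⟩ := hex
        exact (Finset.sum_le_sum_of_subset_of_nonneg (Finset.subset_univ J)
          fun i _ _ => S.rate_nonneg i u).trans
          (hspeed u hu k hpos (hjb.trans_le (hJ k hk).2.1))
      · push Not at hex
        exact (Finset.sum_nonpos hex).trans hM
    rwa [setIntegral_const, smul_eq_mul, Real.volume_real_Ico_of_le htb, mul_comm] at this
  have h3 : ∑ k ∈ J, S.remaining jobs k t =
      ∑ k ∈ J, S.remaining jobs k b + ∑ k ∈ J, ∫ u in Ico t b, S.rate k u := by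
    rw [← Finset.sum_add_distrib]
    refine Finset.sum_congr rfl fun k _ => ?_
    rw [h.integral_rate_Ico k htb]
    ring
  linarith

omit h in
theorem remaining_le_volume (j : Fin n) (t : ℝ) : S.remaining jobs j t ≤ (jobs j).volume :=
  sub_le_self _ (integral_nonneg fun u => S.rate_nonneg j u)

/-- If the planned speed at `b` is at most `y`, then jobs with deadlines after `b` are processed
before `b` at speed at most `max y sc`. -/
theorem speed_le_max {a b y : ℝ} (hy : 0 ≤ y) (hb : plannedSpeed jobs S b ≤ y) {t : ℝ}
    (ht : t ∈ Ico a b) {j : Fin n} (hj : 0 < S.rate j t) (hjb : b < (jobs j).deadline) :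
    S.speed t ≤ max y sc := by
  -- Let `M` be the supremum of the speeds in question. If `M` exceeded `z = max y sc`, each such
  -- speed above `z` would be a density, bounded by an average of `z` and `M` in which `z` has a
  -- fixed positive weight; then `M` could not be the supremum.
  set V : Set ℝ := S.speed '' {u | u ∈ Ico a b ∧ ∃ k, 0 < S.rate k u ∧ b < (jobs k).deadline}
    with hV
  obtain ⟨b', hb', hbb'⟩ :=
    ((eventually_lt_of_lt (fun k => (jobs k).deadline) b).and self_mem_nhdsWithin).exists
  have hδ : 0 < b' - b := sub_pos.2 hbb'
  set z := max y sc with hz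
  have hz0 : 0 ≤ z := hy.trans (le_max_left _ _)
  have hℓ : 0 < b - a := by linarith [ht.1, ht.2]
  -- Horizons here reach past `b'`, so densities are at most the total volume divided by `b' - b`.
  have hbound : ∀ v ∈ V, v ≤ max z ((∑ k, (jobs k).volume) / (b' - b)) := by
    rintro _ ⟨u, ⟨hu, k, hk, hkb⟩, rfl⟩
    rw [h.speed_eq u (h.working_of_rate_pos hk)]
    refine max_le ?_ ((le_max_right y sc).trans (le_max_left _ _))
    refine le_max_of_le_right ?_
    obtain ⟨x, J, hkx, hJ, hle⟩ := h.exists_density hk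
    rw [le_div_iff₀ hδ]
    calc plannedSpeed jobs S u * (b' - b) ≤ plannedSpeed jobs S u * (x - u) := by
          refine mul_le_mul_of_nonneg_left ?_ (plannedSpeed_nonneg _ _ _)
          linarith [hu.2, hb' k hkb]
      _ ≤ ∑ k ∈ J, S.remaining jobs k u := hle
      _ ≤ ∑ k ∈ J, (jobs k).volume := Finset.sum_le_sum fun k _ => remaining_le_volume k u
      _ ≤ ∑ k, (jobs k).volume := Finset.sum_le_sum_of_subset_of_nonneg (Finset.subset_univ J)
          fun k _ _ => (jobs k).volume_pos.le
  have hbdd : BddAbove V := ⟨_, hbound⟩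
  set M := sSup V with hM
  have hmem : S.speed t ∈ V := ⟨t, ⟨ht, j, hj, hjb⟩, rfl⟩
  have hM0 : 0 ≤ M := (S.speed_nonneg t).trans (le_csSup hbdd hmem)
  refine (le_csSup hbdd hmem).trans ?_
  by_contra! hlt
  have hden : 0 < (b' - b) + (b - a) := by linarith
  -- The weight `b' - b` of `z` is a lower bound on the horizon after `b`, and the weight `b - a` of
  -- `M` an upper bound on the time before it; both are independent of `u`.
  have hle : M ≤ max z (((b' - b) * z + (b - a) * M) / ((b' - b) + (b - a))) := by
    refine csSup_le ⟨_, hmem⟩ ?_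
    rintro _ ⟨u, ⟨hu, k, hk, hkb⟩, rfl⟩
    have hle : S.speed u ≤ M := le_csSup hbdd ⟨u, ⟨hu, k, hk, hkb⟩, rfl⟩
    rcases le_or_gt (S.speed u) z with hzu | hzu
    · exact le_max_of_le_left hzu
    refine le_max_of_le_right ?_
    have hs := h.speed_eq u (h.working_of_rate_pos hk)
    have hsρ : S.speed u = plannedSpeed jobs S u := by
      rcases max_choice (plannedSpeed jobs S u) sc with hc | hc
      · rw [hs, hc]
      · rw [hs, hc] at hzu
        exact absurd hzu (not_lt.2 (le_max_right _ _))
    obtain ⟨x, hkx, hx⟩ := h.plannedSpeed_mul_le hu.2.le hb hM0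
      (fun v hv i hi hib => le_csSup hbdd ⟨v, ⟨⟨hu.1.trans hv.1, hv.2⟩, i, hi, hib⟩, rfl⟩) hk hkb
    rw [← hsρ] at hx
    rw [le_div_iff₀ hden]
    have hx' : b' - b ≤ x - b := by linarith [hb' k hkb]
    have hyz : y ≤ z := le_max_left _ _
    have e1 : (b' - b) * (S.speed u - z) ≤ (x - b) * (S.speed u - y) :=
      mul_le_mul hx' (by linarith) (by linarith) (by linarith)
    have e2 : (M - S.speed u) * (b - u) ≤ (M - S.speed u) * (b - a) :=
      mul_le_mul_of_nonneg_left (by linarith [hu.1]) (by linarith)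
    nlinarith
  have : ((b' - b) * z + (b - a) * M) / ((b' - b) + (b - a)) < M := by
    rw [div_lt_iff₀ hden]
    nlinarith
  exact absurd hle (not_le.2 (max_lt hlt this))

/-- At levels from `sc` upwards neither the clamp at `sc` nor the mode matters: a planned speed
above such a level switches the machine to work. -/
theorem lt_speed_iff {y t : ℝ} (hsc : 0 ≤ sc) (hy : sc ≤ y) :
    y < S.speed t ↔ y < plannedSpeed jobs S t := by
  constructor
  · intro hlt
    have hw := h.working_iff.2 ((hsc.trans hy).trans_lt hlt)
    rw [h.speed_eq t hw, lt_max_iff] at hlt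
    exact hlt.resolve_right (not_lt.2 hy)
  · intro hlt
    have hw := h.mode_eq_working ((hsc.trans hy).trans_lt hlt) (hy.trans hlt.le)
    rw [h.speed_eq t hw]
    exact lt_max_of_lt_left hlt

/-- A set of jobs with density above `y` still has density above `y` shortly afterwards, by
continuity of the remaining volumes. There is no analogue to the left: a release may make the speed
jump up, so components of `{speed > y}` can contain their left end. -/
theorem eventually_lt_speed {y t : ℝ} (hsc : 0 ≤ sc) (hy : sc ≤ y) (ht : y < S.speed t) :
    ∀ᶠ u in 𝓝[>] t, y < S.speed u := by
  classical
  simp only [h.lt_speed_iff hsc hy] at ht ⊢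
  have hρ := (hsc.trans hy).trans_lt ht
  obtain ⟨x, hx, hle⟩ := exists_plannedSpeed_mul_le jobs S t hρ
  set J : Finset (Fin n) := Finset.univ.filter fun j => S.Pending jobs j t ∧
    t < (jobs j).deadline ∧ (jobs j).deadline ≤ x with hJ
  have hcont : Continuous fun u => ∑ j ∈ J, S.remaining jobs j u - y * (x - u) := by
    refine (continuous_finsetSum _ fun j _ =>
      Schedule.continuous_remaining (h.integrable_rate j)).sub (by fun_prop)
  have hpos : 0 < ∑ j ∈ J, S.remaining jobs j t - y * (x - t) := by
    have := mul_lt_mul_of_pos_right ht (sub_pos.2 hx)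
    linarith
  filter_upwards [self_mem_nhdsWithin, mem_nhdsWithin_of_mem_nhds (Iio_mem_nhds hx),
    eventually_lt_of_lt (fun k => (jobs k).deadline) t,
    (hcont.tendsto t).eventually_const_lt hpos |>.filter_mono nhdsWithin_le_nhds]
    with u hu hux hd hc
  have h1 := sum_remaining_le_plannedSpeed_mul jobs S u hux J fun j hj _ => by
    have := (Finset.mem_filter.1 hj).2
    exact ⟨this.1.1.trans (le_of_lt hu), hd j this.2.1, this.2.2⟩
  have hux' : 0 < x - u := sub_pos.2 hux
  exact lt_of_mul_lt_mul_right (by linarith) hux'.le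

theorem exists_rate_pos_of_working {t : ℝ} (hw : mode t = Mode.working) :
    ∃ j, 0 < S.rate j t := by
  by_contra! hn
  exact (h.speed_pos hw).not_ge (Finset.sum_nonpos fun j _ => hn j)

theorem integral_rate_le (j : Fin n) (C : Set ℝ) {x : ℝ} (hC : C ⊆ Ici x) :
    ∫ u in C, S.rate j u ≤ S.remaining jobs j x := by
  have hxd : x ≤ max x (jobs j).deadline := le_max_left _ _
  have h1 := h.integral_rate_Ico j hxd
  rw [h.remaining_eq_zero (le_max_right x (jobs j).deadline), sub_zero] at h1
  rw [← h1]
  have h2 : ∫ u in Ico x (max x (jobs j).deadline), S.rate j u = ∫ u in Ici x, S.rate j u := by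
    refine setIntegral_eq_of_subset_of_forall_sdiff_eq_zero measurableSet_Ici
      Ico_subset_Ici_self (fun u hu => ?_) |>.symm
    refine h.rate_eq_zero_of_not_pending fun hp => hu.2 ⟨hu.1, ?_⟩
    exact (h.lt_deadline_of_pending hp).trans_le (le_max_right _ _)
  rw [h2]
  exact setIntegral_mono_set (h.integrable_rate j).integrableOn
    (Eventually.of_forall fun u => S.rate_nonneg j u) hC.eventuallyLE

theorem integral_rate_le_volume (j : Fin n) (C : Set ℝ) :
    ∫ u in C, S.rate j u ≤ (jobs j).volume := by
  refine (setIntegral_le_integral (h.integrable_rate j)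
    (Eventually.of_forall fun u => S.rate_nonneg j u)).trans ?_
  rw [← setIntegral_eq_integral_of_forall_compl_eq_zero (s := Ici (jobs j).release) fun u hu =>
    h.rate_eq_zero_of_not_pending fun hp => hu hp.1, ← h.remaining_release le_rfl]
  exact h.integral_rate_le j _ Subset.rfl

open Classical in
/-- On a component of the set of times at which the speed exceeds `y`, the work done above
level `y` is at most the volume of the jobs that live within that component. -/
theorem lintegral_component_le {y t : ℝ} (hsc : 0 ≤ sc) (hy : sc ≤ y) (ht : y < S.speed t) :
    ∫⁻ u in ordConnectedComponent {u | y < S.speed u} t, ENNReal.ofReal (S.speed u - y) ≤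
      ∑ j with (jobs j).release ∈ ordConnectedComponent {u | y < S.speed u} t ∧
        Ico (jobs j).release (jobs j).deadline ⊆ {u | y < S.speed u},
        ENNReal.ofReal (jobs j).volume := by
  have hy0 : 0 ≤ y := hsc.trans hy
  set U := {u | y < S.speed u} with hU
  set C := ordConnectedComponent U t with hC
  have hCU : C ⊆ U := ordConnectedComponent_subset
  have htC : t ∈ C := self_mem_ordConnectedComponent.2 ht
  have hconn : OrdConnected C := inferInstance
  have hright : ∀ u ∈ U, ∃ v > u, Ico u v ⊆ U := fun u hu =>
    exists_Ico_subset_of_eventually hu (h.eventually_lt_speed hsc hy hu)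
  have hext : ∀ u ∈ C, ∀ v, uIcc u v ⊆ U → v ∈ C := fun u hu v huv => by
    rw [hC, ordConnectedComponent_eq hu]
    exact mem_ordConnectedComponent.2 huv
  have hpend : ∀ u ∈ U, ∃ j, 0 < S.rate j u := fun u hu =>
    h.exists_rate_pos_of_working (h.working_iff.2 (hy0.trans_lt hu))
  have hbelow : BddBelow C := ⟨0, fun u hu => by
    obtain ⟨j, hj⟩ := hpend u (hCU hu)
    exact (jobs j).release_nonneg.trans (h.pending_of_rate_pos hj).1⟩
  have habove : BddAbove C := by
    refine ⟨∑ j, |(jobs j).deadline|, fun u hu => ?_⟩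
    obtain ⟨j, hj⟩ := hpend u (hCU hu)
    refine (h.lt_deadline_of_pending (h.pending_of_rate_pos hj)).le.trans
      ((le_abs_self _).trans ?_)
    exact Finset.single_le_sum (f := fun j => |(jobs j).deadline|) (fun j _ => abs_nonneg _)
      (Finset.mem_univ j)
  set a := sInf C with ha
  set b := sSup C with hb
  have hCa : ∀ u ∈ C, a ≤ u := fun u hu => csInf_le hbelow hu
  have hCb' : ∀ u ∈ C, u ≤ b := fun u hu => le_csSup habove hu
  have hIcoC : ∀ u ∈ C, Ico u b ⊆ C := fun u hu v hv => by
    obtain ⟨w, hw, hvw⟩ := exists_lt_of_lt_csSup ⟨t, htC⟩ hv.2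
    exact hconn.out hu hw ⟨hv.1, hvw.le⟩
  have hIocC : ∀ u ∈ C, Ioc a u ⊆ C := fun u hu v hv => by
    obtain ⟨w, hw, hvw⟩ := exists_lt_of_csInf_lt ⟨t, htC⟩ hv.1
    exact hconn.out hw hu ⟨hvw.le, hv.2⟩
  -- Since `U` is a right neighbourhood of its points, a component cannot contain its right end. So
  -- the planned speed at `b` is at most `y`.
  have hbU : b ∉ U := fun hbU => by
    obtain ⟨v, hv, hsub⟩ := hright b hbU
    have htb := hCb' t htC
    have hmem : (b + v) / 2 ∈ C := hext t htC _ fun w hw => by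
      rw [uIcc_of_le (by linarith)] at hw
      rcases lt_or_ge w b with hwb | hwb
      · exact hCU (hIcoC t htC ⟨hw.1, hwb⟩)
      · exact hsub ⟨hwb, by linarith [hw.2]⟩
    linarith [hCb' _ hmem]
  have hCb : ∀ u ∈ C, u < b := fun u hu => (hCb' u hu).lt_of_ne fun he => hbU (he ▸ hCU hu)
  have hρb : plannedSpeed jobs S b ≤ y := not_lt.1 fun hlt => hbU ((h.lt_speed_iff hsc hy).2 hlt)
  -- By `speed_le_max`, a job with a deadline after `b` would be processed at speed at most `y`,
  -- which does not happen in `C`.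
  have hdl : ∀ u ∈ C, ∀ j, 0 < S.rate j u → (jobs j).deadline ≤ b := fun u hu j hj => by
    by_contra! hlt
    have := h.speed_le_max hy0 hρb (a := u) ⟨le_rfl, hCb u hu⟩ hj hlt
    rw [max_eq_left hy] at this
    exact absurd (hCU hu) (not_lt.2 this)
  have hmeasC : MeasurableSet C := hconn.measurableSet
  have hvol : volume.real C = b - a := by
    have h1 : Ioo a b ⊆ C := fun u hu => by
      rcases le_total u t with hut | hut
      · exact hIocC t htC ⟨hu.1, hut⟩
      · exact hIcoC t htC ⟨hut, hu.2⟩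
    have h2 : C ⊆ Icc a b := fun u hu => ⟨hCa u hu, hCb' u hu⟩
    have hab : a ≤ b := (hCa t htC).trans (hCb' t htC)
    refine le_antisymm ?_ ?_
    · rw [← Real.volume_real_Icc_of_le hab]
      exact measureReal_mono h2 measure_Icc_lt_top.ne
    · rw [← Real.volume_real_Ioo_of_le hab]
      exact measureReal_mono h1 ((measure_mono h2).trans_lt measure_Icc_lt_top).ne
  have hCfin : volume C ≠ ⊤ :=
    ((measure_mono fun u hu => (⟨hCa u hu, hCb' u hu⟩ : u ∈ Icc a b)).trans_lt
      measure_Icc_lt_top).ne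
  set New := Finset.univ.filter fun j => (jobs j).release ∈ C ∧
        Ico (jobs j).release (jobs j).deadline ⊆ U with hNew
  -- Processed jobs not released in `C` were released by its left end and are due by `b`. Those
  -- released in `C` have their whole lifetime in `C`, hence are in `New`.
  set Old := Finset.univ.filter fun j => (jobs j).release ∉ C ∧ ∃ u ∈ C, 0 < S.rate j u with hOld
  have hOldrel : ∀ j ∈ Old, (jobs j).release ≤ a ∧ (jobs j).deadline ≤ b := fun j hj => by
    obtain ⟨hr, u, hu, hju⟩ := (Finset.mem_filter.1 hj).2
    refine ⟨le_of_not_gt fun hlt => hr (hIocC u hu ⟨hlt, (h.pending_of_rate_pos hju).1⟩),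
      hdl u hu j hju⟩
  -- times outside `U` just before the component
  have hbefore : ∀ ε > 0, ∃ x, a - ε ≤ x ∧ x ≤ a ∧ x ∉ U ∧ ∀ j ∈ Old, (jobs j).release ≤ x := by
    intro ε hε
    by_cases haU : a ∈ U
    · have haC : a ∈ C := hext t htC a fun w hw => by
        rw [uIcc_of_ge (hCa t htC)] at hw
        rcases hw.1.eq_or_lt with rfl | hlt
        exacts [haU, hCU (hIocC t htC ⟨hlt, hw.2⟩)]
      have hev : ∀ᶠ x in 𝓝[<] a, ∀ j ∈ Old, (jobs j).release ≤ x := by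
        refine (Finset.eventually_all Old).2 fun j hj => ?_
        have hlt : (jobs j).release < a := (hOldrel j hj).1.lt_of_ne fun he =>
          (Finset.mem_filter.1 hj).2.1 (he ▸ haC)
        filter_upwards [mem_nhdsWithin_of_mem_nhds (Ioi_mem_nhds hlt)] with x hx using le_of_lt hx
      have hfreq : ∃ᶠ x in 𝓝[<] a, x ∉ U := by
        intro hev'
        simp only [not_not] at hev'
        obtain ⟨v, hv, hsub⟩ := mem_nhdsLT_iff_exists_Ioo_subset.1 hev'
        have hmem : (v + a) / 2 ∈ C := hext a haC _ fun w hw => by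
          have hva : v < a := hv
          rw [uIcc_of_ge (by linarith)] at hw
          rcases hw.2.eq_or_lt with rfl | hlt
          · exact haU
          · exact hsub ⟨by linarith [hw.1], hlt⟩
        have hva : v < a := hv
        linarith [hCa _ hmem]
      have hev' : ∀ᶠ x in 𝓝[<] a, a - ε < x :=
        mem_nhdsWithin_of_mem_nhds (Ioi_mem_nhds (sub_lt_self a hε))
      have hev'' : ∀ᶠ x in 𝓝[<] a, x < a := self_mem_nhdsWithin
      obtain ⟨x, hxU, hx1, hx2, hx3⟩ := (hfreq.and_eventually (hev.and (hev'.and hev''))).exists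
      exact ⟨x, le_of_lt hx2, le_of_lt hx3, hxU, hx1⟩
    · exact ⟨a, by linarith, le_rfl, haU, fun j hj => (hOldrel j hj).1⟩
  have hrateC : ∀ j, j ∉ New → j ∉ Old → ∫ u in C, S.rate j u = 0 := by
    intro j hjN hjO
    refine setIntegral_eq_zero_of_forall_eq_zero fun u hu => ?_
    by_contra hne
    have hpos : 0 < S.rate j u := (S.rate_nonneg j u).lt_of_ne (Ne.symm hne)
    have hr : (jobs j).release ∈ C := by
      by_contra hr
      exact hjO (Finset.mem_filter.2 ⟨Finset.mem_univ j, hr, u, hu, hpos⟩)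
    refine hjN (Finset.mem_filter.2 ⟨Finset.mem_univ j, hr, fun v hv => ?_⟩)
    exact hCU (hIcoC _ hr ⟨hv.1, hv.2.trans_le (hdl u hu j hpos)⟩)
  have hdisj : Disjoint New Old := Finset.disjoint_left.2 fun j hj hj' =>
    (Finset.mem_filter.1 hj').2.1 (Finset.mem_filter.1 hj).2.1
  have hspeedC : ∫ u in C, S.speed u =
      (∑ j ∈ New, ∫ u in C, S.rate j u) + ∑ j ∈ Old, ∫ u in C, S.rate j u := by
    simp only [Schedule.speed]
    rw [integral_finsetSum _ fun k _ => (h.integrable_rate k).integrableOn,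
      ← Finset.sum_union hdisj]
    refine (Finset.sum_subset (Finset.subset_univ _) fun j _ hj => ?_).symm
    rw [Finset.mem_union, not_or] at hj
    exact hrateC j hj.1 hj.2
  have hsubint : IntegrableOn (fun u => S.speed u - y) C :=
    h.integrable_speed.integrableOn.sub (integrableOn_const hCfin)
  -- The old jobs use at most `y * (b - x)`, where `x` is a time just before the component with
  -- planned speed at most `y`. Subtracting `y * (b - a)` and letting `x` tend to `a` leaves the new
  -- jobs only.
  have hmain : ∫ u in C, (S.speed u - y) ≤ ∑ j ∈ New, (jobs j).volume := by
    rw [integral_sub h.integrable_speed.integrableOn (integrableOn_const hCfin), setIntegral_const,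
      smul_eq_mul, hvol, hspeedC]
    have hN : ∑ j ∈ New, ∫ u in C, S.rate j u ≤ ∑ j ∈ New, (jobs j).volume :=
      Finset.sum_le_sum fun j _ => h.integral_rate_le_volume j C
    refine le_of_forall_pos_le_add fun ε hε => ?_
    obtain ⟨x, hx1, hx2, hxU, hxO⟩ := hbefore (ε / (y + 1)) (by positivity)
    have hab : a < b := (hCa t htC).trans_lt (hCb t htC)
    have hρx : plannedSpeed jobs S x ≤ y :=
      not_lt.1 fun hlt => hxU ((h.lt_speed_iff hsc hy).2 hlt)
    have hO : ∑ j ∈ Old, ∫ u in C, S.rate j u ≤ y * (b - x) := by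
      refine (Finset.sum_le_sum fun j _ => h.integral_rate_le j C
        fun u hu => hx2.trans (hCa u hu)).trans ?_
      refine (sum_remaining_le_plannedSpeed_mul jobs S x (by linarith) Old
        fun j hj hpos => ⟨hxO j hj, ?_, (hOldrel j hj).2⟩).trans
        (mul_le_mul_of_nonneg_right hρx (by linarith))
      exact h.lt_deadline_of_pending ⟨hxO j hj, hpos⟩
    have hyε : y * (a - x) ≤ ε := by
      have h1 : y * (a - x) ≤ y * (ε / (y + 1)) := mul_le_mul_of_nonneg_left (by linarith) hy0
      refine h1.trans ?_
      rw [mul_div_assoc', div_le_iff₀ (by positivity)]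
      nlinarith
    nlinarith
  rw [← ofReal_integral_eq_lintegral_ofReal hsubint
    ((ae_restrict_mem hmeasC).mono fun u hu => sub_nonneg.2 (le_of_lt (hCU hu))),
    ← ENNReal.ofReal_sum_of_nonneg fun j _ => (jobs j).volume_pos.le]
  exact ENNReal.ofReal_le_ofReal hmain

open Classical in
/-- The work done above level `y ≥ sc` is at most the volume of the jobs during whose lifetimes
the speed always exceeds `y`. -/
theorem lintegral_speed_sub_le {y : ℝ} (hsc : 0 ≤ sc) (hy : sc ≤ y) :
    ∫⁻ u, ENNReal.ofReal (S.speed u - y) ≤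
      ∑ j with Ico (jobs j).release (jobs j).deadline ⊆ {u | y < S.speed u},
        ENNReal.ofReal (jobs j).volume := by
  set U := {u | y < S.speed u} with hU
  have hUmeas : MeasurableSet U := measurableSet_lt measurable_const S.measurable_speed
  set J := Finset.univ.filter fun j => Ico (jobs j).release (jobs j).deadline ⊆ U with hJ
  -- Placing the volume of each job at its release time charges it to one component only, so the
  -- bounds on the components add up.
  set ν : Measure ℝ := ∑ j ∈ J, ENNReal.ofReal (jobs j).volume • Measure.dirac (jobs j).release
  set μ : Measure ℝ := volume.withDensity fun u => ENNReal.ofReal (S.speed u - y)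
  have hν : ∀ C, MeasurableSet C →
      ν C = ∑ j ∈ J, ENNReal.ofReal (jobs j).volume * C.indicator 1 (jobs j).release := by
    intro C hC
    simp [ν, Measure.finsetSum_apply, Measure.dirac_apply' _ hC]
  have hcomp : μ U ≤ ν U := by
    refine measure_le_of_forall_ordConnectedComponent (U := U)
      (fun t ht => h.eventually_lt_speed hsc hy (ht)) fun t ht => ?_
    have hmeas : MeasurableSet (ordConnectedComponent U t) :=
      (inferInstance : OrdConnected (ordConnectedComponent U t)).measurableSet
    rw [withDensity_apply _ hmeas, hν _ hmeas]
    have key := h.lintegral_component_le hsc hy ht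
    rw [← hU] at key
    refine key.trans_eq ?_
    rw [hJ, Finset.sum_filter, Finset.sum_filter]
    refine Finset.sum_congr rfl fun j _ => ?_
    by_cases h1 : (jobs j).release ∈ ordConnectedComponent U t <;>
      by_cases h2 : Ico (jobs j).release (jobs j).deadline ⊆ U <;> simp [h1, h2]
  calc ∫⁻ u, ENNReal.ofReal (S.speed u - y) = μ U := by
        rw [withDensity_apply _ hUmeas, ← lintegral_indicator hUmeas]
        refine lintegral_congr fun u => ?_
        by_cases hu : u ∈ U
        · rw [indicator_of_mem hu]
        · rw [indicator_of_notMem hu, ENNReal.ofReal_eq_zero]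
          exact sub_nonpos.2 (not_lt.1 hu)
    _ ≤ ν U := hcomp
    _ ≤ ∑ j ∈ J, ENNReal.ofReal (jobs j).volume := by
        rw [hν U hUmeas]
        refine Finset.sum_le_sum fun j _ => mul_le_of_le_one_right zero_le ?_
        exact indicator_le_self _ _ _

end IsSOARun

end Level

end SpeedScaling

namespace SpeedScaling

/-! ### Power functions -/

theorem IsCriticalSpeed.nonneg {α g sc : ℝ} (h : IsCriticalSpeed α g sc) : 0 ≤ sc := by
  rcases h with h | h
  exacts [h.1.le, h.2.ge]

theorem IsCriticalSpeed.pos {α g sc : ℝ} (h : IsCriticalSpeed α g sc) (hg : 0 < g) : 0 < sc := by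
  rcases h with h | h
  exacts [h.1, absurd h.1 hg.ne']

/-- The static power equals `(α - 1) * sc ^ α`. -/
theorem IsCriticalSpeed.static_eq {α g sc : ℝ} (h : IsCriticalSpeed α g sc) (hα : 1 ≤ α) :
    g = (α - 1) * sc ^ α := by
  rcases h with ⟨hpos, hmin⟩ | ⟨rfl, rfl⟩
  · have hloc : IsLocalMin (fun s => power α g s / s) sc :=
      Filter.mem_of_superset (Ioi_mem_nhds hpos) fun s hs => hmin s hs
    have hd : HasDerivAt (fun s => power α g s / s)
        ((α * sc ^ (α - 1) * sc - (sc ^ α + g) * 1) / sc ^ 2) sc :=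
      (((Real.hasDerivAt_rpow_const (p := α) (Or.inl hpos.ne')).add_const g).div
        (hasDerivAt_id sc) hpos.ne')
    have h0 := hloc.hasDerivAt_eq_zero hd
    have hsq : sc ^ 2 ≠ 0 := by positivity
    have h1 : sc ^ (α - 1) * sc = sc ^ α := by
      rw [← Real.rpow_add_one hpos.ne', sub_add_cancel]
    have h2 := (div_eq_zero_iff.1 h0).resolve_right hsq
    linear_combination -h2 + α * h1
  · rw [Real.zero_rpow (by linarith), mul_zero]

theorem power_nonneg {α g s : ℝ} (hg : 0 ≤ g) (hs : 0 ≤ s) : 0 ≤ power α g s :=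
  add_nonneg (Real.rpow_nonneg hs α) hg

theorem measurable_power (α g : ℝ) : Measurable (power α g) :=
  (measurable_id.pow_const α).add_const g

/-- Young's inequality for the marginal power. -/
theorem mul_marginal_le {α x b : ℝ} (hα : 1 ≤ α) (hx : 0 ≤ x) (hb : 0 ≤ b) :
    α * (x * (α * b ^ (α - 1))) ≤ α ^ α * x ^ α + (α - 1) * b ^ α := by
  have hα0 : 0 < α := by linarith
  have h := Real.geom_mean_le_arith_mean2_weighted (w₁ := 1 / α) (w₂ := (α - 1) / α)
    (p₁ := (α * x) ^ α) (p₂ := b ^ α) (by positivity) (div_nonneg (by linarith) hα0.le)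
    (by positivity) (by positivity) (by field_simp; ring)
  rw [← Real.rpow_mul (by positivity), ← Real.rpow_mul hb, mul_one_div_cancel hα0.ne',
    Real.rpow_one, mul_div_cancel₀ _ hα0.ne', Real.mul_rpow hα0.le hx] at h
  calc α * (x * (α * b ^ (α - 1))) = α * (α * x * b ^ (α - 1)) := by ring
    _ ≤ α * (1 / α * (α ^ α * x ^ α) + (α - 1) / α * b ^ α) := by gcongr
    _ = _ := by field_simp

/-- Integrability comes from the sign of the derivative. This matters when `1 < α < 2` and `sc = 0`,
where the curvature is unbounded near `0`. -/
theorem lintegral_Ioo_deriv_of_nonneg {F f : ℝ → ℝ} {a b : ℝ} (hab : a ≤ b)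
    (hF : ContinuousOn F (Icc a b)) (hderiv : ∀ x ∈ Ioo a b, HasDerivAt F (f x) x)
    (hf : ∀ x ∈ Ioo a b, 0 ≤ f x) :
    ∫⁻ x in Ioo a b, ENNReal.ofReal (f x) = ENNReal.ofReal (F b - F a) := by
  have hint : IntegrableOn f (Ioc a b) :=
    intervalIntegral.integrableOn_deriv_of_nonneg hF hderiv hf
  rw [← intervalIntegral.integral_eq_sub_of_hasDerivAt_of_le hab hF hderiv
    ((intervalIntegrable_iff_integrableOn_Ioc_of_le hab).2 hint),
    intervalIntegral.integral_of_le hab, integral_Ioc_eq_integral_Ioo,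
    ofReal_integral_eq_lintegral_ofReal (hint.mono_set Ioo_subset_Ioc_self)
      ((ae_restrict_mem measurableSet_Ioo).mono hf)]

/-- Second derivative of the dynamic power. -/
noncomputable def curvature (α y : ℝ) : ℝ := α * ((α - 1) * y ^ (α - 1 - 1))

theorem curvature_nonneg {α y : ℝ} (hα : 1 ≤ α) (hy : 0 ≤ y) : 0 ≤ curvature α y :=
  mul_nonneg (by linarith) (mul_nonneg (by linarith) (Real.rpow_nonneg hy _))

theorem measurable_curvature (α : ℝ) : Measurable (curvature α) := by
  unfold curvature
  fun_prop

theorem hasDerivAt_marginal {α y : ℝ} (hy : 0 < y) :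
    HasDerivAt (fun y => α * y ^ (α - 1)) (curvature α y) y :=
  (Real.hasDerivAt_rpow_const (p := α - 1) (Or.inl hy.ne')).const_mul α

theorem continuous_marginal {α : ℝ} (hα : 1 ≤ α) : Continuous fun y : ℝ => α * y ^ (α - 1) :=
  continuous_const.mul (continuous_id.rpow_const fun _ => Or.inr (by linarith))

/-- Integrating the second derivative from `sc` up to `s` recovers the marginal power. For `α = 1`
and `sc = 0` the convention `0 ^ 0 = 1` gives the correct marginal power `1`. -/
theorem lintegral_curvature {α sc s : ℝ} (hα : 1 ≤ α) (hsc : 0 ≤ sc) :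
    ENNReal.ofReal (α * sc ^ (α - 1)) +
      ∫⁻ y in Ioi sc, ENNReal.ofReal (curvature α y) * (Iio s).indicator 1 y =
    ENNReal.ofReal (α * max s sc ^ (α - 1)) := by
  have h1 : ∫⁻ y in Ioi sc, ENNReal.ofReal (curvature α y) * (Iio s).indicator 1 y =
      ∫⁻ y in Ioo sc s, ENNReal.ofReal (curvature α y) := by
    rw [← Ioi_inter_Iio, inter_comm, ← Measure.restrict_restrict measurableSet_Iio,
      ← lintegral_indicator measurableSet_Iio]
    refine lintegral_congr fun y => ?_
    by_cases hy : y ∈ Iio s <;> simp [hy, indicator]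
  rw [h1]
  rcases le_total s sc with hs | hs
  · rw [Ioo_eq_empty (not_lt.2 hs), max_eq_right hs]
    simp
  · rw [max_eq_left hs, lintegral_Ioo_deriv_of_nonneg hs (continuous_marginal hα).continuousOn
      (fun x hx => hasDerivAt_marginal (hsc.trans_lt hx.1))
      fun x hx => curvature_nonneg hα (hsc.trans hx.1.le),
      ← ENNReal.ofReal_add (mul_nonneg (by linarith) (Real.rpow_nonneg hsc _))]
    · congr 1
      ring
    · have : sc ^ (α - 1) ≤ s ^ (α - 1) := Real.rpow_le_rpow hsc hs (by linarith)
      nlinarith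

/-- Taylor's formula at `sc` with integral remainder. The static power `(α - 1) * sc ^ α` is exactly
what makes the tangent at `sc` pass through the origin, so the first term is proportional to the
work. -/
theorem ofReal_power_eq {α sc s : ℝ} (hα : 1 ≤ α) (hsc : 0 ≤ sc) (hs : sc ≤ s) :
    ENNReal.ofReal (power α ((α - 1) * sc ^ α) s) =
      ENNReal.ofReal (α * sc ^ (α - 1)) * ENNReal.ofReal s +
        ∫⁻ y in Ioi sc, ENNReal.ofReal (curvature α y) * ENNReal.ofReal (s - y) := by
  have h1 : ∫⁻ y in Ioi sc, ENNReal.ofReal (curvature α y) * ENNReal.ofReal (s - y) =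
      ∫⁻ y in Ioo sc s, ENNReal.ofReal (curvature α y * (s - y)) := by
    rw [← Ioi_inter_Iio, inter_comm, ← Measure.restrict_restrict measurableSet_Iio,
      ← lintegral_indicator measurableSet_Iio]
    refine setLIntegral_congr_fun measurableSet_Ioi fun y hy => ?_
    simp only [indicator, mem_Iio]
    split_ifs with hys
    · rw [ENNReal.ofReal_mul (curvature_nonneg hα (hsc.trans (le_of_lt hy)))]
    · rw [ENNReal.ofReal_of_nonpos (p := s - y) (by linarith), mul_zero]
  -- The primitive is the value at `s` of the tangent to the dynamic power at `y`.
  have hderiv : ∀ y ∈ Ioo sc s, HasDerivAt (fun y => α * y ^ (α - 1) * (s - y) + y ^ α)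
      (curvature α y * (s - y)) y := fun y hy => by
    have hy0 : 0 < y := hsc.trans_lt hy.1
    refine (((hasDerivAt_marginal (α := α) hy0).mul ((hasDerivAt_id' y).const_sub s)).add
      (Real.hasDerivAt_rpow_const (p := α) (Or.inl hy0.ne'))).congr_deriv ?_
    ring
  have hcont : Continuous fun y : ℝ => α * y ^ (α - 1) * (s - y) + y ^ α :=
    ((continuous_marginal hα).mul (by fun_prop)).add
      (continuous_id.rpow_const fun _ => Or.inr (by linarith))
  have hpow : sc ^ α = sc ^ (α - 1) * sc := by
    rw [← Real.rpow_add_one' hsc (by linarith), sub_add_cancel]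
  have hnn : ∀ y ∈ Ioo sc s, 0 ≤ curvature α y * (s - y) := fun y hy =>
    mul_nonneg (curvature_nonneg hα (hsc.trans hy.1.le)) (by linarith [hy.2])
  have hmarg : 0 ≤ α * sc ^ (α - 1) := mul_nonneg (by linarith) (Real.rpow_nonneg hsc _)
  -- With `x = s / α` this says that the power at `s` lies above the tangent at `sc`, so the
  -- remainder is nonnegative and `ENNReal.ofReal` is additive.
  have hyoung := mul_marginal_le hα (x := s / α) (b := sc) (div_nonneg (hsc.trans hs) (by linarith))
    hsc
  rw [h1, lintegral_Ioo_deriv_of_nonneg hs hcont.continuousOn hderiv hnn, ← ENNReal.ofReal_mul hmarg,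
    ← ENNReal.ofReal_add (mul_nonneg hmarg (hsc.trans hs))]
  · congr 1
    simp only [power]
    linear_combination α * hpow
  · have h0 : 0 < α := by linarith
    rw [Real.div_rpow (hsc.trans hs) h0.le, mul_div_cancel₀ _ (by positivity)] at hyoung
    have : α * (s / α * (α * sc ^ (α - 1))) = α * sc ^ (α - 1) * s := by field_simp
    rw [this] at hyoung
    rw [sub_self, mul_zero, zero_add, sub_nonneg]
    linear_combination hyoung + α * hpow

/-! ### Energy of the working state -/

section Energy

variable {n : ℕ} {α g A sc : ℝ} {jobs : Fin n → Job} {mode : ℝ → Mode} {S S' : Schedule n}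

theorem Schedule.ofReal_speed (S : Schedule n) (t : ℝ) :
    ENNReal.ofReal (S.speed t) = ∑ j, ENNReal.ofReal (S.rate j t) :=
  ENNReal.ofReal_sum_of_nonneg fun j _ => S.rate_nonneg j t

/-- A feasible schedule processes within `U` the jobs that live within `U`. -/
theorem Schedule.Feasible.sum_volume_le (hS' : S'.Feasible jobs) (J : Finset (Fin n))
    {U : Set ℝ} (hU : ∀ j ∈ J, Ico (jobs j).release (jobs j).deadline ⊆ U) :
    ∑ j ∈ J, ENNReal.ofReal (jobs j).volume ≤
      ∫⁻ t in U ∩ S'.active, ENNReal.ofReal (S'.speed t) := by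
  have hmeas : ∀ j, Measurable fun t => ENNReal.ofReal (S'.rate j t) := fun j =>
    (S'.measurable_rate j).ennreal_ofReal
  calc ∑ j ∈ J, ENNReal.ofReal (jobs j).volume
      ≤ ∑ j ∈ J, ∫⁻ t in U ∩ S'.active, ENNReal.ofReal (S'.rate j t) := by
        refine Finset.sum_le_sum fun j hj => (hS' j).trans ?_
        rw [setLIntegral_congr ((Ico_ae_eq_Icc (μ := volume)).symm.inter
          (ae_eq_refl S'.active))]
        exact lintegral_mono_set (inter_subset_inter_left _ (hU j hj))
    _ ≤ ∑ j, ∫⁻ t in U ∩ S'.active, ENNReal.ofReal (S'.rate j t) :=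
        Finset.sum_le_sum_of_subset (Finset.subset_univ J)
    _ = _ := by
        rw [← lintegral_finsetSum _ fun j _ => hmeas j]
        exact lintegral_congr fun t => (S'.ofReal_speed t).symm

namespace IsSOARun

variable (h : IsSOARun g A sc jobs mode S)
include h

theorem lintegral_speed_le : ∫⁻ t, ENNReal.ofReal (S.speed t) ≤
    ∑ j, ENNReal.ofReal (jobs j).volume := by
  rw [lintegral_congr fun t => S.ofReal_speed t,
    lintegral_finsetSum _ fun j _ => (S.measurable_rate j).ennreal_ofReal]
  refine Finset.sum_le_sum fun j _ => ?_
  rw [← ofReal_integral_eq_lintegral_ofReal (h.integrable_rate j)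
    (Eventually.of_forall fun t => S.rate_nonneg j t)]
  refine ENNReal.ofReal_le_ofReal ?_
  simpa using h.integral_rate_le_volume j univ

/-- The work above level `y` is bounded by the work of any feasible schedule at the times at which
the speed exceeds `y`. -/
theorem lintegral_speed_sub_le_lintegral (hS' : S'.Feasible jobs) {y : ℝ} (hsc : 0 ≤ sc)
    (hy : sc ≤ y) : ∫⁻ t, ENNReal.ofReal (S.speed t - y) ≤
      ∫⁻ t in {t | y < S.speed t} ∩ S'.active, ENNReal.ofReal (S'.speed t) := by
  classical
  exact (h.lintegral_speed_sub_le hsc hy).trans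
    (hS'.sum_volume_le _ fun j hj => (Finset.mem_filter.1 hj).2)

/-- The energy of the working state is bounded by the work of any feasible schedule, weighted by
the marginal power. -/
theorem working_energy_le (hα : 1 ≤ α) (hsc : 0 ≤ sc) (hg : g = (α - 1) * sc ^ α)
    (hS' : S'.Feasible jobs) :
    ∫⁻ t in {t | mode t = Mode.working}, ENNReal.ofReal (power α g (S.speed t)) ≤
      ∫⁻ t in S'.active,
        ENNReal.ofReal (S'.speed t) * ENNReal.ofReal (α * max (S.speed t) sc ^ (α - 1)) := by
  set β := ENNReal.ofReal (α * sc ^ (α - 1))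
  set κ : ℝ → ENNReal := fun y => ENNReal.ofReal (curvature α y) with hκ
  have hκm : Measurable κ := (measurable_curvature α).ennreal_ofReal
  have hsm : Measurable fun t => ENNReal.ofReal (S.speed t) := S.measurable_speed.ennreal_ofReal
  have hsm' : Measurable fun t => ENNReal.ofReal (S'.speed t) :=
    S'.measurable_speed.ennreal_ofReal
  have hlt : MeasurableSet {p : ℝ × ℝ | p.2 < S.speed p.1} :=
    measurableSet_lt measurable_snd (S.measurable_speed.comp measurable_fst)
  have hind : ∀ t y, (Iio (S.speed t)).indicator (1 : ℝ → ENNReal) y =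
      {p : ℝ × ℝ | p.2 < S.speed p.1}.indicator 1 (t, y) := fun t y => by
    simp [indicator]
  have hindm : Measurable fun p : ℝ × ℝ =>
      (Iio (S.speed p.1)).indicator (1 : ℝ → ENNReal) p.2 := by
    simp only [hind]
    exact measurable_one.indicator hlt
  -- The bound on the work above level `y`, weighted by the curvature at `y`. Tonelli's theorem is
  -- used twice below: to split the energy into levels, and to reassemble the marginal power.
  have hlevel : ∀ y ∈ Ioi sc, ∫⁻ t, κ y * ENNReal.ofReal (S.speed t - y) ≤
      ∫⁻ t in S'.active,
        κ y * (ENNReal.ofReal (S'.speed t) * (Iio (S.speed t)).indicator 1 y) := by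
    intro y hy
    have hm : MeasurableSet {t | y < S.speed t} := measurableSet_lt measurable_const S.measurable_speed
    rw [lintegral_const_mul _ (S.measurable_speed.sub_const y).ennreal_ofReal]
    have hm2 : Measurable fun t =>
        ENNReal.ofReal (S'.speed t) * (Iio (S.speed t)).indicator (1 : ℝ → ENNReal) y :=
      hsm'.mul (hindm.comp (measurable_id.prodMk measurable_const))
    rw [lintegral_const_mul _ hm2]
    refine mul_le_mul_right ((h.lintegral_speed_sub_le_lintegral hS' hsc (le_of_lt hy)).trans_eq ?_) _
    rw [← Measure.restrict_restrict hm, ← lintegral_indicator hm]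
    refine lintegral_congr fun t => ?_
    by_cases ht : y < S.speed t <;> simp [ht, indicator]
  calc ∫⁻ t in {t | mode t = Mode.working}, ENNReal.ofReal (power α g (S.speed t))
      ≤ ∫⁻ t in {t | mode t = Mode.working}, (β * ENNReal.ofReal (S.speed t) +
          ∫⁻ y in Ioi sc, κ y * ENNReal.ofReal (S.speed t - y)) := by
        refine setLIntegral_mono' h.measurableSet_working fun t ht => le_of_eq ?_
        rw [hg, ofReal_power_eq hα hsc]
        rw [h.speed_eq t ht]
        exact le_max_right _ _
    _ ≤ ∫⁻ t, (β * ENNReal.ofReal (S.speed t) +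
          ∫⁻ y in Ioi sc, κ y * ENNReal.ofReal (S.speed t - y)) := setLIntegral_le_lintegral _ _
    _ = β * (∫⁻ t, ENNReal.ofReal (S.speed t)) +
          ∫⁻ y in Ioi sc, ∫⁻ t, κ y * ENNReal.ofReal (S.speed t - y) := by
        rw [lintegral_add_left (hsm.const_mul β), lintegral_const_mul _ hsm,
          lintegral_lintegral_swap]
        exact ((hκm.comp measurable_snd).mul ((S.measurable_speed.comp measurable_fst).sub
          measurable_snd).ennreal_ofReal).aemeasurable
    _ ≤ β * (∫⁻ t in S'.active, ENNReal.ofReal (S'.speed t)) +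
          ∫⁻ y in Ioi sc, ∫⁻ t in S'.active,
            κ y * (ENNReal.ofReal (S'.speed t) * (Iio (S.speed t)).indicator 1 y) := by
        refine add_le_add (mul_le_mul_right (h.lintegral_speed_le.trans ?_) _)
          (setLIntegral_mono' measurableSet_Ioi hlevel)
        simpa using hS'.sum_volume_le Finset.univ (U := univ) fun _ _ => subset_univ _
    _ = ∫⁻ t in S'.active, (ENNReal.ofReal (S'.speed t) * β +
          ∫⁻ y in Ioi sc, κ y * (ENNReal.ofReal (S'.speed t) *
            (Iio (S.speed t)).indicator 1 y)) := by
        rw [lintegral_lintegral_swap, lintegral_add_left (hsm'.mul_const β),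
          lintegral_mul_const _ hsm', mul_comm β]
        exact ((hκm.comp measurable_fst).mul ((hsm'.comp measurable_snd).mul
          (hindm.comp measurable_swap))).aemeasurable
    _ = _ := by
        refine lintegral_congr fun t => ?_
        have hm : Measurable fun y => κ y * (Iio (S.speed t)).indicator (1 : ℝ → ENNReal) y :=
          hκm.mul (measurable_one.indicator measurableSet_Iio)
        rw [← lintegral_curvature hα hsc, mul_add, ← lintegral_const_mul _ hm]
        congr 1
        refine lintegral_congr fun y => ?_
        ring

theorem working_subset : {t | mode t = Mode.working} ⊆ Icc 0 (∑ j, |(jobs j).deadline|) := by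
  intro t ht
  obtain ⟨j, hj⟩ := h.exists_rate_pos_of_working ht
  have hp := h.pending_of_rate_pos hj
  refine ⟨(jobs j).release_nonneg.trans hp.1, (h.lt_deadline_of_pending hp).le.trans
    ((le_abs_self _).trans ?_)⟩
  exact Finset.single_le_sum (f := fun j => |(jobs j).deadline|) (fun j _ => abs_nonneg _)
    (Finset.mem_univ j)

/-- `Y` is so large that running above it during the lifetime of any one job would exceed the total
volume. So no job can be charged for work above `Y`, and there is none almost everywhere. This makes
the working energy finite, as is needed to cancel it later. -/
theorem exists_speed_le (hsc : 0 ≤ sc) : ∃ Y, 0 ≤ Y ∧ ∀ᵐ t, S.speed t ≤ Y := by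
  classical
  set P := ∑ j, (jobs j).volume with hP
  have hP0 : 0 ≤ P := Finset.sum_nonneg fun j _ => (jobs j).volume_pos.le
  have hlen : ∀ j, 0 < (jobs j).deadline - (jobs j).release := fun j =>
    sub_pos.2 (jobs j).release_lt_deadline
  have hterm : ∀ j, 0 ≤ (P + 1) / ((jobs j).deadline - (jobs j).release) := fun j =>
    div_nonneg (by linarith) (hlen j).le
  set Y := sc + ∑ j, (P + 1) / ((jobs j).deadline - (jobs j).release) with hY
  have hscY : sc ≤ Y := le_add_of_nonneg_right (Finset.sum_nonneg fun j _ => hterm j)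
  have hYj : ∀ j, P + 1 ≤ Y * ((jobs j).deadline - (jobs j).release) := fun j => by
    rw [← div_le_iff₀ (hlen j)]
    exact (Finset.single_le_sum (fun j _ => hterm j) (Finset.mem_univ j)).trans
      (le_add_of_nonneg_left hsc)
  refine ⟨Y, hsc.trans hscY, ?_⟩
  have hempty : (Finset.univ.filter fun j =>
      Ico (jobs j).release (jobs j).deadline ⊆ {u | Y < S.speed u}) = ∅ := by
    refine Finset.filter_eq_empty_iff.2 fun j _ hsub => ?_
    have h1 : ENNReal.ofReal Y * volume (Ico (jobs j).release (jobs j).deadline) ≤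
        ENNReal.ofReal P := by
      rw [← setLIntegral_const]
      calc ∫⁻ _ in Ico (jobs j).release (jobs j).deadline, ENNReal.ofReal Y
          ≤ ∫⁻ t in Ico (jobs j).release (jobs j).deadline, ENNReal.ofReal (S.speed t) :=
            setLIntegral_mono' measurableSet_Ico fun t ht =>
              ENNReal.ofReal_le_ofReal (le_of_lt (hsub ht))
        _ ≤ ∫⁻ t, ENNReal.ofReal (S.speed t) := setLIntegral_le_lintegral _ _
        _ ≤ ∑ j, ENNReal.ofReal (jobs j).volume := h.lintegral_speed_le
        _ = ENNReal.ofReal P :=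
            (ENNReal.ofReal_sum_of_nonneg fun j _ => (jobs j).volume_pos.le).symm
    rw [Real.volume_Ico, ← ENNReal.ofReal_mul (hsc.trans hscY),
      ENNReal.ofReal_le_ofReal_iff hP0] at h1
    linarith [hYj j]
  have h0 := h.lintegral_speed_sub_le hsc hscY
  rw [hempty, Finset.sum_empty, nonpos_iff_eq_zero,
    lintegral_eq_zero_iff (S.measurable_speed.sub_const Y).ennreal_ofReal] at h0
  filter_upwards [h0] with t ht
  have := ENNReal.ofReal_eq_zero.1 ht
  linarith

theorem working_energy_ne_top (hα : 1 ≤ α) (hsc : 0 ≤ sc) :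
    ∫⁻ t in {t | mode t = Mode.working}, ENNReal.ofReal (power α g (S.speed t)) ≠ ⊤ := by
  obtain ⟨Y, hY, hle⟩ := h.exists_speed_le hsc
  refine ne_top_of_le_ne_top (b := ∫⁻ t in {t | mode t = Mode.working},
    ENNReal.ofReal (power α g Y)) ?_ (lintegral_mono_ae ((ae_restrict_of_ae hle).mono fun t ht =>
      ENNReal.ofReal_le_ofReal ?_))
  · rw [setLIntegral_const]
    exact ENNReal.mul_ne_top ENNReal.ofReal_ne_top
      ((measure_mono h.working_subset).trans_lt measure_Icc_lt_top).ne
  · exact add_le_add_left (Real.rpow_le_rpow (S.speed_nonneg t) ht (by linarith)) g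

/-- The energy of the working state, together with twice the static energy of the idle times at
which the other schedule is active, is paid by the energy of the other schedule. -/
theorem working_energy_add_le (hα : 1 ≤ α) (hsc : 0 ≤ sc) (hg0 : 0 ≤ g)
    (hg : g = (α - 1) * sc ^ α) (hS' : S'.Feasible jobs) {c : ℝ} (hc : 3 ≤ c) (hcα : α ^ α ≤ c) :
    (∫⁻ t in {t | mode t = Mode.working}, ENNReal.ofReal (power α g (S.speed t))) +
      ENNReal.ofReal (2 * g) * volume ({t | mode t = Mode.idle} ∩ S'.active) ≤
    ENNReal.ofReal c * ∫⁻ t in S'.active, ENNReal.ofReal (power α g (S'.speed t)) := by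
  set Wk := {t | mode t = Mode.working} with hWk
  set W := ∫⁻ t in Wk, ENNReal.ofReal (power α g (S.speed t)) with hW
  have hα1 : 0 ≤ α - 1 := by linarith
  have hsm' : Measurable fun t => ENNReal.ofReal (S'.speed t) :=
    S'.measurable_speed.ennreal_ofReal
  have hpm : Measurable fun t => ENNReal.ofReal (power α g (S.speed t)) :=
    ((measurable_power α g).comp S.measurable_speed).ennreal_ofReal
  have hpm' : Measurable fun t => ENNReal.ofReal (power α g (S'.speed t)) :=
    ((measurable_power α g).comp S'.measurable_speed).ennreal_ofReal
  -- Young's inequality with `b = max s sc`. While working, `(α - 1) * b ^ α` is absorbed by the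
  -- power of the run. Otherwise `b = sc` and this term equals `g`; with the slack `2 * g` it makes
  -- `3 * g`, whence the condition `3 ≤ c`.
  have hpt : ∀ t, ENNReal.ofReal α *
      (ENNReal.ofReal (S'.speed t) * ENNReal.ofReal (α * max (S.speed t) sc ^ (α - 1))) +
      {t | mode t = Mode.idle}.indicator (fun _ => ENNReal.ofReal (2 * g)) t ≤
      ENNReal.ofReal (α - 1) * Wk.indicator (fun t => ENNReal.ofReal (power α g (S.speed t))) t +
      ENNReal.ofReal c * ENNReal.ofReal (power α g (S'.speed t)) := by
    intro t
    have hx := S'.speed_nonneg t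
    have hb : 0 ≤ max (S.speed t) sc := hsc.trans (le_max_right _ _)
    have hyoung := mul_marginal_le hα hx hb
    have hpx : 0 ≤ S'.speed t ^ α := Real.rpow_nonneg hx α
    have hm : α ^ α * S'.speed t ^ α ≤ c * S'.speed t ^ α := mul_le_mul_of_nonneg_right hcα hpx
    have hP' : 0 ≤ power α g (S'.speed t) := power_nonneg hg0 hx
    have hL : 0 ≤ α * (S'.speed t * (α * max (S.speed t) sc ^ (α - 1))) :=
      mul_nonneg (by linarith) (mul_nonneg hx
        (mul_nonneg (by linarith) (Real.rpow_nonneg hb _)))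
    rw [← ENNReal.ofReal_mul hx, ← ENNReal.ofReal_mul (by linarith : 0 ≤ α),
      ← ENNReal.ofReal_mul (by linarith : 0 ≤ c)]
    by_cases hw : t ∈ Wk
    · have hidle : t ∉ {t | mode t = Mode.idle} := fun hi => by
        have : mode t = Mode.working := hw
        rw [mem_ofPred_eq, this] at hi
        cases hi
      have hs : max (S.speed t) sc = S.speed t := by
        rw [h.speed_eq t hw]
        exact max_eq_left (le_max_right _ _)
      have hP : 0 ≤ power α g (S.speed t) := power_nonneg hg0 (S.speed_nonneg t)
      rw [indicator_of_notMem hidle, add_zero, indicator_of_mem hw, ← ENNReal.ofReal_mul hα1,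
        ← ENNReal.ofReal_add (mul_nonneg hα1 hP) (mul_nonneg (by linarith) hP')]
      refine ENNReal.ofReal_le_ofReal ?_
      rw [hs] at hyoung ⊢
      simp only [power]
      nlinarith
    · have hs : max (S.speed t) sc = sc := by
        rw [h.speed_eq_zero hw]
        exact max_eq_right hsc
      rw [indicator_of_notMem hw, mul_zero, zero_add]
      have hfin : α * (S'.speed t * (α * max (S.speed t) sc ^ (α - 1))) + 2 * g ≤
          c * power α g (S'.speed t) := by
        rw [hs] at hyoung ⊢
        rw [← hg] at hyoung
        simp only [power]
        nlinarith
      refine (add_le_add_right (indicator_le_self _ _ _) _).trans ?_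
      rw [← ENNReal.ofReal_add hL (by linarith)]
      exact ENNReal.ofReal_le_ofReal hfin
  have hint : ENNReal.ofReal α * (∫⁻ t in S'.active, ENNReal.ofReal (S'.speed t) *
        ENNReal.ofReal (α * max (S.speed t) sc ^ (α - 1))) +
      ENNReal.ofReal (2 * g) * volume ({t | mode t = Mode.idle} ∩ S'.active) ≤
      ENNReal.ofReal (α - 1) * W +
      ENNReal.ofReal c * ∫⁻ t in S'.active, ENNReal.ofReal (power α g (S'.speed t)) := by
    have hmm : Measurable fun t => ENNReal.ofReal (S'.speed t) *
        ENNReal.ofReal (α * max (S.speed t) sc ^ (α - 1)) :=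
      hsm'.mul (((S.measurable_speed.max measurable_const).pow_const _).const_mul α).ennreal_ofReal
    have hi := setLIntegral_mono' (μ := volume) S'.measurableSet_active fun t _ => hpt t
    have hidle : ∫⁻ t in S'.active, {t | mode t = Mode.idle}.indicator
        (fun _ => ENNReal.ofReal (2 * g)) t =
        ENNReal.ofReal (2 * g) * volume ({t | mode t = Mode.idle} ∩ S'.active) := by
      rw [lintegral_indicator h.measurableSet_idle, Measure.restrict_restrict h.measurableSet_idle,
        setLIntegral_const]
    rw [lintegral_add_left (hmm.const_mul _), lintegral_const_mul _ hmm, hidle,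
      lintegral_add_left ((hpm.indicator h.measurableSet_working).const_mul _),
      lintegral_const_mul _ (hpm.indicator h.measurableSet_working),
      lintegral_const_mul _ hpm'] at hi
    refine hi.trans ?_
    gcongr
    rw [hW, ← lintegral_indicator h.measurableSet_working]
    exact setLIntegral_le_lintegral _ _
  have hX := h.working_energy_le hα hsc hg hS'
  have hαW : ENNReal.ofReal α * W = ENNReal.ofReal (α - 1) * W + W := by
    conv_lhs => rw [show α = (α - 1) + 1 by ring, ENNReal.ofReal_add hα1 zero_le_one]
    rw [add_mul, ENNReal.ofReal_one, one_mul]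
  have hfin : ENNReal.ofReal (α - 1) * W ≠ ⊤ :=
    ENNReal.mul_ne_top ENNReal.ofReal_ne_top (h.working_energy_ne_top hα hsc)
  -- Adding `(α - 1) * W` to both sides turns the working energy `W` into `α * W`, to which the
  -- pointwise bound applies.
  refine (ENNReal.add_le_add_iff_left hfin).1 ?_
  rw [← add_assoc, ← hαW]
  refine le_trans ?_ hint
  gcongr

end IsSOARun

end Energy

end SpeedScaling

namespace SpeedScaling

/-! ### Counting wake-ups -/

/-- There are `m` successive wake-ups before time `x`. -/
def WakesBefore (act : Set ℝ) (m : ℕ) (x : ℝ) : Prop :=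
  ∃ t : ℕ → ℝ, StrictMono t ∧ (∀ i < m, t (2 * i) ∉ act ∧ t (2 * i + 1) ∈ act) ∧
    ∀ i < 2 * m, t i < x

theorem wakesBefore_zero (act : Set ℝ) (x : ℝ) : WakesBefore act 0 x :=
  ⟨fun i => i, Nat.strictMono_cast, fun i hi => absurd hi (Nat.not_lt_zero i),
    fun i hi => absurd hi (Nat.not_lt_zero i)⟩

theorem WakesBefore.succ {act : Set ℝ} {m : ℕ} {x y x' : ℝ} (h : WakesBefore act m x)
    (hx : x ∉ act) (hy : y ∈ act) (hxy : x < y) (hyx' : y < x') : WakesBefore act (m + 1) x' := by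
  obtain ⟨t, hmono, halt, hlt⟩ := h
  -- The new pair occupies the indices `2 * m` and `2 * m + 1`; later values only keep the sequence
  -- strictly increasing.
  refine ⟨fun i => if i < 2 * m then t i else if i = 2 * m then x else y + (i - (2 * m + 1) : ℝ),
    strictMono_nat_of_lt_succ fun i => ?_, fun i hi => ?_, fun i hi => ?_⟩
  · rcases lt_trichotomy (i + 1) (2 * m) with h1 | h1 | h1
    · have h2 : i < 2 * m := by omega
      simp only [h1, h2, if_true]
      exact hmono (Nat.lt_succ_self i)
    · have h2 : i < 2 * m := by omega
      simp only [h1, h2, lt_irrefl, if_true, if_false]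
      exact hlt i h2
    · have h2 : ¬ i + 1 < 2 * m := by omega
      have h3 : ¬ i < 2 * m := by omega
      have h4 : ¬ i + 1 = 2 * m := by omega
      simp only [h2, h3, h4, if_false]
      split_ifs with h5
      · subst h5
        push_cast
        linarith
      · push_cast
        linarith
  · rcases (Nat.lt_succ_iff_lt_or_eq.1 hi) with h1 | rfl
    · have h2 : 2 * i < 2 * m := by omega
      have h3 : 2 * i + 1 < 2 * m := by omega
      simpa only [h2, h3, if_true] using halt i h1
    · simp only [lt_irrefl, if_false, if_true, Nat.not_succ_lt_self, Nat.succ_ne_self]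
      refine ⟨hx, ?_⟩
      push_cast
      simpa using hy
  · dsimp only
    split_ifs with h1 h2
    · exact (hlt i h1).trans (hxy.trans hyx')
    · exact hxy.trans hyx'
    · have h3 : i = 2 * m + 1 := by omega
      subst h3
      push_cast
      linarith

theorem Schedule.le_wakeUps {n : ℕ} {S : Schedule n} {m : ℕ} {x : ℝ}
    (h : WakesBefore S.active m x) : (m : ENNReal) ≤ S.wakeUps := by
  obtain ⟨t, hmono, halt, -⟩ := h
  exact le_iSup₂_of_le m ⟨t, hmono, halt⟩ le_rfl

theorem Schedule.Feasible.exists_active {n : ℕ} {S : Schedule n} {jobs : Fin n → Job}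
    (h : S.Feasible jobs) (j : Fin n) :
    ∃ x ∈ S.active, (jobs j).release ≤ x ∧ x ≤ (jobs j).deadline := by
  by_contra! hn
  have hempty : Icc (jobs j).release (jobs j).deadline ∩ S.active = ∅ :=
    eq_empty_of_forall_notMem fun x hx => absurd hx.1.2 (not_le.2 (hn x hx.2 hx.1.1))
  have := h j
  rw [hempty, setLIntegral_empty, nonpos_iff_eq_zero, ENNReal.ofReal_eq_zero] at this
  exact absurd (jobs j).volume_pos (not_lt.2 this)

/-- The set is exhausted from below by points of itself, up to its supremum. It is used for the idle
budget, which is controlled only at idle times. -/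
theorem measure_le_of_forall_inter_Iio_le {I : Set ℝ} {K : ENNReal}
    (h : ∀ t ∈ I, volume (I ∩ Iio t) ≤ K) (hI : BddAbove I) : volume I ≤ K := by
  rcases I.eq_empty_or_nonempty with rfl | hne
  · simp
  obtain ⟨u, hmono, htend, hmem⟩ := exists_seq_tendsto_sSup hne hI
  have hsub : I ⊆ {sSup I} ∪ ⋃ k, I ∩ Iio (u k) := fun x hx => by
    rcases (le_csSup hI hx).eq_or_lt with heq | hlt
    · exact Or.inl heq
    · obtain ⟨k, hk⟩ := (htend.eventually_const_lt hlt).exists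
      exact Or.inr (mem_iUnion.2 ⟨k, hx, hk⟩)
  have hmono' : Monotone fun k => I ∩ Iio (u k) := fun a b hab =>
    inter_subset_inter_right _ (Iio_subset_Iio (hmono hab))
  calc volume I ≤ volume {sSup I} + volume (⋃ k, I ∩ Iio (u k)) :=
        (measure_mono hsub).trans (measure_union_le _ _)
    _ = ⨆ k, volume (I ∩ Iio (u k)) := by
        rw [Real.volume_singleton, zero_add, hmono'.measure_iUnion]
    _ ≤ K := iSup_le fun k => h _ (hmem k)

/-- The machine wakes up at time `w`. -/
def IsWake (mode : ℝ → Mode) (w : ℝ) : Prop :=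
  mode w ≠ Mode.sleep ∧ ∀ᶠ u in 𝓝[<] w, mode u = Mode.sleep

theorem IsWake.exists_sleep {mode : ℝ → Mode} {w : ℝ} (h : IsWake mode w) {x : ℝ} (hx : x < w) :
    ∃ v, x < v ∧ v < w ∧ mode v = Mode.sleep := by
  have hI : ∀ᶠ u in 𝓝[<] w, x < u ∧ u < w :=
    Ioo_mem_nhdsLT hx
  obtain ⟨v, hv, hv'⟩ := (hI.and h.2).exists
  exact ⟨v, hv.1, hv.2, hv'⟩

theorem IsWake.le_of_forall_ne_sleep {mode : ℝ → Mode} {w w' u : ℝ} (hw' : IsWake mode w')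
    (hu : ∀ v ∈ Ico w u, mode v ≠ Mode.sleep) (hwu : w' ≤ u) : w' ≤ w := by
  by_contra! hlt
  obtain ⟨v, hv1, hv2, hv3⟩ := hw'.exists_sleep hlt
  exact hu v ⟨hv1.le, hv2.trans_le hwu⟩ hv3

theorem IsWake.idleTime_eq {mode : ℝ → Mode} {w t : ℝ} (hw : IsWake mode w) (hwt : w ≤ t)
    (ht : ∀ v ∈ Ico w t, mode v ≠ Mode.sleep) :
    idleTime mode t = volume.real ({u | mode u = Mode.idle} ∩ Ico w t) := by
  unfold idleTime Measure.real
  congr 2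
  ext u
  refine ⟨fun hu => ⟨hu.2.1, not_lt.1 fun huw => ?_, hu.1⟩, fun hu => ⟨hu.2.2, hu.1, fun v hv =>
    ht v ⟨hu.2.1.trans hv.1, hv.2⟩⟩⟩
  obtain ⟨v, hv1, hv2, hv3⟩ := hw.exists_sleep huw
  exact hu.2.2 v ⟨hv1.le, hv2.trans_le hwt⟩ hv3

/-! ### Active periods and the payment for idling and wake-ups -/

section Periods

variable {n : ℕ} {α g A sc : ℝ} {jobs : Fin n → Job} {mode : ℝ → Mode} {S S' : Schedule n}

namespace IsSOARun

variable (h : IsSOARun g A sc jobs mode S)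
include h

theorem nonneg_of_ne_sleep {t : ℝ} (ht : mode t ≠ Mode.sleep) : 0 ≤ t :=
  not_lt.1 fun hlt => ht (h.initial t hlt)

/-- The successor of a state that is constant just before `t`. -/
theorem mode_eq_nextMode {t : ℝ} {m : Mode} (hm : ∀ᶠ u in 𝓝[<] t, mode u = m) :
    mode t = nextMode sc (plannedSpeed jobs S t) (A ≤ g * idleTime mode t) m := by
  obtain ⟨m', hm', hnext, -⟩ := h.step t
  obtain ⟨u, hu, hu'⟩ := (hm.and hm').exists
  rw [hnext, ← hu', hu]

theorem wake_spec {w : ℝ} (hw : IsWake mode w) :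
    mode w = Mode.working ∧ 0 < plannedSpeed jobs S w ∧ sc ≤ plannedSpeed jobs S w := by
  have h1 := h.mode_eq_nextMode hw.2
  have h2 := hw.1
  rw [h1] at h2 ⊢
  simp only [nextMode] at h2 ⊢
  split_ifs at h2 ⊢ with hc
  exacts [⟨rfl, hc⟩, absurd rfl h2]

/-- The first time at which a given state is left. -/
theorem exists_first {p : Mode → Prop} {w v : ℝ} (hwv : w ≤ v) (hw : p (mode w))
    (hv : ¬ p (mode v)) : ∃ e, w < e ∧ e ≤ v ∧ ¬ p (mode e) ∧ ∀ u ∈ Ico w e, p (mode u) := by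
  set B := {u | w ≤ u ∧ ¬ p (mode u)} with hB
  have hbdd : BddBelow B := ⟨w, fun u hu => hu.1⟩
  have hne : B.Nonempty := ⟨v, hwv, hv⟩
  have hwle : w ≤ sInf B := le_csInf hne fun u hu => hu.1
  have hmem : ¬ p (mode (sInf B)) := by
    intro hp
    obtain ⟨-, -, -, hr⟩ := h.step (sInf B)
    obtain ⟨r, hr1, hr2⟩ := mem_nhdsGT_iff_exists_Ioo_subset.1 hr
    refine not_le.2 hr1 (le_csInf hne fun u hu => not_lt.1 fun hur => hu.2 ?_)
    rcases (csInf_le hbdd hu).eq_or_lt with heq | hlt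
    · exact heq ▸ hp
    · have : mode u = mode (sInf B) := hr2 ⟨hlt, hur⟩
      rwa [this]
  refine ⟨sInf B, hwle.lt_of_ne fun heq => hmem (heq ▸ hw), csInf_le hbdd ⟨hwv, hv⟩, hmem,
    fun u hu => ?_⟩
  by_contra hn
  exact notMem_of_lt_csInf hu.2 hbdd ⟨hu.1, hn⟩

theorem exists_wake {s t : ℝ} (hst : s ≤ t) (hs : mode s = Mode.sleep) (ht : mode t ≠ Mode.sleep) :
    ∃ w, s < w ∧ w ≤ t ∧ IsWake mode w ∧ ∀ v ∈ Icc w t, mode v ≠ Mode.sleep := by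
  -- The supremum of the sleep times before `t` is not attained, since the mode persists to the
  -- right of every time; so it is the wake-up.
  set B := {u | u ≤ t ∧ mode u = Mode.sleep} with hB
  have hbdd : BddAbove B := ⟨t, fun u hu => hu.1⟩
  have hne : B.Nonempty := ⟨s, hst, hs⟩
  have hle : sSup B ≤ t := csSup_le hne fun u hu => hu.1
  have hafter : ∀ v, sSup B < v → v ≤ t → mode v ≠ Mode.sleep := fun v hv hvt hm =>
    not_le.2 hv (le_csSup hbdd ⟨hvt, hm⟩)
  have hmem : mode (sSup B) ≠ Mode.sleep := by
    intro hp
    have hlt : sSup B < t := hle.lt_of_ne fun he => ht (he ▸ hp)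
    obtain ⟨-, -, -, hr⟩ := h.step (sSup B)
    have hI : ∀ᶠ u in 𝓝[>] sSup B, sSup B < u ∧ u < t := Ioo_mem_nhdsGT hlt
    obtain ⟨v, hv, hv1, hv2⟩ := (hr.and hI).exists
    exact hafter v hv1 hv2.le (hv.trans hp)
  refine ⟨sSup B, (le_csSup hbdd ⟨hst, hs⟩).lt_of_ne fun he => hmem (he ▸ hs), hle,
    ⟨hmem, ?_⟩, fun v hv => ?_⟩
  · obtain ⟨m, hm, -, -⟩ := h.step (sSup B)
    suffices m = Mode.sleep from this ▸ hm
    obtain ⟨l, hl1, hl2⟩ := mem_nhdsLT_iff_exists_Ioo_subset.1 hm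
    obtain ⟨b, hb, hlb⟩ := exists_lt_of_lt_csSup hne hl1
    have hbS : b < sSup B := (le_csSup hbdd hb).lt_of_ne fun he => hmem (he ▸ hb.2)
    have : mode b = m := hl2 ⟨hlb, hbS⟩
    rw [← this, hb.2]
  · rcases hv.1.eq_or_lt with heq | hlt
    · exact heq ▸ hmem
    · exact hafter v hlt hv.2

/-- Wake-ups lie in a compact interval, and an accumulation point would contradict the one-sided
local constancy of the mode. -/
theorem finite_wake : {w | IsWake mode w}.Finite := by
  by_contra hinf
  have hsub : {w | IsWake mode w} ⊆ Icc 0 (∑ j, |(jobs j).deadline|) := fun w hw =>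
    h.working_subset (h.wake_spec hw).1
  obtain ⟨x, -, hx⟩ := Set.Infinite.exists_accPt_of_subset_isCompact hinf isCompact_Icc hsub
  rw [accPt_iff_frequently_nhdsNE] at hx
  refine hx ?_
  have hconst : ∀ y m, (∀ᶠ u in 𝓝[<] y, mode u = m) → mode y = m → ¬ IsWake mode y := by
    intro y m hm hy hw
    obtain ⟨u, hu, hu'⟩ := (hm.and hw.2).exists
    exact hw.1 (hy.trans (hu.symm.trans hu'))
  rw [← nhdsLT_sup_nhdsGT, eventually_sup]
  obtain ⟨m, hm, -, hr⟩ := h.step x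
  constructor
  · obtain ⟨l, hl1, hl2⟩ := mem_nhdsLT_iff_exists_Ioo_subset.1 hm
    filter_upwards [Ioo_mem_nhdsLT hl1] with y hy
    refine hconst y m ?_ (hl2 hy)
    filter_upwards [Ioo_mem_nhdsLT hy.1] with u hu using hl2 ⟨hu.1, hu.2.trans hy.2⟩
  · obtain ⟨r, hr1, hr2⟩ := mem_nhdsGT_iff_exists_Ioo_subset.1 hr
    filter_upwards [Ioo_mem_nhdsGT hr1] with y hy
    refine hconst y _ ?_ (hr2 hy)
    filter_upwards [Ioo_mem_nhdsLT hy.1] with u hu using hr2 ⟨hu.1, hu.2.trans hy.2⟩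

theorem idle_budget {t : ℝ} (ht : mode t = Mode.idle) : g * idleTime mode t < A := by
  obtain ⟨m, -, hm, -⟩ := h.step t
  rw [ht] at hm
  by_contra! hle
  cases m <;> simp only [nextMode, hle, if_true] at hm <;> split_ifs at hm

/-- The period after a wake-up ends when the idle budget is used up. -/
theorem exists_sleep_of_sleep {w v : ℝ} (hw : IsWake mode w) (hwv : w ≤ v)
    (hv : mode v = Mode.sleep) : ∃ z, w < z ∧ z ≤ v ∧ mode z = Mode.sleep ∧
      (∀ u ∈ Ico w z, mode u ≠ Mode.sleep) ∧ A ≤ g * idleTime mode z := by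
  obtain ⟨z, hwz, hzv, hz, hwork⟩ := h.exists_first (p := fun m => m ≠ Mode.sleep) hwv hw.1
    (by simpa using hv)
  rw [not_not] at hz
  refine ⟨z, hwz, hzv, hz, hwork, ?_⟩
  obtain ⟨m, hm, hnext, -⟩ := h.step z
  have hI : ∀ᶠ u in 𝓝[<] z, u ∈ Ico w z := Ico_mem_nhdsLT hwz
  obtain ⟨u, hu, hu'⟩ := (hm.and hI).exists
  have hmne : m ≠ Mode.sleep := hu ▸ hwork u hu'
  rw [hz] at hnext
  by_contra hle
  cases m <;> simp only [nextMode, hle, if_false] at hnext <;> split_ifs at hnext; simp_all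

/-- A working phase ends when no job is pending. -/
theorem exists_end_of_working {w v : ℝ} (hwv : w ≤ v) (hw : mode w = Mode.working)
    (hv : mode v ≠ Mode.working) : ∃ e, w < e ∧ e ≤ v ∧ plannedSpeed jobs S e = 0 ∧
      ∀ u ∈ Ico w e, mode u = Mode.working := by
  obtain ⟨e, hwe, hev, he, hwork⟩ := h.exists_first (p := fun m => m = Mode.working) hwv hw hv
  refine ⟨e, hwe, hev, ?_, hwork⟩
  have hI : ∀ᶠ u in 𝓝[<] e, mode u = Mode.working := by
    filter_upwards [Ico_mem_nhdsLT hwe] with u hu using hwork u hu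
  have hnext := h.mode_eq_nextMode hI
  refine le_antisymm (not_lt.1 fun hpos => he ?_) (plannedSpeed_nonneg _ _ _)
  rw [hnext]
  simp [nextMode, hpos]

/-- During the first working phase after a wake-up, the deadline of some processed job passes. -/
theorem exists_deadline_le {w u : ℝ} (hsc : 0 < sc) (hw : IsWake mode w) (hwu : w ≤ u)
    (hu : mode u ≠ Mode.working) :
    ∃ j t, w ≤ t ∧ S.Pending jobs j t ∧ (jobs j).deadline ≤ u := by
  -- At the end `e` of the phase nothing is pending. If no processed job were due by `u`, all work
  -- on `[w, e)` would run at speed at most `sc`. A density with horizon `x > e` would then satisfy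
  -- `ρ(w) * (x - w) ≤ sc * (e - w)`, contrary to `ρ(w) ≥ sc`.
  obtain ⟨hwork, hρ, hscρ⟩ := h.wake_spec hw
  obtain ⟨e, hwe, heu, hρe, hall⟩ := h.exists_end_of_working hwu hwork hu
  by_contra! hn
  have hlate : ∀ t ∈ Ico w e, ∀ j, 0 < S.rate j t → e < (jobs j).deadline := fun t ht j hj =>
    heu.trans_lt (hn j t ht.1 (h.pending_of_rate_pos hj))
  have hspeed : ∀ t ∈ Ico w e, ∀ j, 0 < S.rate j t → e < (jobs j).deadline → S.speed t ≤ sc :=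
    fun t ht j hj hje => by
      have := h.speed_le_max le_rfl hρe.le ht hj hje
      rwa [max_eq_right hsc.le] at this
  obtain ⟨j, hj⟩ := h.exists_rate_pos_of_working hwork
  have hje := hlate w ⟨le_rfl, hwe⟩ j hj
  obtain ⟨x, hx, hle⟩ := h.plannedSpeed_mul_le hwe.le hρe.le hsc.le hspeed hj hje
  nlinarith [mul_le_mul_of_nonneg_right hscρ (by linarith : 0 ≤ x - w)]

/-- A job that is pending after a wake-up was released after the preceding wake-up. -/
theorem lt_release {w' w t : ℝ} (hw' : IsWake mode w') (hw : IsWake mode w) (hlt : w' < w)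
    (hwt : w ≤ t) {j : Fin n} (hj : S.Pending jobs j t) : w' < (jobs j).release := by
  obtain ⟨v, hv1, hv2, hv⟩ := hw.exists_sleep hlt
  -- The first working phase of the earlier period ends at `e` with nothing pending, so jobs pending
  -- later are released after `e`.
  obtain ⟨e, hwe, hev, hρe, -⟩ := h.exists_end_of_working hv1.le (h.wake_spec hw').1
    (by rw [hv]; simp)
  refine hwe.trans (not_le.1 fun hrel => ?_)
  refine h.not_pending_of_plannedSpeed_eq_zero hρe j ⟨hrel, hj.2.trans_le ?_⟩
  exact Schedule.antitone_remaining (h.integrable_rate j) (by linarith)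

/-- Each pair of a sleeping and a later active time encloses a wake-up, and successive pairs enclose
distinct ones. -/
theorem wakeUps_le : S.wakeUps ≤ (h.finite_wake.toFinset.card : ENNReal) := by
  refine iSup₂_le fun m ⟨t, hmono, halt⟩ => Nat.cast_le.2 ?_
  have hex : ∀ i < m, ∃ w, t (2 * i) < w ∧ w ≤ t (2 * i + 1) ∧ IsWake mode w := fun i hi => by
    obtain ⟨h1, h2⟩ := halt i hi
    rw [h.active_iff] at h1 h2
    rw [not_not] at h1
    obtain ⟨w, hw1, hw2, hw3, -⟩ := h.exists_wake (hmono (Nat.lt_succ_self _)).le h1 h2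
    exact ⟨w, hw1, hw2, hw3⟩
  choose! w hw1 hw2 hw3 using hex
  rw [← Finset.card_range m]
  have hlt : ∀ i < m, ∀ k < m, i < k → w i < w k := fun i hi k hk hik =>
    (hw2 i hi).trans_lt ((hmono.monotone (by omega : 2 * i + 1 ≤ 2 * k)).trans_lt (hw1 k hk))
  refine Finset.card_le_card_of_injOn w (fun i hi => ?_) fun i hi k hk hik => ?_
  · simpa using hw3 i (Finset.mem_range.1 hi)
  · have hi' := Finset.mem_range.1 hi
    have hk' := Finset.mem_range.1 hk
    rcases lt_trichotomy i k with hlt' | heq | hlt'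
    · exact absurd hik (hlt i hi' k hk' hlt').ne
    · exact heq
    · exact absurd hik (hlt k hk' i hi' hlt').ne'

/-- Without static power there is at most one wake-up. -/
theorem wakeUps_le_of_static_eq_zero (hg : g = 0) (hA : 0 < A) (hS' : S'.Feasible jobs) :
    S.wakeUps ≤ S'.wakeUps := by
  have hnever : ∀ w, IsWake mode w → ∀ v, w ≤ v → mode v ≠ Mode.sleep := fun w hw v hwv hv => by
    obtain ⟨z, -, -, -, -, hz⟩ := h.exists_sleep_of_sleep hw hwv hv
    rw [hg, zero_mul] at hz
    exact absurd hA (not_lt.2 hz)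
  have hle : ∀ w w', IsWake mode w → IsWake mode w' → w' ≤ w := fun w w' hw hw' =>
    (le_total w' w).elim id fun hle =>
      hw'.le_of_forall_ne_sleep (u := w') (fun v hv => hnever w hw v hv.1) le_rfl
  refine h.wakeUps_le.trans ?_
  rcases h.finite_wake.toFinset.eq_empty_or_nonempty with he | ⟨w, hw⟩
  · simp [he]
  · rw [Set.Finite.mem_toFinset] at hw
    have hcard : h.finite_wake.toFinset.card ≤ 1 := Finset.card_le_one.2 fun a ha b hb => by
      rw [Set.Finite.mem_toFinset] at ha hb
      exact le_antisymm (hle b a hb ha) (hle a b ha hb)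
    refine (Nat.cast_le.2 hcard).trans ?_
    obtain ⟨j, -⟩ := h.exists_rate_pos_of_working (h.wake_spec hw).1
    obtain ⟨y, hy, -⟩ := hS'.exists_active j
    have hy0 : 0 ≤ y := S'.active_subset hy
    have hm : (-1 : ℝ) ∉ S'.active := fun hm => by
      have : (0 : ℝ) ≤ -1 := S'.active_subset hm
      linarith
    exact Schedule.le_wakeUps ((wakesBefore_zero S'.active (-1)).succ hm hy (by linarith)
      (lt_add_one y))

/-- With static power, each period uses up its idle budget. -/
theorem exists_period_end (hg : 0 < g) {w : ℝ} (hw : IsWake mode w) :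
    ∃ z, w < z ∧ mode z = Mode.sleep ∧ (∀ u ∈ Ico w z, mode u ≠ Mode.sleep) ∧
      ENNReal.ofReal g * volume ({u | mode u = Mode.idle} ∩ Ico w z) = ENNReal.ofReal A := by
  have hex : ∃ v, w ≤ v ∧ mode v = Mode.sleep := by
    by_contra! hn
    set D := max w (∑ j, |(jobs j).deadline|) with hD
    have hA : 0 ≤ |A| / g := by positivity
    -- Without sleep the machine would idle from `D` on, and by time `t` it would have spent `|A| +
    -- g > A`.
    set t := D + (|A| / g + 1) with ht
    have hDt : D < t := by linarith
    have hwt : w ≤ t := (le_max_left _ _).trans hDt.le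
    have hidle : ∀ u, D < u → mode u = Mode.idle := fun u hu => by
      have h1 : mode u ≠ Mode.sleep := hn u ((le_max_left _ _).trans hu.le)
      have h2 : mode u ≠ Mode.working := fun hm =>
        absurd (h.working_subset hm).2 (not_le.2 ((le_max_right _ _).trans_lt hu))
      revert h1 h2
      cases mode u <;> simp
    have hb := h.idle_budget (hidle t hDt)
    rw [hw.idleTime_eq hwt fun v hv => hn v hv.1] at hb
    have hvol : t - D ≤ volume.real ({u | mode u = Mode.idle} ∩ Ico w t) := by
      rw [← Real.volume_real_Ioo_of_le hDt.le]
      exact measureReal_mono (fun u hu => ⟨hidle u hu.1, (le_max_left _ _).trans hu.1.le, hu.2⟩)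
        ((measure_mono inter_subset_right).trans_lt measure_Ico_lt_top).ne
    have h1 : g * (t - D) ≤ A := (mul_le_mul_of_nonneg_left hvol hg.le).trans hb.le
    have h2 : g * (t - D) = |A| + g := by
      rw [ht, add_sub_cancel_left, mul_add, mul_div_cancel₀ _ hg.ne', mul_one]
    linarith [le_abs_self A]
  obtain ⟨v, hwv, hv⟩ := hex
  obtain ⟨z, hwz, -, hz, hno, hA⟩ := h.exists_sleep_of_sleep hw hwv hv
  refine ⟨z, hwz, hz, hno, le_antisymm ?_ ?_⟩
  -- The budget is not exceeded at any idle time, while at `z` it is used up; so the idle energy is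
  -- exactly `A`.
  · have hK : volume ({u | mode u = Mode.idle} ∩ Ico w z) ≤ ENNReal.ofReal (A / g) := by
      refine measure_le_of_forall_inter_Iio_le (fun t ht => ?_) ⟨z, fun u hu => hu.2.2.le⟩
      have hb := h.idle_budget ht.1
      rw [hw.idleTime_eq ht.2.1 fun v hv => hno v ⟨hv.1, hv.2.trans ht.2.2⟩] at hb
      rw [inter_assoc, Ico_inter_Iio, min_eq_right ht.2.2.le, ← ENNReal.ofReal_toReal
        ((measure_mono inter_subset_right).trans_lt measure_Ico_lt_top).ne]
      refine ENNReal.ofReal_le_ofReal ?_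
      rw [le_div_iff₀ hg, mul_comm]
      exact hb.le
    calc _ ≤ ENNReal.ofReal g * ENNReal.ofReal (A / g) := by gcongr
      _ = ENNReal.ofReal A := by rw [← ENNReal.ofReal_mul hg.le, mul_div_cancel₀ _ hg.ne']
  · rw [hw.idleTime_eq hwz.le hno] at hA
    rw [← ENNReal.ofReal_toReal
      ((measure_mono inter_subset_right).trans_lt (measure_Ico_lt_top (a := w) (b := z))).ne,
      ← ENNReal.ofReal_mul hg.le]
    exact ENNReal.ofReal_le_ofReal hA

/-- The other schedule wakes up at least once for every two periods in which it sleeps at some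
idle time. -/
theorem card_le_two_mul_wakeUps (hsc : 0 < sc) (hS' : S'.Feasible jobs) (B : Finset ℝ) (u : ℝ → ℝ)
    (hB : ∀ w ∈ B, IsWake mode w ∧ w ≤ u w ∧ mode (u w) = Mode.idle ∧
      (∀ v ∈ Ico w (u w), mode v ≠ Mode.sleep) ∧ u w ∉ S'.active) :
    (B.card : ENNReal) ≤ 2 * S'.wakeUps := by
  have hhit : ∀ w ∈ B, ∃ j t y, w ≤ t ∧ S.Pending jobs j t ∧ y ∈ S'.active ∧
      (jobs j).release ≤ y ∧ y < u w := fun w hw => by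
    obtain ⟨hwake, hwu, hidle, -, hout⟩ := hB w hw
    obtain ⟨j, t, hwt, hj, hd⟩ := h.exists_deadline_le hsc hwake hwu (by rw [hidle]; simp)
    obtain ⟨y, hy, hry, hyd⟩ := hS'.exists_active j
    exact ⟨j, t, y, hwt, hj, hy, hry, (hyd.trans hd).lt_of_ne fun he => hout (he ▸ hy)⟩
  have hm : (-1 : ℝ) ∉ S'.active := fun hm => by
    have : (0 : ℝ) ≤ -1 := S'.active_subset hm
    linarith
  set b := B.orderEmbOfFin rfl with hb
  have hbmem : ∀ i, b i ∈ B := fun i => B.orderEmbOfFin_mem rfl i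
  -- In each period, `S'` must serve a job released after the preceding wake-up of the run and due
  -- by the chosen idle time. From period `k` to period `k + 2`, the sleep of `S'` at the earlier
  -- idle time precedes that release, so `S'` wakes up in between. One period in the middle is lost,
  -- whence the factor `2`.
  have key : ∀ i (hi : i < B.card), WakesBefore S'.active ((i + 2) / 2) (u (b ⟨i, hi⟩)) := by
    intro i
    induction i using Nat.strong_induction_on with
    | _ i ih =>
      intro hi
      obtain ⟨j, t, y, hwt, hj, hy, hry, hyu⟩ := hhit _ (hbmem ⟨i, hi⟩)
      have hy0 : 0 ≤ y := S'.active_subset hy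
      rcases lt_or_ge i 2 with hi2 | hi2
      · have : (i + 2) / 2 = 0 + 1 := by omega
        rw [this]
        exact (wakesBefore_zero S'.active (-1)).succ hm hy (by linarith) hyu
      · obtain ⟨k, rfl⟩ : ∃ k, i = k + 2 := ⟨i - 2, by omega⟩
        have : (k + 2 + 2) / 2 = (k + 2) / 2 + 1 := by omega
        rw [this]
        have hw1 := hB _ (hbmem ⟨k, by omega⟩)
        have hw2 := hB _ (hbmem ⟨k + 1, by omega⟩)
        have hw3 := hB _ (hbmem ⟨k + 2, hi⟩)
        have hlt12 : b ⟨k, by omega⟩ < b ⟨k + 1, by omega⟩ := b.strictMono (by simp)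
        have hlt23 : b ⟨k + 1, by omega⟩ < b ⟨k + 2, hi⟩ := b.strictMono (by simp)
        have hrel := h.lt_release hw2.1 hw3.1 hlt23 hwt hj
        have hu1 : u (b ⟨k, by omega⟩) < b ⟨k + 1, by omega⟩ := not_le.1 fun hle =>
          not_lt.2 (hw2.1.le_of_forall_ne_sleep hw1.2.2.2.1 hle) hlt12
        exact (ih k (by omega) (by omega)).succ hw1.2.2.2.2 hy (by linarith) hyu
  rcases Nat.eq_zero_or_pos B.card with h0 | hpos
  · simp [h0]
  · have hlast := Schedule.le_wakeUps (key (B.card - 1) (by omega))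
    calc (B.card : ENNReal) ≤ ((2 * ((B.card - 1 + 2) / 2) : ℕ) : ENNReal) :=
          Nat.cast_le.2 (by omega)
      _ = 2 * (((B.card - 1 + 2) / 2 : ℕ) : ENNReal) := by push_cast; rfl
      _ ≤ 2 * S'.wakeUps := by gcongr

/-- The idle and wake-up energy is paid by the static energy of the idle times at which the other
schedule is active and by its wake-ups. -/
theorem idle_energy_add_le (hA : 0 < A) (hg : 0 ≤ g) (hsc : 0 < g → 0 < sc)
    (hS' : S'.Feasible jobs) :
    ENNReal.ofReal g * volume {t | mode t = Mode.idle} + ENNReal.ofReal A * S.wakeUps ≤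
      ENNReal.ofReal (2 * g) * volume ({t | mode t = Mode.idle} ∩ S'.active) +
        4 * (ENNReal.ofReal A * S'.wakeUps) := by
  classical
  rcases hg.eq_or_lt with hg0 | hg0
  · have hle := h.wakeUps_le_of_static_eq_zero hg0.symm hA hS'
    rw [← hg0, mul_zero, ENNReal.ofReal_zero, zero_mul, zero_mul, zero_add, zero_add]
    calc ENNReal.ofReal A * S.wakeUps ≤ 1 * (ENNReal.ofReal A * S'.wakeUps) := by
          rw [one_mul]; gcongr
      _ ≤ 4 * (ENNReal.ofReal A * S'.wakeUps) := by
          gcongr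
          norm_num
  set I := {t | mode t = Mode.idle} with hI
  set Wk := h.finite_wake.toFinset with hWk
  have hmem : ∀ w, w ∈ Wk ↔ IsWake mode w := fun w => by rw [hWk, Set.Finite.mem_toFinset]; rfl
  have hz : ∀ w, ∃ z, IsWake mode w → w < z ∧ mode z = Mode.sleep ∧
      (∀ u ∈ Ico w z, mode u ≠ Mode.sleep) ∧
      ENNReal.ofReal g * volume (I ∩ Ico w z) = ENNReal.ofReal A := fun w => by
    by_cases hw : IsWake mode w
    · obtain ⟨z, hz⟩ := h.exists_period_end hg0 hw
      exact ⟨z, fun _ => hz⟩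
    · exact ⟨w, fun hw' => absurd hw' hw⟩
  choose z hz using hz
  have hdisj : (Wk : Set ℝ).PairwiseDisjoint fun w => I ∩ Ico w (z w) := by
    have : ∀ w ∈ Wk, ∀ w' ∈ Wk, ∀ x, x ∈ Ico w (z w) → x ∈ Ico w' (z w') → w' ≤ w :=
      fun w hw w' hw' x hx hx' => ((hmem w').1 hw').le_of_forall_ne_sleep (u := x)
        (fun v hv => (hz w ((hmem w).1 hw)).2.2.1 v ⟨hv.1, hv.2.trans hx.2⟩) hx'.1
    intro w hw w' hw' hne
    refine disjoint_left.2 fun x hx hx' => hne ?_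
    exact le_antisymm (this w' hw' w hw x hx'.2 hx.2) (this w hw w' hw' x hx.2 hx'.2)
  have hunion : I = ⋃ w ∈ Wk, I ∩ Ico w (z w) := by
    refine subset_antisymm (fun t ht => ?_) (iUnion₂_subset fun w _ => inter_subset_left)
    have hns : mode t ≠ Mode.sleep := by
      have : mode t = Mode.idle := ht
      rw [this]
      simp
    have ht0 := h.nonneg_of_ne_sleep hns
    obtain ⟨w, hw1, hw2, hw, hno⟩ := h.exists_wake (s := -1) (by linarith)
      (h.initial _ (by norm_num)) hns
    obtain ⟨hwz, hzs, -, -⟩ := hz w hw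
    exact mem_iUnion₂.2 ⟨w, (hmem w).2 hw, ht, hw2, not_le.1 fun hzt => hno _ ⟨hwz.le, hzt⟩ hzs⟩
  have hImeas : ∀ w, MeasurableSet (I ∩ Ico w (z w)) := fun w =>
    h.measurableSet_idle.inter measurableSet_Ico
  have hvolI : volume I = ∑ w ∈ Wk, volume (I ∩ Ico w (z w)) := by
    conv_lhs => rw [hunion]
    exact measure_biUnion_finset hdisj fun w _ => hImeas w
  have hvolI' : volume (I ∩ S'.active) = ∑ w ∈ Wk, volume (I ∩ Ico w (z w) ∩ S'.active) := by
    conv_lhs => rw [hunion, iUnion₂_inter]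
    refine measure_biUnion_finset (fun w hw w' hw' hne => ?_)
      fun w _ => (hImeas w).inter S'.measurableSet_active
    exact (hdisj hw hw' hne).mono inter_subset_left inter_subset_left
  -- Periods in which `S'` sleeps at some idle time; in the others the whole idle energy `A` counts
  -- twice in the slack.
  set B := Wk.filter fun w => ∃ u ∈ I ∩ Ico w (z w), u ∉ S'.active with hB
  have hBex : ∀ w, ∃ u, w ∈ B → u ∈ I ∩ Ico w (z w) ∧ u ∉ S'.active := fun w => by
    by_cases hw : w ∈ B
    · obtain ⟨u, hu⟩ := (Finset.mem_filter.1 hw).2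
      exact ⟨u, fun _ => hu⟩
    · exact ⟨w, fun hw' => absurd hw' hw⟩
  choose u hu using hBex
  have hcard : (B.card : ENNReal) ≤ 2 * S'.wakeUps := by
    refine h.card_le_two_mul_wakeUps (hsc hg0) hS' B u fun w hw => ?_
    have hw' := (hmem w).1 (Finset.mem_filter.1 hw).1
    obtain ⟨⟨hidle, hIco⟩, hout⟩ := hu w hw
    exact ⟨hw', hIco.1, hidle, fun v hv => (hz w hw').2.2.1 v ⟨hv.1, hv.2.trans hIco.2⟩, hout⟩
  have hterm : ∀ w ∈ Wk, ENNReal.ofReal g * volume (I ∩ Ico w (z w)) + ENNReal.ofReal A ≤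
      ENNReal.ofReal (2 * g) * volume (I ∩ Ico w (z w) ∩ S'.active) +
        if w ∈ B then 2 * ENNReal.ofReal A else 0 := by
    intro w hw
    have hA' := (hz w ((hmem w).1 hw)).2.2.2
    split_ifs with hwB
    · rw [hA', ← two_mul]
      exact le_add_self
    · have hsub : I ∩ Ico w (z w) ∩ S'.active = I ∩ Ico w (z w) :=
        inter_eq_left.2 fun x hx => by
          by_contra hx'
          exact hwB (Finset.mem_filter.2 ⟨hw, x, hx, hx'⟩)
      rw [hsub, ENNReal.ofReal_mul zero_le_two, mul_assoc, hA', add_zero, ← two_mul]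
      simp
  calc ENNReal.ofReal g * volume I + ENNReal.ofReal A * S.wakeUps
      ≤ ENNReal.ofReal g * volume I + ENNReal.ofReal A * Wk.card := by
        gcongr
        exact h.wakeUps_le
    _ = ∑ w ∈ Wk, (ENNReal.ofReal g * volume (I ∩ Ico w (z w)) + ENNReal.ofReal A) := by
        rw [hvolI, Finset.mul_sum, Finset.sum_add_distrib, Finset.sum_const, nsmul_eq_mul,
          mul_comm (ENNReal.ofReal A)]
    _ ≤ ∑ w ∈ Wk, (ENNReal.ofReal (2 * g) * volume (I ∩ Ico w (z w) ∩ S'.active) +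
          if w ∈ B then 2 * ENNReal.ofReal A else 0) := Finset.sum_le_sum hterm
    _ = ENNReal.ofReal (2 * g) * volume (I ∩ S'.active) + B.card * (2 * ENNReal.ofReal A) := by
        rw [Finset.sum_add_distrib, ← Finset.mul_sum, ← hvolI', ← Finset.sum_filter,
          Finset.filter_mem_eq_inter, Finset.inter_eq_right.2 (Finset.filter_subset _ _),
          Finset.sum_const, nsmul_eq_mul]
    _ ≤ ENNReal.ofReal (2 * g) * volume (I ∩ S'.active) +
          2 * S'.wakeUps * (2 * ENNReal.ofReal A) := by gcongr
    _ = _ := by ring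

/-! ### Adding up the two accounts -/

theorem energy_eq (hα : 1 ≤ α) : S.energy α g A =
    (∫⁻ t in {t | mode t = Mode.working}, ENNReal.ofReal (power α g (S.speed t))) +
      ENNReal.ofReal g * volume {t | mode t = Mode.idle} + ENNReal.ofReal A * S.wakeUps := by
  have hact : S.active = {t | mode t = Mode.working} ∪ {t | mode t = Mode.idle} := by
    ext t
    rw [h.active_iff, Set.mem_union, mem_ofPred_eq, mem_ofPred_eq]
    cases mode t <;> simp
  have hdisj : Disjoint {t | mode t = Mode.working} {t | mode t = Mode.idle} :=
    disjoint_left.2 fun t ht ht' => by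
      have h1 : mode t = Mode.working := ht
      have h2 : mode t = Mode.idle := ht'
      rw [h1] at h2
      cases h2
  rw [Schedule.energy, hact, lintegral_union h.measurableSet_idle hdisj, ← setLIntegral_const]
  congr 2
  refine setLIntegral_congr_fun h.measurableSet_idle fun t ht => ?_
  have hi : mode t = Mode.idle := ht
  rw [h.speed_eq_zero (by rw [hi]; simp), power, Real.zero_rpow (by linarith), zero_add]

/-- The algorithm is `max 4 (α ^ α)`-competitive. -/
theorem energy_le (hα : 1 ≤ α) (hg : 0 ≤ g) (hA : 0 < A) (hsc : IsCriticalSpeed α g sc)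
    (hS' : S'.Feasible jobs) :
    S.energy α g A ≤ ENNReal.ofReal (max 4 (α ^ α)) * S'.energy α g A := by
  set c := max 4 (α ^ α) with hc
  have hc4 : 4 ≤ c := le_max_left _ _
  have h1 := h.working_energy_add_le hα hsc.nonneg hg (hsc.static_eq hα) hS'
    (c := c) (by linarith) (le_max_right _ _)
  have h2 := h.idle_energy_add_le hA hg hsc.pos hS'
  have h4 : (4 : ENNReal) ≤ ENNReal.ofReal c := by
    rw [← ENNReal.ofReal_ofNat]
    exact ENNReal.ofReal_le_ofReal hc4
  rw [h.energy_eq hα, add_assoc]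
  calc _ ≤ (∫⁻ t in {t | mode t = Mode.working}, ENNReal.ofReal (power α g (S.speed t))) +
        (ENNReal.ofReal (2 * g) * volume ({t | mode t = Mode.idle} ∩ S'.active) +
          4 * (ENNReal.ofReal A * S'.wakeUps)) := by gcongr
    _ ≤ ENNReal.ofReal c * (∫⁻ t in S'.active, ENNReal.ofReal (power α g (S'.speed t))) +
          ENNReal.ofReal c * (ENNReal.ofReal A * S'.wakeUps) := by
        rw [← add_assoc]
        gcongr
    _ = _ := by rw [Schedule.energy, mul_add]

end IsSOARun

end Periods

end SpeedScaling

theorem mainTheorem3 (α g A sc : ℝ) (hα : 1 ≤ α) (hg : 0 ≤ g) (hA : 0 < A)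
    (hsc : SpeedScaling.IsCriticalSpeed α g sc)
    (n : ℕ) (jobs : Fin n → SpeedScaling.Job) :
    (∃ (mode : ℝ → SpeedScaling.Mode) (S : SpeedScaling.Schedule n),
      SpeedScaling.IsSOARun g A sc jobs mode S) ∧
    ∀ (mode : ℝ → SpeedScaling.Mode) (S : SpeedScaling.Schedule n),
      SpeedScaling.IsSOARun g A sc jobs mode S →
        S.Feasible jobs ∧
        ∀ S' : SpeedScaling.Schedule n, S'.Feasible jobs →
          S.energy α g A ≤ ENNReal.ofReal (max 4 (α ^ α)) * S'.energy α g A := by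
  exact ⟨SpeedScaling.exists_isSOARun hg jobs, fun _ _ h =>
    ⟨h.feasible, fun _ hS' => h.energy_le hα hg hA hsc hS'⟩⟩
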